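/- **Notation.** Let $K$ be a number field of degree $n=[K:\mathbb Q]$ with $r_1$ real and $r_2$ complex places, $\mathcal O_K$ its ring of integers, $\mathfrak q=\prod_{\mathfrak p}\mathfrak p^{n_{\mathfrak p}}\subset\mathcal O_K$ a non-zero ideal and $\varphi(\mathfrak q)=\#(\mathcal O_K/\mathfrak q)^\times$. Let $$C(\mathfrak q)=\Bigl((K\otimes_{\mathbb Q}\mathbb R)^\times\times\bigoplus_{\mathfrak p\mid\mathfrak q}K^\times/(1+\mathfrak p^{n_{\mathfrak p}}\mathcal O_{K,\mathfrak p})\times\bigoplus_{\mathfrak p\nmid\mathfrak q}\mathbb Z\Bigr)\Big/K^\times$$ (with $K^\times$ embedded diagonally, through the valuation $v_{\mathfrak p}$ at $\mathfrak p\nmid\mathfrak q$; all factors except the first are discrete), and let $T=C(\mathfrak q)/\mathbb R_{>0}$ and $B=(K\otimes_{\mathbb Q}\mathbb R)^\times/(\mathcal O_K^\times\mathbb R_{>0})$. These are compact abelian Lie groups of dimension $n-1$; $T^0,B^0$ denote their neutral components and $\pi_0(T)=T/T^0$. The subgroup $\bigl((K\otimes_{\mathbb Q}\mathbb R)^\times/\mathbb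 R_{>0}\times(\mathcal O_K/\mathfrak q)^\times\bigr)/\mathcal O_K^\times$ of $T$ is open, hence contains $T^0$, and $(x,\alpha)\mapsto x$ induces a covering map $T^0\to B^0$. Let $e\colon B^0\cong(S^1)^{n-1}=(\mathbb R/\mathbb Z)^{n-1}$ be any isomorphism of topological groups. Let $\mathbf T$ be a compact abelian Lie group with an isomorphism $\mathbf T^0\cong(\mathbb R/\mathbb Z)^d$. A *small convex subset of size $\le\delta$* of $\mathbf T$ is a connected subset $Q\subset\mathbf T$ such that, for some $p\in Q$, the translate $p^{-1}Q$ is contained in $\mathbf T^0$ and is the projection of an open convex subset of $[-\delta,\delta]^d\subset\mathbb R^d$; a *small convex subset* is one of size $\le 1/4$. Identify $(K\otimes_{\mathbb Q}\mathbb R)^\times/\mathbb R_{>0}$ with $V\times(S^1)^{r_2}\times\{\pm1\}^{r_1}$, where $V=\{x\in\mathbb R^{r_1+r_2}:\sum x_i=0\}$, by taking the representative of norm $\pm1$ and using $\log|x|$ at real and $\log|z|^2$ at complex places as coordinates in $V$. Give it the product of the Euclidean measure on $V$, the Haar measure of mass $(2\pi)^{r_2}$ on $(S^1)^{r_2}$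 and the counting measure. Then $\mathrm{Vol}$ is the Haar measure on $T$ induced by this measure and the counting measure on the discrete factors, i.e. the quotient measure under the discrete group $K^\times$. **Proposition.** There are constants $c_n>0$ and $C_n>0$ depending only on $n$, and $C_K>0$ depending only on $K$, such that the following holds for all $\mathfrak q$ and $e$ as above and all real numbers $M>1$, $Y\ge2$. Let $P\subset T$ be a connected open subset having a translate in $T^0$ on which $T^0\to B^0\cong(S^1)^{n-1}$ is injective and whose image is a small convex subset of size $\le\delta$ with respect to $e$, for some $0<\delta<1/4$ with $\delta\le c_n\,\varphi(\mathfrak q)^{-(n-2)}$. Then there are a finite set $\Xi$ of continuous characters $\psi\colon T\to S^1$, coefficients $c_\psi\in\mathbb C$ (with $c_\psi=0$ for $\psi\notin\Xi$) and functions $G,H\colon T\to\mathbb C$ such that $$1_P=\sum_{\psi\in\Xi}c_\psi\,\psi+G+H$$ and * $\#\Xi\le C_K\,\varphi(\mathfrak q)\,Y^{n-1}$; * $|c_\psi|\le1$ for all $\psi$; * $|G|\le1$ everywhere, and there is a small convex subset $P'\supset P$ of $T$ (with respect to some isomorphism $T^0\cong(S^1)^{n-1}$) with $\mathrm{Supp}(G)\subset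 P'\setminus P$ and $\mathrm{Vol}(P'\setminus P)\le C_n/M$; * $\|H\|_\infty\le C_n\,M\,\dfrac{\log Y}{Y}$. Moreover, for every character $\psi$ of $T$ that factors through $\pi_0(T)$, $$\Bigl|\,c_\psi-\frac{\mathrm{Vol}(P)}{\mathrm{Vol}(T)}\,\overline{\psi(P)}\,\Bigr|\le\frac{C_n}{M},$$ where $\psi(P)$ is the constant value of $\psi$ on the connected set $P$. -/

import Mathlib

open NumberField MeasureTheory IsDedekindDomain
open scoped ENNReal

noncomputable section

namespace IdeleTorus

universe u

/-! ### Small convex subsets of a torus -/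

/-- The projection `ℝ^d → (ℝ/ℤ)^d ≅ (S¹)^d`, `x ↦ (e^{2πi x_j})_j`. -/
def torusProj {d : ℕ} (x : Fin d → ℝ) : Fin d → Circle :=
  fun j => Circle.exp (2 * Real.pi * x j)

/-- `P` is a small convex subset of size `≤ δ` of the commutative topological group `T`, whose
neutral component `T⁰` is equipped with an isomorphism `e` to `(S¹)^d`: `P` is connected and, for
some `p ∈ P`, the translate of `P` by `p⁻¹` is the projection of an open convex subset of the cube
`[-δ, δ]^d`. -/
def IsSmallConvex {T : Type*} [CommGroup T] [TopologicalSpace T] [IsTopologicalGroup T] {d : ℕ}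
    (e : Subgroup.connectedComponentOfOne T ≃ₜ* (Fin d → Circle)) (δ : ℝ) (P : Set T) : Prop :=
  IsConnected P ∧ ∃ p ∈ P, ∃ C : Set (Fin d → ℝ),
    IsOpen C ∧ Convex ℝ C ∧ C ⊆ Set.Icc (fun _ => -δ) (fun _ => δ) ∧
      {x : T | p * x ∈ P} = (fun v => ((e.symm (torusProj v) : _) : T)) '' C

/-! ### Measures on quotients -/

/-- The measure induced on `Y` by a measure `μ` on `X` and a measurable map `π : X → Y`, thought of
as the quotient map for a measure preserving action of a countable group: the volume of a
measurable set `B` is the least volume of a measurable `U` with `B ⊆ π(U)`, which is the volume of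
the part of `π⁻¹(B)` in a fundamental domain. -/
def quotientMeasure {X Y : Type*} [MeasurableSpace X] [MeasurableSpace Y] (π : X → Y)
    (hπ : Measurable π) (μ : Measure X) : Measure Y :=
  (OuterMeasure.ofFunction
    (fun B => ⨅ (U : Set X) (_ : MeasurableSet U) (_ : B ⊆ π '' U), μ U)
    (by
      refine le_antisymm ?_ zero_le
      refine (iInf_le _ (∅ : Set X)).trans ?_
      simp)).toMeasure (by
    intro s hs
    refine OuterMeasure.ofFunction_caratheodory fun t => ?_
    refine le_iInf fun U => le_iInf fun hU => le_iInf fun htU => ?_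
    rw [← measure_inter_add_sdiff U (hπ hs)]
    refine add_le_add ?_ ?_
    · refine iInf_le_of_le (U ∩ π ⁻¹' s) (iInf_le_of_le (hU.inter (hπ hs)) (iInf_le _ ?_))
      rintro y ⟨hy, hys⟩
      obtain ⟨x, hx, rfl⟩ := htU hy
      exact ⟨x, ⟨hx, hys⟩, rfl⟩
    · refine iInf_le_of_le (U \ π ⁻¹' s) (iInf_le_of_le (hU.diff (hπ hs)) (iInf_le _ ?_))
      rintro y ⟨hy, hys⟩
      obtain ⟨x, hx, rfl⟩ := htU hy
      exact ⟨x, ⟨hx, hys⟩, rfl⟩)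

variable (K : Type u) [Field K] [NumberField K]

/-! ### The archimedean part -/

/-- `(K ⊗_ℚ ℝ)ˣ`, with `K ⊗_ℚ ℝ` realized as `ℝ^{r₁} × ℂ^{r₂}`. -/
abbrev ArchUnits : Type u := (mixedEmbedding.mixedSpace K)ˣ

/-- The diagonal map `ℝ_{>0} → (K ⊗_ℚ ℝ)ˣ`. -/
def posReal : Units.posSubgroup ℝ →* ArchUnits K :=
  (Units.map (algebraMap ℝ (mixedEmbedding.mixedSpace K) : ℝ →* _)).comp
    (Units.posSubgroup ℝ).subtype

/-- The map `Kˣ → (K ⊗_ℚ ℝ)ˣ`. -/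
def archDiag : Kˣ →* ArchUnits K :=
  Units.map (mixedEmbedding K : K →* mixedEmbedding.mixedSpace K)

/-- The subgroup `O_Kˣ · ℝ_{>0}` of `(K ⊗_ℚ ℝ)ˣ`. -/
def unitsPos : Subgroup (ArchUnits K) :=
  ((archDiag K).comp (Units.map (algebraMap (𝓞 K) K : 𝓞 K →* K))).range ⊔ (posReal K).range

/-- The torus `(K ⊗_ℚ ℝ)ˣ / (O_Kˣ · ℝ_{>0})`. -/
def BaseTorus : Type u := ArchUnits K ⧸ unitsPos K

instance : CommGroup (BaseTorus K) := inferInstanceAs (CommGroup (ArchUnits K ⧸ unitsPos K))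

instance : TopologicalSpace (BaseTorus K) :=
  inferInstanceAs (TopologicalSpace (ArchUnits K ⧸ unitsPos K))

instance : IsTopologicalGroup (BaseTorus K) :=
  inferInstanceAs (IsTopologicalGroup (ArchUnits K ⧸ unitsPos K))

/-- The quotient map onto `(K ⊗_ℚ ℝ)ˣ / (O_Kˣ · ℝ_{>0})`. -/
def toBase : ArchUnits K →* BaseTorus K := QuotientGroup.mk' (unitsPos K)

/-- The hyperplane `H = {x | ∑ x_i = 0}` of `ℝ^{r₁+r₂}` with its induced Euclidean structure. -/
def traceZero : Submodule ℝ (EuclideanSpace ℝ (InfinitePlace K)) :=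
  LinearMap.ker (∑ w : InfinitePlace K, (EuclideanSpace.proj (𝕜 := ℝ) w).toLinearMap)

instance fact_two_pi : Fact (0 < 2 * Real.pi) := ⟨Real.two_pi_pos⟩

/-- The space `H × (S¹)^{r₂} × {±1}^{r₁}`, with `S¹` viewed as `ℝ/2πℤ`. -/
abbrev ArchCoord : Type u :=
  traceZero K × ({w : InfinitePlace K // w.IsComplex} → AddCircle (2 * Real.pi)) ×
    ({w : InfinitePlace K // w.IsReal} → ℤˣ)

open scoped Classical in
/-- The product of the Euclidean measure on `H`, the measure of total mass `(2π)^{r₂}` on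
`(S¹)^{r₂}`, and the counting measure on `{±1}^{r₁}`. -/
def archMeasure : Measure (ArchCoord K) :=
  (stdOrthonormalBasis ℝ (traceZero K)).toBasis.addHaar.prod
    ((Measure.pi fun _ => volume).prod Measure.count)

/-- The element of `(K ⊗_ℚ ℝ)ˣ` with given coordinates in `H × (S¹)^{r₂} × {±1}^{r₁}`; it is the
representative of norm `±1` of its class modulo `ℝ_{>0}`. The coordinate in `H` at a real
(resp. complex) place is `log |x|` (resp. `log |z|²`). -/
def archPoint (a : ArchCoord K) : ArchUnits K :=
  MulEquiv.prodUnits.symm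
    (MulEquiv.piUnits.symm fun w =>
        Units.mk0 (((a.2.2 w : ℤ) : ℝ) * Real.exp ((a.1 : EuclideanSpace ℝ _) w.1))
          (mul_ne_zero (by simp) (Real.exp_ne_zero _)),
      MulEquiv.piUnits.symm fun w =>
        Units.mk0 (((a.2.1 w).toCircle : ℂ) *
            (Real.exp ((a.1 : EuclideanSpace ℝ _) w.1 / 2) : ℂ))
          (mul_ne_zero (Circle.coe_ne_zero _) (by simp [Complex.exp_ne_zero])))

/-! ### The finite part -/

variable {K}

/-- The group `O_{K,p}ˣ` of `x ∈ Kˣ` with `v_p(x) = 0`. -/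
def localUnits (p : HeightOneSpectrum (𝓞 K)) : Subgroup Kˣ :=
  (Units.map (p.valuation K).toMonoidWithZeroHom.toMonoidHom).ker

/-- The group of `x ∈ O_{K,p}ˣ` with `v_p(x - 1) ≥ m`. This is `1 + p^m O_{K,p}` for `m ≥ 1`. -/
def higherUnits (p : HeightOneSpectrum (𝓞 K)) (m : ℕ) : Subgroup Kˣ where
  carrier := {x | p.valuation K (x : K) = 1 ∧
    p.valuation K ((x : K) - 1) ≤ WithZero.exp (-(m : ℤ))}
  one_mem' := by simp
  mul_mem' := by
    rintro x y ⟨hx, hx'⟩ ⟨hy, hy'⟩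
    refine ⟨by simp [hx, hy], ?_⟩
    have : ((x * y : Kˣ) : K) - 1 = x * (y - 1) + (x - 1) := by push_cast; ring
    rw [this]
    refine (p.valuation K).map_add_le ?_ hx'
    rw [map_mul, hx, one_mul]
    exact hy'
  inv_mem' := by
    rintro x ⟨hx, hx'⟩
    refine ⟨by simp [hx], ?_⟩
    have : ((x⁻¹ : Kˣ) : K) - 1 = (x⁻¹ : Kˣ) * -((x : K) - 1) := by
      have := x.inv_mul
      linear_combination this
    rw [this, map_mul, Valuation.map_neg]
    simpa [hx] using hx'

variable (q : Ideal (𝓞 K))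

/-- `⨁_{p ∣ q} Kˣ/(1 + p^{n_p} O_{K,p}) × ⨁_{p ∤ q} ℤ`, where `q = ∏ p^{n_p}`. -/
def FinitePart : Type u :=
  ((p : {p : HeightOneSpectrum (𝓞 K) // p.asIdeal ∣ q}) →
      Kˣ ⧸ higherUnits p.1 (multiplicity p.1.asIdeal q)) ×
    Multiplicative ({p : HeightOneSpectrum (𝓞 K) // ¬ p.asIdeal ∣ q} →₀ ℤ)

instance : CommGroup (FinitePart q) :=
  inferInstanceAs (CommGroup
    (((p : {p : HeightOneSpectrum (𝓞 K) // p.asIdeal ∣ q}) →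
      Kˣ ⧸ higherUnits p.1 (multiplicity p.1.asIdeal q)) ×
    Multiplicative ({p : HeightOneSpectrum (𝓞 K) // ¬ p.asIdeal ∣ q} →₀ ℤ)))

/-- The finite part is a discrete group. -/
instance : TopologicalSpace (FinitePart q) := ⊥

instance : DiscreteTopology (FinitePart q) := ⟨rfl⟩

instance : MeasurableSpace (FinitePart q) := ⊤

/-- The normalized `p`-adic valuation `v_p : Kˣ → ℤ`. -/
def ord (p : HeightOneSpectrum (𝓞 K)) (x : Kˣ) : ℤ :=
  -(WithZero.log (p.valuation K (x : K)))

theorem ord_finite (x : Kˣ) : {p : HeightOneSpectrum (𝓞 K) | ord p x ≠ 0}.Finite := by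
  refine ((HeightOneSpectrum.Support.finite (𝓞 K) (x : K)).union
    (HeightOneSpectrum.Support.finite (𝓞 K) ((x⁻¹ : Kˣ) : K))).subset fun p hp => ?_
  by_contra h
  simp only [HeightOneSpectrum.Support, Set.mem_union, Set.mem_ofPred_eq, not_or, not_lt] at h
  apply hp
  have h0 : p.valuation K (x : K) ≠ 0 := by simp
  have h1 : p.valuation K (x : K) = 1 := by
    refine le_antisymm h.1 ?_
    have h2 := h.2
    rw [Units.val_inv_eq_inv_val, map_inv₀] at h2
    exact (inv_le_one₀ (zero_lt_iff.mpr h0)).mp h2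
  simp [ord, h1]

theorem ord_one (p : HeightOneSpectrum (𝓞 K)) : ord p (1 : Kˣ) = 0 := by simp [ord]

theorem ord_mul (p : HeightOneSpectrum (𝓞 K)) (x y : Kˣ) :
    ord p (x * y) = ord p x + ord p y := by
  simp only [ord, Units.val_mul, map_mul]
  rw [WithZero.log_mul (by simp) (by simp)]
  ring

/-- The family of valuations `(v_p(x))_{p ∤ q}` of `x ∈ Kˣ`. -/
def ordFamily : Kˣ →* Multiplicative ({p : HeightOneSpectrum (𝓞 K) // ¬ p.asIdeal ∣ q} →₀ ℤ) where
  toFun x := Multiplicative.ofAdd (Finsupp.ofSupportFinite (fun p => ord p.1 x)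
    ((ord_finite x).preimage Subtype.val_injective.injOn))
  map_one' := by
    rw [← ofAdd_zero]
    congr 1
    ext p
    exact ord_one p.1
  map_mul' x y := by
    rw [← ofAdd_add]
    congr 1
    ext p
    exact ord_mul p.1 x y

theorem ordFamily_apply (x : Kˣ) (p : {p : HeightOneSpectrum (𝓞 K) // ¬ p.asIdeal ∣ q}) :
    (ordFamily q x).toAdd p = ord p.1 x := rfl

/-- The map of `Kˣ` to the finite part. -/
def finiteDiag : Kˣ →* FinitePart q :=
  MonoidHom.prod (MonoidHom.pi fun _ => QuotientGroup.mk' _) (ordFamily q)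

/-- The elements of the finite part all of whose valuations are zero; this is `(O_K/q)ˣ`. -/
def finiteUnits : Subgroup (FinitePart q) :=
  Subgroup.prod
    (Subgroup.pi Set.univ fun p => (localUnits p.1).map (QuotientGroup.mk' _)) ⊥

/-! ### The idele class group modulo `q` -/

/-- `(K ⊗_ℚ ℝ)ˣ × ⨁_{p ∣ q} Kˣ/(1 + p^{n_p} O_{K,p}) × ⨁_{p ∤ q} ℤ`. -/
abbrev PreClassGroup : Type u := ArchUnits K × FinitePart q

/-- The diagonal map of `Kˣ`. -/
def principal : Kˣ →* PreClassGroup q := (archDiag K).prod (finiteDiag q)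

/-- The idele class group `C(q)` modulo `q`. -/
def ClassGroupMod : Type u := PreClassGroup q ⧸ (principal q).range

instance : CommGroup (ClassGroupMod q) :=
  inferInstanceAs (CommGroup (PreClassGroup q ⧸ (principal q).range))

instance : TopologicalSpace (ClassGroupMod q) :=
  inferInstanceAs (TopologicalSpace (PreClassGroup q ⧸ (principal q).range))

instance : IsTopologicalGroup (ClassGroupMod q) :=
  inferInstanceAs (IsTopologicalGroup (PreClassGroup q ⧸ (principal q).range))

/-- The quotient map onto `C(q)`. -/
def toClassGroupMod : PreClassGroup q →* ClassGroupMod q :=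
  QuotientGroup.mk' (principal q).range

/-- The image of `ℝ_{>0}` in `C(q)`. -/
def posClasses : Subgroup (ClassGroupMod q) :=
  ((toClassGroupMod q).comp
    ((MonoidHom.inl (ArchUnits K) (FinitePart q)).comp (posReal K))).range

/-- The torus `C(q)/ℝ_{>0}`. -/
def ClassTorus : Type u := ClassGroupMod q ⧸ posClasses q

instance : CommGroup (ClassTorus q) :=
  inferInstanceAs (CommGroup (ClassGroupMod q ⧸ posClasses q))

instance : TopologicalSpace (ClassTorus q) :=
  inferInstanceAs (TopologicalSpace (ClassGroupMod q ⧸ posClasses q))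

instance : IsTopologicalGroup (ClassTorus q) :=
  inferInstanceAs (IsTopologicalGroup (ClassGroupMod q ⧸ posClasses q))

instance : MeasurableSpace (ClassTorus q) := borel _

instance : BorelSpace (ClassTorus q) := ⟨rfl⟩

/-- The quotient map onto `C(q)/ℝ_{>0}`. -/
def toTorus : PreClassGroup q →* ClassTorus q :=
  (QuotientGroup.mk' (posClasses q)).comp (toClassGroupMod q)

theorem toTorus_eq_one {s : PreClassGroup q} (h : toTorus q s = 1) :
    ∃ (k : Kˣ) (r : Units.posSubgroup ℝ), s = principal q k * (posReal K r, 1) := by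
  obtain ⟨r, hr⟩ := (QuotientGroup.eq_one_iff (N := posClasses q) (toClassGroupMod q s)).mp h
  obtain ⟨k, hk⟩ := (QuotientGroup.eq (s := (principal q).range)).mp hr
  refine ⟨k, r, ?_⟩
  rw [hk, mul_comm]
  exact (mul_inv_cancel_left _ _).symm

theorem continuous_toTorus : Continuous (toTorus q) :=
  (QuotientGroup.continuous_mk (N := posClasses q)).comp
    (QuotientGroup.continuous_mk (N := (principal q).range))

theorem isOpenMap_toTorus : IsOpenMap (toTorus q) :=
  (QuotientGroup.isOpenMap_coe (N := posClasses q)).comp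
    (QuotientGroup.isOpenMap_coe (N := (principal q).range))

/-! ### The covering of the neutral component -/

/-- The subgroup `(K ⊗_ℚ ℝ)ˣ × (O_K/q)ˣ`. -/
def unitSubgroup : Subgroup (PreClassGroup q) := Subgroup.prod ⊤ (finiteUnits q)

/-- The map `(K ⊗_ℚ ℝ)ˣ × (O_K/q)ˣ → C(q)/ℝ_{>0}`. Its image is
`((K ⊗_ℚ ℝ)ˣ/ℝ_{>0} × (O_K/q)ˣ)/O_Kˣ`. -/
def unitToTorus : unitSubgroup q →* ClassTorus q := (toTorus q).comp (unitSubgroup q).subtype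

/-- The map `(K ⊗_ℚ ℝ)ˣ × (O_K/q)ˣ → (K ⊗_ℚ ℝ)ˣ/(O_Kˣ · ℝ_{>0})`. -/
def unitToBase : unitSubgroup q →* BaseTorus K :=
  (toBase K).comp
    ((MonoidHom.fst (ArchUnits K) (FinitePart q)).comp (unitSubgroup q).subtype)

theorem exists_unit_of_valuation_eq_one (k : Kˣ)
    (h : ∀ p : HeightOneSpectrum (𝓞 K), p.valuation K (k : K) = 1) :
    ∃ ε : (𝓞 K)ˣ, Units.map (algebraMap (𝓞 K) K : 𝓞 K →* K) ε = k := by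
  obtain ⟨a, ha⟩ := HeightOneSpectrum.mem_integers_of_valuation_le_one K (k : K)
    fun p => (h p).le
  obtain ⟨b, hb⟩ := HeightOneSpectrum.mem_integers_of_valuation_le_one K ((k⁻¹ : Kˣ) : K)
    fun p => by rw [Units.val_inv_eq_inv_val, map_inv₀, h p, inv_one]
  have hab : a * b = 1 := by
    apply FaithfulSMul.algebraMap_injective (𝓞 K) K
    rw [map_mul, ha, hb, map_one, Units.mul_inv]
  exact ⟨⟨a, b, hab, by rw [mul_comm, hab]⟩, Units.ext ha⟩

theorem valuation_eq_one_of_finiteDiag_mem (k : Kˣ) (h : finiteDiag q k ∈ finiteUnits q)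
    (p : HeightOneSpectrum (𝓞 K)) : p.valuation K (k : K) = 1 := by
  obtain ⟨h1, h2⟩ := h
  by_cases hp : p.asIdeal ∣ q
  · obtain ⟨u, hu, huk⟩ := h1 ⟨p, hp⟩ trivial
    have huk' : (QuotientGroup.mk u : Kˣ ⧸ higherUnits p (multiplicity p.asIdeal q)) =
      QuotientGroup.mk k := huk
    rw [QuotientGroup.eq] at huk'
    have hu1 : p.valuation K (u : K) = 1 := by
      simpa [localUnits, MonoidHom.mem_ker, Units.ext_iff] using hu
    have := huk'.1
    simpa [hu1] using this
  · have h3 : ordFamily q k = 1 := h2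
    have h4 : ord p k = 0 := by
      rw [← ordFamily_apply q k ⟨p, hp⟩, h3]
      rfl
    have h0 : p.valuation K (k : K) ≠ 0 := by simp
    have h5 : WithZero.log (p.valuation K (k : K)) = 0 := by simpa [ord] using h4
    rw [← WithZero.exp_log h0, h5, WithZero.exp_zero]

theorem ker_unitToTorus_le :
    (unitToTorus q).rangeRestrict.ker ≤ (unitToBase q).ker := by
  rintro ⟨⟨x, d⟩, hxd⟩ h
  rw [MonoidHom.ker_rangeRestrict, MonoidHom.mem_ker] at h
  obtain ⟨k, r, hkr⟩ := toTorus_eq_one q h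
  have hk1 : x = archDiag K k * posReal K r := congrArg Prod.fst hkr
  have hk2 : d = finiteDiag q k := (congrArg Prod.snd hkr).trans (mul_one _)
  have hd : finiteDiag q k ∈ finiteUnits q := by rw [← hk2]; exact hxd.2
  obtain ⟨ε, rfl⟩ := exists_unit_of_valuation_eq_one k (valuation_eq_one_of_finiteDiag_mem q k hd)
  rw [MonoidHom.mem_ker]
  refine (QuotientGroup.eq_one_iff (N := unitsPos K) x).mpr ?_
  rw [hk1]
  exact Subgroup.mul_mem_sup ⟨ε, rfl⟩ ⟨r, rfl⟩

/-- The projection of `((K ⊗_ℚ ℝ)ˣ/ℝ_{>0} × (O_K/q)ˣ)/O_Kˣ ⊆ C(q)/ℝ_{>0}` onto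
`(K ⊗_ℚ ℝ)ˣ/(O_Kˣ · ℝ_{>0})`. -/
def rangeToBase : (unitToTorus q).range →* BaseTorus K :=
  MonoidHom.liftOfSurjective (unitToTorus q).rangeRestrict
    (unitToTorus q).rangeRestrict_surjective ⟨unitToBase q, ker_unitToTorus_le q⟩

theorem connectedComponent_le_range :
    Subgroup.connectedComponentOfOne (ClassTorus q) ≤ (unitToTorus q).range := by
  have hopen : IsOpen ((unitToTorus q).range : Set (ClassTorus q)) := by
    have h1 : IsOpen (unitSubgroup q : Set (PreClassGroup q)) := by
      rw [unitSubgroup, Subgroup.coe_prod]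
      exact isOpen_univ.prod (isOpen_discrete _)
    convert isOpenMap_toTorus q _ h1 using 1
    ext t
    constructor
    · rintro ⟨s, rfl⟩
      exact ⟨s.1, s.2, rfl⟩
    · rintro ⟨s, hs, rfl⟩
      exact ⟨⟨s, hs⟩, rfl⟩
  have hclopen : IsClopen ((unitToTorus q).range : Set (ClassTorus q)) :=
    ⟨Subgroup.isClosed_of_isOpen _ hopen, hopen⟩
  exact hclopen.connectedComponent_subset (one_mem (unitToTorus q).range)

/-- The covering map from the neutral component of `C(q)/ℝ_{>0}` to
`(K ⊗_ℚ ℝ)ˣ/(O_Kˣ · ℝ_{>0})`, induced by `(x, d) ↦ x`. -/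
def covering : Subgroup.connectedComponentOfOne (ClassTorus q) →* BaseTorus K :=
  (rangeToBase q).comp (Subgroup.inclusion (connectedComponent_le_range q))

/-- `P` is a connected open subset of `C(q)/ℝ_{>0}` such that a translate `t⁻¹ P` of it lies in the
neutral component, the covering map is injective on the translate, and the image is a small convex
set of size `≤ δ` with respect to the trivialization `e`. -/
def IsThinPatch {d : ℕ}
    (e : Subgroup.connectedComponentOfOne (BaseTorus K) ≃ₜ* (Fin d → Circle)) (δ : ℝ)
    (P : Set (ClassTorus q)) : Prop :=
  IsOpen P ∧ IsConnected P ∧ ∃ t : ClassTorus q,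
    (∀ x ∈ P, t⁻¹ * x ∈ Subgroup.connectedComponentOfOne (ClassTorus q)) ∧
    Set.InjOn (covering q)
      {y : Subgroup.connectedComponentOfOne (ClassTorus q) | t * (y : ClassTorus q) ∈ P} ∧
    IsSmallConvex e δ (covering q ''
      {y : Subgroup.connectedComponentOfOne (ClassTorus q) | t * (y : ClassTorus q) ∈ P})

/-! ### The measure on `C(q)/ℝ_{>0}` -/

/-- The map `(H × (S¹)^{r₂} × {±1}^{r₁}) × (finite part) → C(q)/ℝ_{>0}`; its source is
`(K ⊗_ℚ ℝ)ˣ/ℝ_{>0} × (finite part)`, and its fibres are the orbits of `Kˣ`. -/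
def coordToTorus (a : ArchCoord K × FinitePart q) : ClassTorus q :=
  toTorus q (archPoint K a.1, a.2)

theorem continuous_archPoint : Continuous (archPoint K) := by
  have hH : ∀ w : InfinitePlace K,
      Continuous fun a : ArchCoord K => (a.1 : EuclideanSpace ℝ (InfinitePlace K)) w := by
    intro w
    exact (EuclideanSpace.proj (𝕜 := ℝ) w).continuous.comp (continuous_subtype_val.comp continuous_fst)
  have hθ : ∀ w : {w : InfinitePlace K // w.IsComplex},
      Continuous fun a : ArchCoord K => (((a.2.1 w).toCircle : Circle) : ℂ) := by
    intro w
    exact continuous_subtype_val.comp (AddCircle.continuous_toCircle.comp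
      ((continuous_apply w).comp (continuous_fst.comp continuous_snd)))
  have hε : ∀ w : {w : InfinitePlace K // w.IsReal},
      Continuous fun a : ArchCoord K => ((a.2.2 w : ℤ) : ℝ) := by
    intro w
    have h : Continuous fun u : ℤˣ => ((u : ℤ) : ℝ) := continuous_of_discreteTopology
    exact h.comp ((continuous_apply w).comp (continuous_snd.comp continuous_snd))
  rw [Units.continuous_iff]
  constructor
  · refine Continuous.prodMk (continuous_pi fun w => ?_) (continuous_pi fun w => ?_)
    · exact (hε w).mul (Real.continuous_exp.comp (hH w.1))
    · exact (hθ w).mul (Complex.continuous_ofReal.comp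
        (Real.continuous_exp.comp ((hH w.1).div_const 2)))
  · refine Continuous.prodMk (continuous_pi fun w => ?_) (continuous_pi fun w => ?_)
    · exact ((hε w).mul (Real.continuous_exp.comp (hH w.1))).inv₀
        fun a => mul_ne_zero (by simp) (Real.exp_ne_zero _)
    · exact ((hθ w).mul (Complex.continuous_ofReal.comp
        (Real.continuous_exp.comp ((hH w.1).div_const 2)))).inv₀
        fun a => mul_ne_zero (Circle.coe_ne_zero _) (by simp [Complex.exp_ne_zero])

variable (K) in
theorem countable_field : Countable K :=
  (Module.finBasis ℚ K).equivFun.toEquiv.injective.countable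

theorem countable_units : Countable Kˣ := by
  have := countable_field K
  exact Units.val_injective.countable

theorem countable_finitePart [hq : NeZero q] : Countable (FinitePart q) := by
  have : Countable Kˣ := countable_units
  have : Finite {p : HeightOneSpectrum (𝓞 K) // p.asIdeal ∣ q} :=
    (Ideal.finite_factors hq.out).to_subtype
  have : Countable {p : HeightOneSpectrum (𝓞 K) // ¬ p.asIdeal ∣ q} := by
    have := countable_field K
    have : Countable (𝓞 K) := RingOfIntegers.coe_injective.countable
    have : Countable (Ideal (𝓞 K)) := by
      have h : Function.Surjective fun s : Finset (𝓞 K) => Ideal.span (s : Set (𝓞 K)) :=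
        fun I => IsNoetherian.noetherian I
      exact h.countable
    have : Countable (HeightOneSpectrum (𝓞 K)) :=
      Function.Injective.countable (f := HeightOneSpectrum.asIdeal)
        fun _ _ h => HeightOneSpectrum.ext h
    infer_instance
  have h1 : ∀ p : {p : HeightOneSpectrum (𝓞 K) // p.asIdeal ∣ q},
      Countable (Kˣ ⧸ higherUnits p.1 (multiplicity p.1.asIdeal q)) :=
    fun p => QuotientGroup.mk_surjective.countable
  have h2 : Countable (Multiplicative
      ({p : HeightOneSpectrum (𝓞 K) // ¬ p.asIdeal ∣ q} →₀ ℤ)) :=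
    inferInstanceAs (Countable ({p : HeightOneSpectrum (𝓞 K) // ¬ p.asIdeal ∣ q} →₀ ℤ))
  exact inferInstanceAs (Countable (_ × _))

theorem measurable_coordToTorus [NeZero q] : Measurable (coordToTorus q) := by
  have := countable_finitePart q
  have : MeasurableSingletonClass (FinitePart q) := ⟨fun _ => trivial⟩
  have : OpensMeasurableSpace ℤˣ := ⟨by
    refine MeasurableSpace.generateFrom_le fun s _ => ?_
    exact ⟨(fun u : ℤˣ => (u : ℤ)) '' s, trivial, Units.val_injective.preimage_image s⟩⟩
  have : OpensMeasurableSpace ({w : InfinitePlace K // w.IsComplex} → AddCircle (2 * Real.pi)) :=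
    inferInstance
  have : OpensMeasurableSpace ({w : InfinitePlace K // w.IsReal} → ℤˣ) := inferInstance
  have : SecondCountableTopology ({w : InfinitePlace K // w.IsReal} → ℤˣ) := inferInstance
  have : OpensMeasurableSpace (({w : InfinitePlace K // w.IsComplex} → AddCircle (2 * Real.pi)) ×
      ({w : InfinitePlace K // w.IsReal} → ℤˣ)) := Prod.opensMeasurableSpace
  have : SecondCountableTopology (traceZero K) := inferInstance
  have : OpensMeasurableSpace (ArchCoord K) := Prod.opensMeasurableSpace
  refine measurable_from_prod_countable_left fun d => Continuous.measurable ?_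
  exact (continuous_toTorus q).comp (continuous_archPoint.prodMk continuous_const)

/-- The measure on `C(q)/ℝ_{>0}` induced by the measure of `(K ⊗_ℚ ℝ)ˣ/ℝ_{>0}` and the counting
measure of the finite part. -/
def ideleMeasure [NeZero q] : Measure (ClassTorus q) :=
  quotientMeasure (coordToTorus q) (measurable_coordToTorus q)
    ((archMeasure K).prod Measure.count)

/-- Euler's totient function `φ(q) = #(O_K/q)ˣ`. -/
def totient : ℕ := Nat.card (𝓞 K ⧸ q)ˣ

end IdeleTorus

end

noncomputable section

set_option linter.unusedSectionVars false

namespace IdeleTorus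

/-! ### Lifting homomorphisms from a vector space to the circle -/

section Lift

variable {V : Type*} [NormedAddCommGroup V] [NormedSpace ℝ V]

/-! Put d = n - 1. A trivialization `e` of B⁰ linearizes the exponential map of K ⊗ ℝ: modulo the
line ℝ·1 the source becomes ℝ^d, and the exponential becomes a continuous open homomorphism π : ℝ^d
→ T with image T⁰ (`LinearChart.proj`). Its kernel lies in ℤ^d because T⁰ covers B⁰, and contains
Nℤ^d for some N ≠ 0 because integral vectors land in the finite image F of (O_K/q)ˣ. In these
coordinates P is a translate of the image of a convex set C
(`LinearChart.exists_convex_of_isThinPatch`), and the claim becomes one about compact abelian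
groups, `exists_approximation`.

Let V ≥ 1 bound the volume of the image of the open unit cube. Replace 1_P by a plateau f that is 1
on P, vanishes off the ε-neighbourhood P' of P and is (2/ε)-Lipschitz along π, with ε of order
1/(MV). Then average f along π against a band-limited kernel at scale 1/L, L = YV. If ψ has
frequency ξ along π, averaging multiplies its Fourier coefficient by b(ξ/L) ∈ [0, 1], where b is a
bump function with b(0) = 1. The result is a trigonometric polynomial whose distance to f is of
order 1/(εL), that is M/Y. Thus G = 1_P - f and H = f minus the polynomial. A character trivial on
T⁰ has frequency 0, so c_ψ is the exact coefficient of f, and it differs from that of 1_P by at most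
the relative volume of P' \ P.

The substance lies in four uniform estimates. The collar of any small convex set has volume at most
a constant, depending on d only, times ε times the volume of the cube (`measure_collar_le`). The set
P' is small convex for a trivialization of T⁰ itself: the period lattice in ℤ^d has a Hermite basis
for which coordinates are bounded in terms of d, whatever the index (`exists_lattice_basis`,
`exists_torus_equiv`). The bound V depends on K only, by comparing the volume of T⁰ in an arbitrary
chart and in a fixed one (`LinearChart.ideleMeasure_image_half_ball_le`). Finally, a character is
determined by its restriction to F, the floors of its frequencies and a character of T/(F·T⁰); since
F has order at most φ(q) and T/(F·T⁰) is bounded in terms of K, the count is φ(q)L^d up to a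
constant depending on K (`exists_finset_characters`). -/

theorem exists_continuousLinearMap_lift_circle (φ : V → Circle) (hc : Continuous φ)
    (hφ : ∀ x y, φ (x + y) = φ x * φ y) :
    ∃ l : V →L[ℝ] ℝ, ∀ x, Circle.exp (2 * Real.pi * l x) = φ x := by
  have h0 : φ 0 = 1 := by
    have := hφ 0 0
    rw [add_zero] at this
    exact left_eq_mul.mp this
  obtain ⟨F, ⟨hF0, hF⟩, -⟩ := Circle.isCoveringMap_exp.existsUnique_continuousMap_lifts
    (⟨φ, hc⟩ : C(V, Circle)) 0 0 (by simp [h0])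
  have hF' : ∀ x, Circle.exp (F x) = φ x := fun x => congrFun hF x
  have hadd : ∀ x y, F (x + y) = F x + F y := by
    intro x y
    -- The additivity defect of the lift, divided by 2π, is continuous and integer-valued along t ↦
    -- (tx, ty) and vanishes at t = 0; hence it is identically 0.
    have hcont : Continuous fun t : ℝ =>
        (F (t • x + t • y) - F (t • x) - F (t • y)) / (2 * Real.pi) := by fun_prop
    have hint : ∀ t : ℝ, ∃ n : ℤ,
        (F (t • x + t • y) - F (t • x) - F (t • y)) / (2 * Real.pi) = n := by
      intro t
      have : Circle.exp (F (t • x + t • y)) = Circle.exp (F (t • x) + F (t • y)) := by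
        rw [Circle.exp_add, hF', hF', hF', hφ]
      obtain ⟨m, hm⟩ := Circle.exp_eq_exp.mp this
      refine ⟨m, ?_⟩
      rw [hm]
      field_simp
      ring
    choose n hn using hint
    have hn' : Continuous n := by
      exact Int.isClosedEmbedding_coe_real.isInducing.continuous_iff.mpr
        (by convert hcont using 1; ext t; exact (hn t).symm)
    have hconst : n 1 = n 0 := PreconnectedSpace.constant inferInstance hn'
    have h1 := hn 1
    have h2 := hn 0
    rw [hconst, ← h2] at h1
    simp only [one_smul, zero_smul, add_zero, hF0, sub_zero, zero_div] at h1
    have := (div_eq_zero_iff.mp h1).resolve_right (by positivity)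
    linarith
  let f : V →+ ℝ := ⟨⟨F, hF0⟩, hadd⟩
  refine ⟨(2 * Real.pi)⁻¹ • f.toRealLinearMap F.continuous, fun x => ?_⟩
  rw [← hF']
  congr 1
  change 2 * Real.pi * ((2 * Real.pi)⁻¹ * F x) = F x
  field_simp

end Lift

/-! ### The standard torus as a quotient of ℝ^d by ℤ^d -/

section TorusProj

variable {d : ℕ}

theorem torusProj_apply (x : Fin d → ℝ) (j : Fin d) :
    torusProj x j = Circle.exp (2 * Real.pi * x j) := rfl

theorem torusProj_add (x y : Fin d → ℝ) : torusProj (x + y) = torusProj x * torusProj y := by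
  ext j
  simp [torusProj, mul_add, Circle.exp_add]

theorem continuous_torusProj : Continuous (torusProj (d := d)) := by
  unfold torusProj
  fun_prop

theorem torusProj_surjective : Function.Surjective (torusProj (d := d)) := by
  intro z
  choose x hx using fun j => Circle.exp_surjective (z j)
  refine ⟨fun j => x j / (2 * Real.pi), ?_⟩
  ext j
  rw [torusProj_apply, mul_div_cancel₀ _ (by positivity), hx]

theorem isOpenMap_torusProj : IsOpenMap (torusProj (d := d)) := by
  refine IsOpenMap.piMap (f := fun (_ : Fin d) (x : ℝ) => Circle.exp (2 * Real.pi * x))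
    (fun _ => isLocalHomeomorph_circleExp.isOpenMap.comp
      (Homeomorph.mulLeft₀ (2 * Real.pi) (by positivity)).isOpenMap)
    (by simp)

theorem torusProj_eq_one_iff {x : Fin d → ℝ} :
    torusProj x = 1 ↔ ∃ z : Fin d → ℤ, x = fun j => (z j : ℝ) := by
  constructor
  · intro h
    have : ∀ j, ∃ m : ℤ, x j = m := by
      intro j
      have hj : Circle.exp (2 * Real.pi * x j) = 1 := congrFun h j
      obtain ⟨m, hm⟩ := Circle.exp_eq_one.mp hj
      refine ⟨m, ?_⟩
      have : (2 * Real.pi) ≠ 0 := by positivity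
      apply mul_left_cancel₀ this
      linarith
    choose z hz using this
    exact ⟨z, funext hz⟩
  · rintro ⟨z, rfl⟩
    ext j
    rw [torusProj_apply, mul_comm, Circle.exp_int_mul_two_pi]
    rfl

theorem exists_continuousLinearMap_lift_torus {V : Type*} [NormedAddCommGroup V]
    [NormedSpace ℝ V] (φ : V → Fin d → Circle) (hc : Continuous φ)
    (hφ : ∀ x y, φ (x + y) = φ x * φ y) :
    ∃ l : V →L[ℝ] (Fin d → ℝ), ∀ x, torusProj (l x) = φ x := by
  choose l hl using fun j => exists_continuousLinearMap_lift_circle (fun x => φ x j)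
    ((continuous_apply j).comp hc) (fun x y => congrFun (hφ x y) j)
  exact ⟨ContinuousLinearMap.pi l, fun x => funext fun j => hl j x⟩

end TorusProj

end IdeleTorus

namespace IdeleTorus

/-! ### Fourier analysis on a compact abelian group -/

section Fourier

variable {T : Type*} [CommGroup T] [TopologicalSpace T] [IsTopologicalGroup T] [CompactSpace T]

/-- A character as a continuous complex valued function. -/
def charFun (ψ : PontryaginDual T) : C(T, ℂ) where
  toFun x := ((ψ x : Circle) : ℂ)
  continuous_toFun := continuous_subtype_val.comp (map_continuous ψ)

theorem charFun_apply (ψ : PontryaginDual T) (x : T) : charFun ψ x = ((ψ x : Circle) : ℂ) := rfl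

theorem dual_mul_apply (ψ χ : PontryaginDual T) (x : T) : (ψ * χ) x = ψ x * χ x := rfl

theorem dual_inv_apply (ψ : PontryaginDual T) (x : T) : (ψ⁻¹) x = (ψ x)⁻¹ := rfl

theorem charFun_mul (ψ χ : PontryaginDual T) : charFun (ψ * χ) = charFun ψ * charFun χ := by
  ext x
  simp [charFun_apply, dual_mul_apply]

theorem charFun_inv (ψ : PontryaginDual T) : charFun ψ⁻¹ = star (charFun ψ) := by
  ext x
  exact Circle.coe_inv_eq_conj (ψ x)

theorem charFun_one : charFun (1 : PontryaginDual T) = 1 := by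
  ext x
  simp [charFun_apply]

/-- The star algebra of trigonometric polynomials. -/
def trigPolynomials (T : Type*) [CommGroup T] [TopologicalSpace T] [IsTopologicalGroup T]
    [CompactSpace T] : StarSubalgebra ℂ C(T, ℂ) where
  toSubalgebra := Algebra.adjoin ℂ (Set.range charFun)
  star_mem' := by
    change Algebra.adjoin ℂ (Set.range (charFun (T := T))) ≤
      star (Algebra.adjoin ℂ (Set.range (charFun (T := T))))
    refine Algebra.adjoin_le ?_
    rintro - ⟨ψ, rfl⟩
    refine Algebra.subset_adjoin ⟨ψ⁻¹, ?_⟩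
    rw [charFun_inv]

theorem trigPolynomials_coe :
    Subalgebra.toSubmodule (trigPolynomials T).toSubalgebra =
      Submodule.span ℂ (Set.range (charFun (T := T))) := by
  apply Algebra.adjoin_eq_span_of_subset
  refine Set.Subset.trans ?_ Submodule.subset_span
  intro x hx
  refine Submonoid.closure_induction (fun _ => id) ⟨1, charFun_one⟩ ?_ hx
  rintro - - - - ⟨ψ, rfl⟩ ⟨χ, rfl⟩
  exact ⟨ψ * χ, charFun_mul ψ χ⟩

/-- Stone–Weierstrass: products and conjugates of characters are characters, so their span is a star
subalgebra. -/
theorem trigPolynomials_closure (hsep : ∀ t : T, t ≠ 1 → ∃ ψ : PontryaginDual T, ψ t ≠ 1) :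
    (Submodule.span ℂ (Set.range (charFun (T := T)))).topologicalClosure = ⊤ := by
  rw [← trigPolynomials_coe]
  refine congr_arg (Subalgebra.toSubmodule <| StarSubalgebra.toSubalgebra ·)
    (ContinuousMap.starSubalgebra_topologicalClosure_eq_top_of_separatesPoints
      (trigPolynomials T) ?_)
  intro x y hxy
  obtain ⟨ψ, hψ⟩ := hsep (x * y⁻¹) (by rwa [Ne, mul_inv_eq_one])
  refine ⟨_, ⟨charFun ψ, Algebra.subset_adjoin ⟨ψ, rfl⟩, rfl⟩, ?_⟩
  contrapose hψ
  have : ψ x = ψ y := Circle.ext hψ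
  rw [map_mul, map_inv, this, mul_inv_cancel]

variable [MeasurableSpace T] [BorelSpace T] (μ : Measure T) [IsFiniteMeasure μ]

theorem integrable_continuousMap (h : C(T, ℂ)) : Integrable h μ :=
  h.continuous.integrable_of_hasCompactSupport (HasCompactSupport.of_compactSpace _)

/-- Integration against a continuous function. -/
def integralMul (h : C(T, ℂ)) : C(T, ℂ) →L[ℂ] ℂ :=
  LinearMap.mkContinuous
    { toFun := fun u => ∫ x, h x * u x ∂μ
      map_add' := fun u v => by
        simp only [ContinuousMap.add_apply, mul_add]
        exact integral_add (integrable_continuousMap μ (h * u)) (integrable_continuousMap μ (h * v))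
      map_smul' := fun c u => by
        simp only [ContinuousMap.smul_apply, smul_eq_mul, mul_left_comm _ c, RingHom.id_apply]
        exact integral_const_mul _ _ }
    (‖h‖ * μ.real Set.univ) (fun u => by
      change ‖∫ x, h x * u x ∂μ‖ ≤ _
      refine (norm_integral_le_of_norm_le_const (C := ‖h‖ * ‖u‖)
        (Filter.Eventually.of_forall fun x => ?_)).trans_eq (by ring)
      rw [norm_mul]
      exact mul_le_mul (h.norm_coe_le_norm x) (u.norm_coe_le_norm x) (norm_nonneg _)
        (norm_nonneg _))

theorem integralMul_apply (h u : C(T, ℂ)) : integralMul μ h u = ∫ x, h x * u x ∂μ := rfl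

/-- Pairing with h is continuous and kills the characters, hence by density every continuous
function, in particular the conjugate of h; so the integral of |h|² is 0. -/
theorem eq_zero_of_integralMul_char [μ.IsOpenPosMeasure]
    (hsep : ∀ t : T, t ≠ 1 → ∃ ψ : PontryaginDual T, ψ t ≠ 1) (h : C(T, ℂ))
    (hh : ∀ ψ : PontryaginDual T, integralMul μ h (charFun ψ) = 0) : h = 0 := by
  have h1 : ∀ u, integralMul μ h u = 0 := by
    intro u
    have hu : u ∈ (Submodule.span ℂ (Set.range (charFun (T := T)))).topologicalClosure := by
      rw [trigPolynomials_closure hsep]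
      trivial
    have hle : (Submodule.span ℂ (Set.range (charFun (T := T)))).topologicalClosure ≤
        LinearMap.ker (integralMul μ h).toLinearMap := by
      refine Submodule.topologicalClosure_minimal _ (Submodule.span_le.mpr ?_)
        (ContinuousLinearMap.isClosed_ker _)
      rintro _ ⟨ψ, rfl⟩
      exact hh ψ
    exact hle hu
  have h2 := h1 (star h)
  by_contra hne
  obtain ⟨x, hx⟩ : ∃ x, h x ≠ 0 := by
    by_contra! hcon
    exact hne (ContinuousMap.ext hcon)
  have h3 : 0 < ∫ x, ‖h x‖ ^ 2 ∂μ :=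
    Continuous.integral_pos_of_hasCompactSupport_nonneg_nonzero (x := x)
      (by fun_prop) (HasCompactSupport.of_compactSpace _) (fun x => by positivity)
      (by simpa using hx)
  rw [integralMul_apply] at h2
  have h4 : ∀ x, h x * (star h) x = ((‖h x‖ ^ 2 : ℝ) : ℂ) := by
    intro x
    simpa using Complex.mul_conj' (h x)
  simp only [h4] at h2
  rw [integral_complex_ofReal] at h2
  exact h3.ne' (by exact_mod_cast h2)

theorem integral_char_eq_zero [μ.IsMulLeftInvariant] {ψ : PontryaginDual T} (hψ : ψ ≠ 1) :
    ∫ x, charFun ψ x ∂μ = 0 := by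
  obtain ⟨a, ha⟩ : ∃ a, ψ a ≠ 1 := by
    by_contra! hcon
    exact hψ (PontryaginDual.ext hcon)
  have h1 := integral_mul_left_eq_self (μ := μ) (fun x => charFun ψ x) a
  have h2 : ∀ x, charFun ψ (a * x) = (ψ a : ℂ) * charFun ψ x := by
    intro x
    simp [charFun_apply]
  simp only [h2] at h1
  rw [integral_const_mul] at h1
  have h3 : ((ψ a : ℂ) - 1) * ∫ x, charFun ψ x ∂μ = 0 := by rw [sub_mul, h1]; ring
  refine (mul_eq_zero.mp h3).resolve_left (sub_ne_zero.mpr fun h => ha ?_)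
  exact Circle.ext h

open scoped Classical in
theorem integralMul_char_char [μ.IsMulLeftInvariant] (ψ χ : PontryaginDual T) :
    integralMul μ (charFun ψ) (charFun χ⁻¹) = if ψ = χ then (μ.real Set.univ : ℂ) else 0 := by
  have : integralMul μ (charFun ψ) (charFun χ⁻¹) = ∫ x, charFun (ψ * χ⁻¹) x ∂μ := by
    rw [integralMul_apply, charFun_mul]
    rfl
  rw [this]
  split_ifs with h
  · subst h
    simp [charFun_one, mul_inv_cancel]
  · exact integral_char_eq_zero μ (by rwa [Ne, mul_inv_eq_one])

/-- A continuous function whose Fourier coefficients vanish off a finite set is a trigonometric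
polynomial. -/
theorem eq_sum_of_fourier_support [μ.IsOpenPosMeasure] [μ.IsMulLeftInvariant]
    (hsep : ∀ t : T, t ≠ 1 → ∃ ψ : PontryaginDual T, ψ t ≠ 1) (h : C(T, ℂ))
    (Ξ : Finset (PontryaginDual T)) (c : PontryaginDual T → ℂ)
    (hc : ∀ ψ, integralMul μ h (charFun ψ⁻¹) = c ψ * μ.real Set.univ)
    (hΞ : ∀ ψ, ψ ∉ Ξ → c ψ = 0) : h = ∑ ψ ∈ Ξ, c ψ • charFun ψ := by
  classical
  rw [← sub_eq_zero]
  refine eq_zero_of_integralMul_char μ hsep _ fun χ => ?_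
  have hlin : ∀ u v w : C(T, ℂ), integralMul μ (u - v) w =
      integralMul μ u w - integralMul μ v w := by
    intro u v w
    simp only [integralMul_apply, ContinuousMap.sub_apply, sub_mul]
    exact integral_sub (integrable_continuousMap μ (u * w)) (integrable_continuousMap μ (v * w))
  have hsymm : ∀ u v : C(T, ℂ), integralMul μ u v = integralMul μ v u := by
    intro u v
    simp only [integralMul_apply, mul_comm]
  rw [hlin, ← inv_inv χ, hc, hsymm (∑ ψ ∈ Ξ, _), map_sum]
  have hterm : ∀ ψ : PontryaginDual T, integralMul μ (charFun χ⁻¹⁻¹) (c ψ • charFun ψ) =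
      if ψ = χ⁻¹ then c ψ * (μ.real Set.univ : ℂ) else 0 := by
    intro ψ
    rw [map_smul, hsymm, integralMul_char_char, smul_eq_mul, mul_ite, mul_zero]
  simp only [hterm, Finset.sum_ite_eq']
  split_ifs with h
  · ring
  · rw [hΞ _ h]; ring

end Fourier

/-! ### A band-limited kernel -/

open scoped FourierTransform in
/-- There is an integrable kernel with finite first moment, whose Fourier transform is supported
in the unit ball, takes values in `[0, 1]`, and is equal to `1` at `0`. -/
theorem exists_bandlimited_kernel (d : ℕ) :
    ∃ (g : EuclideanSpace ℝ (Fin d) → ℂ) (b : EuclideanSpace ℝ (Fin d) → ℝ),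
      Integrable g ∧ Integrable (fun x => ‖x‖ * ‖g x‖) ∧
      (∀ ξ, 0 ≤ b ξ) ∧ (∀ ξ, b ξ ≤ 1) ∧ b 0 = 1 ∧ (∀ ξ, 1 ≤ ‖ξ‖ → b ξ = 0) ∧
      ∀ ξ, ∫ x, Complex.exp ((2 * Real.pi * inner ℝ x ξ : ℝ) * Complex.I) * g x = b ξ := by
  -- The kernel is the Fourier transform of a bump function. Being Schwartz it has a finite first
  -- moment, and Fourier inversion returns the bump.
  let β : ContDiffBump (0 : EuclideanSpace ℝ (Fin d)) := ⟨1 / 2, 1, by norm_num, by norm_num⟩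
  let βc : EuclideanSpace ℝ (Fin d) → ℂ := fun x => (β x : ℂ)
  have hβs : HasCompactSupport βc := β.hasCompactSupport.comp_left (g := fun r : ℝ => (r : ℂ)) rfl
  have hβd : ContDiff ℝ (⊤ : ℕ∞) βc := Complex.ofRealCLM.contDiff.comp β.contDiff
  let B : SchwartzMap (EuclideanSpace ℝ (Fin d)) ℂ := hβs.toSchwartzMap hβd
  let A : SchwartzMap (EuclideanSpace ℝ (Fin d)) ℂ := 𝓕 B
  refine ⟨A, β, A.integrable, ?_, fun ξ => β.nonneg, fun ξ => β.le_one, ?_, ?_, ?_⟩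
  · simpa using A.integrable_pow_mul volume 1
  · exact β.one_of_mem_closedBall (Metric.mem_closedBall_self β.rIn_pos.le)
  · intro ξ hξ
    exact β.zero_of_le_dist (by simpa [β] using hξ)
  · intro ξ
    have h1 : 𝓕⁻ A = B := FourierPair.fourierInv_fourier_eq B
    have h2 := Real.fourierInv_eq' A ξ
    rw [← SchwartzMap.fourierInv_coe, h1] at h2
    exact h2.symm

end IdeleTorus

namespace IdeleTorus

/-! ### Approximation by trigonometric polynomials -/

section OneParameter

variable {T : Type*} [CommGroup T] {d : ℕ} {π : (Fin d → ℝ) → T}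

theorem map_zero_of_add (hadd : ∀ x y, π (x + y) = π x * π y) : π 0 = 1 := by
  have := hadd 0 0
  rw [add_zero] at this
  exact left_eq_mul.mp this

theorem map_neg_of_add (hadd : ∀ x y, π (x + y) = π x * π y) (x : Fin d → ℝ) :
    π (-x) = (π x)⁻¹ := by
  rw [eq_inv_iff_mul_eq_one, ← hadd, neg_add_cancel, map_zero_of_add hadd]

theorem map_sub_of_add (hadd : ∀ x y, π (x + y) = π x * π y) (x y : Fin d → ℝ) :
    π (x - y) = π x * (π y)⁻¹ := by
  rw [sub_eq_add_neg, hadd, map_neg_of_add hadd]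

end OneParameter

section Approximation

variable {T : Type*} [CommGroup T] [TopologicalSpace T] [IsTopologicalGroup T]
variable {d : ℕ} {π : (Fin d → ℝ) → T}

/-- Every character has a frequency along a one-parameter family. -/
theorem exists_frequency (hπ : Continuous π) (hadd : ∀ x y, π (x + y) = π x * π y)
    (ψ : PontryaginDual T) :
    ∃ ξ : Fin d → ℝ, ∀ x, ψ (π x) = Circle.exp (2 * Real.pi * ∑ j, x j * ξ j) := by
  obtain ⟨l, hl⟩ := exists_continuousLinearMap_lift_circle (fun x => ψ (π x))
    ((map_continuous ψ).comp hπ) (fun x y => by rw [hadd, map_mul])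
  refine ⟨fun j => l (Pi.single j 1), fun x => ?_⟩
  rw [← hl]
  congr 2
  have : x = ∑ j, x j • (Pi.single j (1 : ℝ) : Fin d → ℝ) := by
    conv_lhs => rw [← Finset.univ_sum_single x]
    refine Finset.sum_congr rfl fun j _ => ?_
    rw [← Pi.single_smul, smul_eq_mul, mul_one]
  conv_lhs => rw [this, map_sum]
  simp

theorem frequency_eq_zero {ξ : Fin d → ℝ}
    (h : ∀ x : Fin d → ℝ, Circle.exp (2 * Real.pi * ∑ j, x j * ξ j) = 1) : ξ = 0 := by
  by_contra hne
  obtain ⟨j, hj⟩ : ∃ j, ξ j ≠ 0 := by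
    by_contra! hcon
    exact hne (funext hcon)
  have h1 := h (Pi.single j (1 / (2 * ξ j)))
  have h2 : ∑ i, (Pi.single j (1 / (2 * ξ j)) : Fin d → ℝ) i * ξ i = 1 / 2 := by
    rw [Finset.sum_eq_single j]
    · simp
      field_simp
    · intro i _ hi
      simp [Pi.single_eq_of_ne hi]
    · simp
  rw [h2, show 2 * Real.pi * (1 / 2) = Real.pi by ring] at h1
  have h3 := congrArg (fun z : Circle => (z : ℂ)) h1
  simp [Circle.coe_exp] at h3
  norm_num at h3

variable [CompactSpace T] [MeasurableSpace T] [BorelSpace T]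

/-- The polynomial is the average of f along π against `g` rescaled by 1/L. Translating f by π x
multiplies its coefficient at ψ by a phase of frequency `ξ ψ`, so averaging multiplies it by `b` at
`ξ ψ / L`: coefficients of frequency 0 survive intact, none grows, and those outside `Ξ` vanish. The
error is the Lipschitz constant times the first moment of the rescaled kernel. -/
theorem exists_trigPolynomial_approx {g : EuclideanSpace ℝ (Fin d) → ℂ}
    {b : EuclideanSpace ℝ (Fin d) → ℝ} (hg : Integrable g)
    (hg1 : Integrable (fun x => ‖x‖ * ‖g x‖))
    (hb0 : ∀ ξ, 0 ≤ b ξ) (hb1 : ∀ ξ, b ξ ≤ 1) (hb : b 0 = 1) (hbs : ∀ ξ, 1 ≤ ‖ξ‖ → b ξ = 0)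
    (hgb : ∀ ξ, ∫ x, Complex.exp ((2 * Real.pi * inner ℝ x ξ : ℝ) * Complex.I) * g x = b ξ)
    (μ : Measure T) [IsFiniteMeasure μ] [μ.IsOpenPosMeasure] [μ.IsMulLeftInvariant]
    (hsep : ∀ t : T, t ≠ 1 → ∃ ψ : PontryaginDual T, ψ t ≠ 1)
    (hπ : Continuous π)
    (f : C(T, ℂ)) {Λ : ℝ}
    (hf : ∀ t x, ‖f (t * π x) - f t‖ ≤ Λ * ‖x‖) {L : ℝ} (hL : 0 < L)
    (ξ : PontryaginDual T → Fin d → ℝ)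
    (hξ : ∀ ψ x, ψ (π x) = Circle.exp (2 * Real.pi * ∑ j, x j * ξ ψ j))
    (Ξ : Finset (PontryaginDual T)) (hΞ : ∀ ψ, (∀ j, |ξ ψ j| ≤ L) → ψ ∈ Ξ) :
    ∃ c : PontryaginDual T → ℂ, (∀ ψ, ψ ∉ Ξ → c ψ = 0) ∧
      (∀ ψ, ‖c ψ‖ ≤ ‖integralMul μ f (charFun ψ⁻¹)‖ / μ.real Set.univ) ∧
      (∀ ψ, ξ ψ = 0 → c ψ = integralMul μ f (charFun ψ⁻¹) / μ.real Set.univ) ∧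
      ∀ t, ‖f t - ∑ ψ ∈ Ξ, c ψ * ((ψ t : Circle) : ℂ)‖ ≤ Λ / L * ∫ x, ‖x‖ * ‖g x‖ := by
  have hμ : (μ.real Set.univ : ℝ) ≠ 0 := by
    have : μ Set.univ ≠ 0 := (isOpen_univ.measure_pos μ ⟨1, trivial⟩).ne'
    exact (ENNReal.toReal_pos this (measure_ne_top μ _)).ne'
  have hμ' : (μ.real Set.univ : ℂ) ≠ 0 := by exact_mod_cast hμ
  let sc : EuclideanSpace ℝ (Fin d) → Fin d → ℝ := fun x => L⁻¹ • (x : Fin d → ℝ)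
  have hsc : Continuous sc := by
    have : Continuous fun x : EuclideanSpace ℝ (Fin d) => (x : Fin d → ℝ) :=
      PiLp.continuous_ofLp 2 _
    exact this.const_smul L⁻¹
  let uncur : C(EuclideanSpace ℝ (Fin d) × T, ℂ) :=
    ⟨fun p => f (p.2 * π (sc p.1)), by fun_prop⟩
  -- `tr x` is the translate of f by π (x/L). Its continuity in x makes the average a Bochner
  -- integral in C(T, ℂ), which commutes with taking Fourier coefficients and with evaluation.
  let tr : C(EuclideanSpace ℝ (Fin d), C(T, ℂ)) := uncur.curry
  have htr : ∀ x t, tr x t = f (t * π (sc x)) := fun x t => rfl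
  have htrn : ∀ x, ‖tr x‖ ≤ ‖f‖ := fun x =>
    (ContinuousMap.norm_le _ (norm_nonneg _)).mpr fun t => f.norm_coe_le_norm _
  have hint : Integrable (fun x => g x • tr x) := by
    refine (hg.norm.mul_const ‖f‖).mono' (hg.aestronglyMeasurable.smul
      tr.continuous.aestronglyMeasurable) (Filter.Eventually.of_forall fun x => ?_)
    rw [norm_smul]
    exact mul_le_mul_of_nonneg_left (htrn x) (norm_nonneg _)
  let fL : C(T, ℂ) := ∫ x, g x • tr x
  have hg1' : ∫ x, g x = 1 := by
    have := hgb 0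
    simpa [hb] using this
  let scale : PontryaginDual T → EuclideanSpace ℝ (Fin d) := fun ψ => WithLp.toLp 2 (L⁻¹ • ξ ψ)
  let c : PontryaginDual T → ℂ := fun ψ =>
    b (scale ψ) * (integralMul μ f (charFun ψ⁻¹) / μ.real Set.univ)
  -- Outside `Ξ` some coordinate of the frequency exceeds L, which already forces the rescaled
  -- Euclidean norm to be at least 1, beyond the support of `b`.
  have hc0 : ∀ ψ, ψ ∉ Ξ → c ψ = 0 := by
    intro ψ hψ
    have : ∃ j, L < |ξ ψ j| := by
      by_contra! hcon
      exact hψ (hΞ ψ hcon)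
    obtain ⟨j, hj⟩ := this
    have h1 : 1 ≤ ‖scale ψ‖ := by
      have h2 : ‖(scale ψ) j‖ ≤ ‖scale ψ‖ := PiLp.norm_apply_le _ j
      have h3 : (scale ψ) j = L⁻¹ * ξ ψ j := rfl
      rw [h3, norm_mul, Real.norm_eq_abs, Real.norm_eq_abs, abs_of_pos (inv_pos.mpr hL)] at h2
      refine le_trans ?_ h2
      rw [inv_mul_eq_div, one_le_div hL]
      exact hj.le
    simp [c, hbs _ h1]
  refine ⟨c, hc0, fun ψ => ?_, fun ψ hψ => ?_, fun t => ?_⟩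
  · simp only [c, norm_mul, norm_div, Complex.norm_real, Real.norm_eq_abs,
      abs_of_nonneg (hb0 _), abs_of_nonneg (measureReal_nonneg (μ := μ) (s := Set.univ))]
    exact mul_le_of_le_one_left (by positivity) (hb1 _)
  · have : scale ψ = 0 := by simp [scale, hψ]
    simp [c, this, hb]
  · have hcoef : ∀ ψ, integralMul μ fL (charFun ψ⁻¹) = c ψ * μ.real Set.univ := by
      intro ψ
      have hsymm : ∀ u v : C(T, ℂ), integralMul μ u v = integralMul μ v u := by
        intro u v
        simp only [integralMul_apply, mul_comm]
      rw [hsymm]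
      have h1 := (integralMul μ (charFun ψ⁻¹)).integral_comp_comm hint
      rw [← h1]
      have h2 : ∀ x, integralMul μ (charFun ψ⁻¹) (g x • tr x) =
          (Complex.exp ((2 * Real.pi * inner ℝ x (scale ψ) : ℝ) * Complex.I) * g x) *
            integralMul μ f (charFun ψ⁻¹) := by
        intro x
        rw [map_smul, smul_eq_mul]
        have h3 : integralMul μ (charFun ψ⁻¹) (tr x) =
            ((ψ (π (sc x)) : Circle) : ℂ) * integralMul μ f (charFun ψ⁻¹) := by
          have h4 := integral_mul_left_eq_self (μ := μ)
            (fun t => charFun ψ⁻¹ (t * (π (sc x))⁻¹) * f t) (π (sc x))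
          have h5 : ∀ t, charFun ψ⁻¹ (π (sc x) * t * (π (sc x))⁻¹) * f (π (sc x) * t) =
              charFun ψ⁻¹ t * tr x t := by
            intro t
            rw [htr, mul_inv_cancel_comm, mul_comm t]
          simp only [h5] at h4
          rw [integralMul_apply, h4, integralMul_apply, ← integral_const_mul]
          refine integral_congr_ae (Filter.Eventually.of_forall fun t => ?_)
          simp only [charFun_apply, dual_inv_apply, map_mul, map_inv, inv_inv, Circle.coe_mul]
          ring
        rw [h3, hξ, Circle.coe_exp]
        have h6 : inner ℝ x (scale ψ) = ∑ j, sc x j * ξ ψ j := by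
          rw [PiLp.inner_apply]
          refine Finset.sum_congr rfl fun j _ => ?_
          simp [scale, sc]
          ring
        rw [h6]
        ring
      simp only [h2]
      rw [integral_mul_const, hgb]
      simp only [c]
      field_simp
    have hfL := eq_sum_of_fourier_support μ hsep fL Ξ c hcoef hc0
    have hval : ∑ ψ ∈ Ξ, c ψ * ((ψ t : Circle) : ℂ) = fL t := by
      rw [hfL]
      simp [charFun_apply]
    rw [hval]
    have h7 : fL t = ∫ x, g x * f (t * π (sc x)) := by
      simp only [fL]
      rw [ContinuousMap.integral_apply hint]
      rfl
    have hint' : Integrable (fun x => g x * f (t * π (sc x))) := by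
      refine (hg.norm.mul_const ‖f‖).mono' (hg.aestronglyMeasurable.mul
        (Continuous.aestronglyMeasurable (by fun_prop))) (Filter.Eventually.of_forall fun x => ?_)
      rw [norm_mul]
      exact mul_le_mul_of_nonneg_left (f.norm_coe_le_norm _) (norm_nonneg _)
    have h8 : f t - fL t = ∫ x, g x * (f t - f (t * π (sc x))) := by
      simp only [mul_sub]
      rw [integral_sub (hg.mul_const _) hint', integral_mul_const, hg1', one_mul, h7]
    rw [h8, ← integral_const_mul]
    refine norm_integral_le_of_norm_le (hg1.const_mul _)
      (Filter.Eventually.of_forall fun x => ?_)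
    rw [norm_mul, norm_sub_rev]
    have h9 : ‖sc x‖ ≤ L⁻¹ * ‖x‖ := by
      rw [norm_smul, Real.norm_eq_abs, abs_of_pos (inv_pos.mpr hL)]
      refine mul_le_mul_of_nonneg_left ?_ (inv_pos.mpr hL).le
      exact (pi_norm_le_iff_of_nonneg (norm_nonneg _)).mpr fun j => PiLp.norm_apply_le x j
    have hΛ : ‖f (t * π (sc x)) - f t‖ ≤ Λ / L * ‖x‖ := by
      -- The sign of Λ is not given; `hf` yields Λ ≥ 0 as soon as the displacement is nonzero.
      by_cases hx : ‖sc x‖ = 0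
      · have : sc x = 0 := norm_eq_zero.mp hx
        have hx0 : x = 0 := by
          ext j
          have := congrFun this j
          simpa [sc, hL.ne'] using this
        have h10 := hf t (sc x)
        rw [hx, mul_zero] at h10
        simpa [hx0] using h10
      · have hpos : 0 < ‖sc x‖ := lt_of_le_of_ne (norm_nonneg _) (Ne.symm hx)
        have hΛ0 : 0 ≤ Λ := by
          by_contra hneg
          push Not at hneg
          have := (norm_nonneg _).trans (hf t (sc x))
          nlinarith
        refine (hf t (sc x)).trans ((mul_le_mul_of_nonneg_left h9 hΛ0).trans_eq ?_)
        ring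
    calc ‖g x‖ * ‖f (t * π (sc x)) - f t‖ ≤ ‖g x‖ * (Λ / L * ‖x‖) :=
          mul_le_mul_of_nonneg_left hΛ (norm_nonneg _)
      _ = Λ / L * (‖x‖ * ‖g x‖) := by ring

end Approximation

/-! ### Plateau functions -/

section Plateau

variable {T : Type*} [CommGroup T] {d : ℕ}

/-- A function equal to `1` on `P`, supported in the `ε`-neighbourhood of `P` along the
one-parameter family `π`, and with Lipschitz constant `1 / ε` along it. -/
def plateau (π : (Fin d → ℝ) → T) (ε : ℝ) (P : Set T) (t : T) : ℝ :=
  ⨆ y : Fin d → ℝ, P.indicator (fun _ => max 0 (1 - ‖y‖ / ε)) (t * π y)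

variable {π : (Fin d → ℝ) → T} {ε : ℝ} {P : Set T}

theorem plateau_term_nonneg (t : T) (y : Fin d → ℝ) :
    0 ≤ P.indicator (fun _ => max 0 (1 - ‖y‖ / ε)) (t * π y) :=
  Set.indicator_nonneg (fun _ _ => le_max_left _ _) _

theorem plateau_term_le_one (hε : 0 < ε) (t : T) (y : Fin d → ℝ) :
    P.indicator (fun _ => max 0 (1 - ‖y‖ / ε)) (t * π y) ≤ 1 := by
  refine Set.indicator_le' (fun _ _ => ?_) (fun _ _ => zero_le_one) _
  exact max_le zero_le_one (sub_le_self _ (by positivity))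

theorem plateau_bddAbove (hε : 0 < ε) (t : T) :
    BddAbove (Set.range fun y : Fin d → ℝ =>
      P.indicator (fun _ => max 0 (1 - ‖y‖ / ε)) (t * π y)) :=
  ⟨1, by rintro _ ⟨y, rfl⟩; exact plateau_term_le_one hε t y⟩

theorem plateau_nonneg (t : T) : 0 ≤ plateau π ε P t :=
  Real.iSup_nonneg fun y => plateau_term_nonneg t y

theorem plateau_le_one (hε : 0 < ε) (t : T) : plateau π ε P t ≤ 1 :=
  ciSup_le fun y => plateau_term_le_one hε t y

theorem plateau_eq_one (hε : 0 < ε) (hadd : ∀ x y, π (x + y) = π x * π y) {t : T} (ht : t ∈ P) :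
    plateau π ε P t = 1 := by
  refine le_antisymm (plateau_le_one hε t) ?_
  refine le_trans ?_ (le_ciSup (plateau_bddAbove hε t) 0)
  have h0 : π 0 = 1 := map_zero_of_add hadd
  simp [h0, ht]

theorem exists_of_plateau_ne_zero (hε : 0 < ε) {t : T} (ht : plateau π ε P t ≠ 0) :
    ∃ y : Fin d → ℝ, ‖y‖ < ε ∧ t * π y ∈ P := by
  by_contra! hcon
  refine ht (le_antisymm (ciSup_le fun y => ?_) (plateau_nonneg t))
  by_cases hy : ‖y‖ < ε
  · rw [Set.indicator_of_notMem (hcon y hy)]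
  · refine Set.indicator_le' (fun _ _ => ?_) (fun _ _ => le_rfl) _
    refine max_le le_rfl ?_
    have : 1 ≤ ‖y‖ / ε := by rw [one_le_div hε]; linarith
    linarith

/-- A competitor y at t gives the competitor y - x at t · π x, reaching the same point of P, and the
two weights differ by at most ‖x‖/ε. -/
theorem plateau_le_add (hε : 0 < ε) (hadd : ∀ x y, π (x + y) = π x * π y) (t : T)
    (x : Fin d → ℝ) : plateau π ε P t ≤ plateau π ε P (t * π x) + ‖x‖ / ε := by
  refine ciSup_le fun y => ?_
  have h1 := le_ciSup (plateau_bddAbove (P := P) (π := π) hε (t * π x)) (y - x)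
  have h2 : t * π x * π (y - x) = t * π y := by
    rw [mul_assoc, ← hadd, add_sub_cancel]
  change _ ≤ plateau π ε P (t * π x) at h1
  simp only [h2] at h1
  have h3 : 0 ≤ ‖x‖ / ε := by positivity
  refine le_trans ?_ (add_le_add_left h1 _)
  by_cases hP : t * π y ∈ P
  · rw [Set.indicator_of_mem hP, Set.indicator_of_mem hP]
    refine max_le (add_nonneg (le_max_left _ _) h3) ?_
    have h4 : ‖y - x‖ / ε ≤ ‖y‖ / ε + ‖x‖ / ε := by
      rw [← add_div]
      exact div_le_div_of_nonneg_right (norm_sub_le y x) hε.le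
    have h5 := le_max_right 0 (1 - ‖y - x‖ / ε)
    linarith
  · rw [Set.indicator_of_notMem hP, Set.indicator_of_notMem hP]
    linarith

theorem abs_plateau_sub_le (hε : 0 < ε) (hadd : ∀ x y, π (x + y) = π x * π y) (t : T)
    (x : Fin d → ℝ) : |plateau π ε P (t * π x) - plateau π ε P t| ≤ 1 / ε * ‖x‖ := by
  rw [abs_sub_le_iff]
  constructor
  · have h := plateau_le_add (P := P) hε hadd (t * π x) (-x)
    have h0 : π x * π (-x) = 1 := by
      rw [← hadd, add_neg_cancel, map_zero_of_add hadd]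
    rw [mul_assoc, h0, mul_one, norm_neg] at h
    rw [one_div_mul_eq_div]
    linarith
  · have h := plateau_le_add (P := P) hε hadd t x
    rw [one_div_mul_eq_div]
    linarith

/-- Since π is open, every point near t is t · π x with x small, so the Lipschitz bound along π is
enough. -/
theorem continuous_plateau [TopologicalSpace T] [IsTopologicalGroup T] (hε : 0 < ε)
    (hadd : ∀ x y, π (x + y) = π x * π y) (hopen : IsOpenMap π) :
    Continuous (plateau π ε P) := by
  rw [continuous_iff_continuousAt]
  intro t
  rw [ContinuousAt, Metric.tendsto_nhds]
  intro η hη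
  have h0 : π 0 = 1 := map_zero_of_add hadd
  have h1 : π '' Metric.ball 0 (η * ε) ∈ nhds (1 : T) := by
    rw [← h0]
    exact hopen.image_mem_nhds (Metric.ball_mem_nhds _ (by positivity))
  have h2 : Filter.Tendsto (fun s => t⁻¹ * s) (nhds t) (nhds 1) := by
    have : Continuous fun s : T => t⁻¹ * s := by fun_prop
    simpa using this.tendsto t
  filter_upwards [h2 h1] with s hs
  obtain ⟨x, hx, hxs⟩ := hs
  have hs' : s = t * π x := by rw [hxs]; group
  rw [hs', Real.dist_eq]
  refine (abs_plateau_sub_le hε hadd t x).trans_lt ?_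
  rw [mem_ball_zero_iff] at hx
  rw [one_div_mul_eq_div, div_lt_iff₀ hε]
  exact hx

end Plateau

end IdeleTorus

namespace IdeleTorus

/-! ### Bases of sublattices of `ℤ^d` -/

/-- A sublattice of finite index of `ℤ^d` has a basis for which the coordinates of a vector are
bounded in terms of the vector and `d` only. -/
theorem exists_lattice_basis (d : ℕ) : ∃ C : ℝ, 0 < C ∧
    ∀ (Λ : AddSubgroup (Fin d → ℤ)), (∃ N : ℤ, N ≠ 0 ∧ ∀ v : Fin d → ℤ, N • v ∈ Λ) →
      ∃ b : Fin d → Fin d → ℤ, (∀ v, v ∈ Λ ↔ ∃ c : Fin d → ℤ, v = ∑ j, c j • b j) ∧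
        ∀ y : Fin d → ℝ, ‖y‖ ≤ C * ‖∑ j, y j • fun i => (b j i : ℝ)‖ := by
  induction d with
  | zero =>
    refine ⟨1, one_pos, fun Λ _ => ⟨fun _ => 0, fun v => ?_, fun y => ?_⟩⟩
    · rw [Subsingleton.elim v 0]
      exact ⟨fun _ => ⟨0, by simp⟩, fun _ => Λ.zero_mem⟩
    · have : y = 0 := Subsingleton.elim _ _
      simp [this]
  | succ d ih =>
    obtain ⟨C, hC, ih⟩ := ih
    -- Hermite normal form: the basis consists of m e₀, generating the intersection of Λ with the
    -- first axis, and of lifts of a basis of the projection of Λ to the last d coordinates, with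
    -- first coordinates reduced modulo m.
    refine ⟨1 + (d + 1) * C, by positivity, fun Λ ⟨N, hN, hΛ⟩ => ?_⟩
    let tl : (Fin (d + 1) → ℤ) →+ (Fin d → ℤ) :=
      { toFun := fun v => Fin.tail v, map_zero' := rfl, map_add' := fun _ _ => rfl }
    let cn : ℤ →+ (Fin (d + 1) → ℤ) :=
      { toFun := fun t => Fin.cons t 0
        map_zero' := by ext i; refine Fin.cases ?_ (fun i => ?_) i <;> simp
        map_add' := fun s t => by ext i; refine Fin.cases ?_ (fun i => ?_) i <;> simp }
    obtain ⟨b', hb', hbd⟩ := ih (Λ.map tl) ⟨N, hN, fun v => ⟨N • Fin.cons 0 v, hΛ _, by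
      ext i
      change (N • (Fin.cons 0 v : Fin (d + 1) → ℤ)) i.succ = (N • v) i
      simp⟩⟩
    obtain ⟨m, hm⟩ := Int.subgroup_cyclic (Λ.comap cn)
    have hmem : ∀ t : ℤ, (Fin.cons t 0 : Fin (d + 1) → ℤ) ∈ Λ ↔ ∃ k : ℤ, k * m = t := by
      intro t
      have : t ∈ Λ.comap cn ↔ ∃ k : ℤ, k • m = t := by
        rw [hm, AddSubgroup.mem_closure_singleton]
      exact this
    have hm0 : m ≠ 0 := by
      rintro rfl
      obtain ⟨k, hk⟩ := (hmem N).mp (by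
        have := hΛ (Fin.cons 1 0)
        convert this using 1
        ext i; refine Fin.cases ?_ (fun i => ?_) i <;> simp)
      rw [mul_zero] at hk
      exact hN hk.symm
    have hlift : ∀ j, ∃ a : ℤ, (0 ≤ a ∧ a < |m|) ∧ (Fin.cons a (b' j) : Fin (d + 1) → ℤ) ∈ Λ := by
      intro j
      obtain ⟨w, hw, hwt⟩ := (hb' (b' j)).mpr ⟨Pi.single j 1, by
        rw [Finset.sum_eq_single j] <;> simp +contextual [Pi.single_eq_of_ne]⟩
      refine ⟨w 0 % m, ⟨Int.emod_nonneg _ hm0, Int.emod_lt_abs _ hm0⟩, ?_⟩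
      have h1 : (Fin.cons (w 0 % m) (b' j) : Fin (d + 1) → ℤ) =
          w - Fin.cons ((w 0 / m) * m) 0 := by
        ext i
        refine Fin.cases ?_ (fun i => ?_) i
        · simp only [Fin.cons_zero, Pi.sub_apply]
          have := Int.emod_add_mul_ediv (w 0) m
          linarith
        · rw [← hwt]
          change w i.succ = w i.succ - (Fin.cons ((w 0 / m) * m) 0 : Fin (d + 1) → ℤ) i.succ
          simp
      rw [h1]
      exact Λ.sub_mem hw ((hmem _).mpr ⟨_, rfl⟩)
    choose a ha haΛ using hlift
    refine ⟨Fin.cons (Fin.cons m 0) (fun j => Fin.cons (a j) (b' j)), fun v => ⟨fun hv => ?_, ?_⟩,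
      fun y => ?_⟩
    · obtain ⟨c, hc⟩ := (hb' (Fin.tail v)).mp ⟨v, hv, rfl⟩
      have h1 : (Fin.cons (v 0 - ∑ j, c j * a j) 0 : Fin (d + 1) → ℤ) ∈ Λ := by
        have : (Fin.cons (v 0 - ∑ j, c j * a j) 0 : Fin (d + 1) → ℤ) =
            v - ∑ j, c j • Fin.cons (a j) (b' j) := by
          ext i
          refine Fin.cases ?_ (fun i => ?_) i
          · simp [Finset.sum_apply]
          · have := congrFun hc i
            simp only [Fin.tail, Finset.sum_apply, Pi.smul_apply] at this
            simp [Finset.sum_apply, this]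
        rw [this]
        exact Λ.sub_mem hv (Λ.sum_mem fun j _ => Λ.zsmul_mem (haΛ j) _)
      obtain ⟨k, hk⟩ := (hmem _).mp h1
      refine ⟨Fin.cons k c, ?_⟩
      rw [Fin.sum_univ_succ]
      ext i
      refine Fin.cases ?_ (fun i => ?_) i
      · simp [Finset.sum_apply, hk]
      · have := congrFun hc i
        simp only [Fin.tail, Finset.sum_apply, Pi.smul_apply] at this
        simp [Finset.sum_apply, this]
    · rintro ⟨c, rfl⟩
      refine Λ.sum_mem fun j _ => Λ.zsmul_mem ?_ _
      refine Fin.cases ?_ (fun j => ?_) j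
      · exact (hmem m).mpr ⟨1, one_mul m⟩
      · exact haΛ j
    · set X : Fin (d + 1) → ℝ := ∑ j, y j • fun i => (((Fin.cons (Fin.cons m 0)
        (fun j => Fin.cons (a j) (b' j)) : Fin (d + 1) → Fin (d + 1) → ℤ) j i : ℤ) : ℝ) with hX
      have hX0 : X 0 = y 0 * m + ∑ j : Fin d, y j.succ * a j := by
        rw [hX, Fin.sum_univ_succ]
        simp [Finset.sum_apply]
      have hXs : Fin.tail X = ∑ j : Fin d, Fin.tail y j • fun i => (b' j i : ℝ) := by
        ext i
        rw [hX, Fin.sum_univ_succ]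
        simp [Fin.tail, Finset.sum_apply]
      have htail : ‖Fin.tail y‖ ≤ C * ‖X‖ := by
        refine (hbd (Fin.tail y)).trans (mul_le_mul_of_nonneg_left ?_ hC.le)
        rw [← hXs]
        exact (pi_norm_le_iff_of_nonneg (norm_nonneg _)).mpr fun j => norm_le_pi_norm X j.succ
      have hmr : (1 : ℝ) ≤ |(m : ℝ)| := by
        have := Int.one_le_abs hm0
        exact_mod_cast this
      -- Here X₀ = y₀m + ∑ yⱼaⱼ with |aⱼ| ≤ |m|. Dividing by |m| ≥ 1 gives a bound in which m, and
      -- so the index of Λ, no longer appears.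
      have h0 : |y 0| ≤ (1 + d * C) * ‖X‖ := by
        have h1 : |y 0| * |(m : ℝ)| ≤ ‖X‖ + d * (C * ‖X‖ * |(m : ℝ)|) := by
          rw [← abs_mul]
          have h2 : y 0 * m = X 0 - ∑ j : Fin d, y j.succ * a j := by rw [hX0]; ring
          rw [h2]
          refine (abs_sub _ _).trans (add_le_add (norm_le_pi_norm X 0) ?_)
          refine (Finset.abs_sum_le_sum_abs _ _).trans ?_
          refine (Finset.sum_le_card_nsmul _ _ (C * ‖X‖ * |(m : ℝ)|) fun j _ => ?_).trans_eq ?_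
          · rw [abs_mul]
            refine mul_le_mul ((norm_le_pi_norm (Fin.tail y) j).trans htail) ?_ (abs_nonneg _)
              (by positivity)
            rw [abs_of_nonneg (by exact_mod_cast (ha j).1)]
            exact_mod_cast (ha j).2.le
          · simp
        have h3 : ‖X‖ ≤ ‖X‖ * |(m : ℝ)| := le_mul_of_one_le_right (norm_nonneg _) hmr
        have h4 : |y 0| * |(m : ℝ)| ≤ (1 + d * C) * ‖X‖ * |(m : ℝ)| := by nlinarith
        exact le_of_mul_le_mul_right h4 (by linarith)
      refine (pi_norm_le_iff_of_nonneg (by positivity)).mpr fun i => ?_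
      have hCX : 0 ≤ C * ‖X‖ := by positivity
      refine Fin.cases ?_ (fun i => ?_) i
      · rw [Real.norm_eq_abs]
        nlinarith
      · refine ((norm_le_pi_norm (Fin.tail y) i).trans htail).trans ?_
        have : 0 ≤ d * (C * ‖X‖) := by positivity
        nlinarith [norm_nonneg X]

/-! ### Quotients of a group by the same subgroup -/

/-- Continuous open surjections are quotient maps, so G and H are both the topological quotient of V
by the common kernel. -/
theorem exists_continuousMulEquiv_of_kernel_eq {V G H : Type*} [AddCommGroup V]
    [TopologicalSpace V] [CommGroup G] [TopologicalSpace G] [CommGroup H] [TopologicalSpace H]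
    {p : V → G} {r : V → H} (hpc : Continuous p) (hrc : Continuous r) (hpo : IsOpenMap p)
    (hro : IsOpenMap r) (hps : Function.Surjective p) (hrs : Function.Surjective r)
    (hpa : ∀ x y, p (x + y) = p x * p y) (hra : ∀ x y, r (x + y) = r x * r y)
    (hker : ∀ x, p x = 1 ↔ r x = 1) : ∃ e : G ≃ₜ* H, ∀ x, e (p x) = r x := by
  have hp0 : p 0 = 1 := by
    have := hpa 0 0
    rw [add_zero] at this
    exact left_eq_mul.mp this
  have hr0 : r 0 = 1 := (hker 0).mp hp0
  have hpr : ∀ x y, p x = p y ↔ r x = r y := by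
    intro x y
    have h1 : p x = p (x - y) * p y := by rw [← hpa, sub_add_cancel]
    have h2 : r x = r (x - y) * r y := by rw [← hra, sub_add_cancel]
    rw [h1, h2, mul_eq_right, mul_eq_right, hker]
  let f : G → H := fun g => r (Function.surjInv hps g)
  let g : H → G := fun h => p (Function.surjInv hrs h)
  have hf : ∀ x, f (p x) = r x := fun x => (hpr _ _).mp (Function.surjInv_eq hps (p x))
  have hg : ∀ x, g (r x) = p x := fun x => (hpr _ _).mpr (Function.surjInv_eq hrs (r x))
  have hpq : Topology.IsQuotientMap p := hpo.isQuotientMap hpc hps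
  have hrq : Topology.IsQuotientMap r := hro.isQuotientMap hrc hrs
  refine ⟨⟨⟨⟨f, g, fun a => ?_, fun a => ?_⟩, fun a b => ?_⟩, ?_, ?_⟩, hf⟩
  · obtain ⟨x, rfl⟩ := hps a
    rw [hf, hg]
  · obtain ⟨x, rfl⟩ := hrs a
    rw [hg, hf]
  · obtain ⟨x, rfl⟩ := hps a
    obtain ⟨y, rfl⟩ := hps b
    change f _ = f _ * f _
    rw [← hpa, hf, hf, hf, hra]
  · change Continuous f
    rw [hpq.continuous_iff]
    convert hrc using 1
    exact funext hf
  · change Continuous g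
    rw [hrq.continuous_iff]
    convert hpc using 1
    exact funext hg

/-- A torus `ℝ^d/Λ` with `Λ ⊆ ℤ^d` of finite index is isomorphic to the standard torus, through a
linear map whose inverse is bounded in terms of `d` only. -/
theorem exists_torus_equiv (d : ℕ) : ∃ C : ℝ, 0 < C ∧
    ∀ {G : Type*} [CommGroup G] [TopologicalSpace G] (p : (Fin d → ℝ) → G),
      Continuous p → IsOpenMap p → Function.Surjective p →
      (∀ x y, p (x + y) = p x * p y) →
      (∀ x, p x = 1 → ∃ z : Fin d → ℤ, x = fun j => (z j : ℝ)) →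
      (∃ N : ℤ, N ≠ 0 ∧ ∀ z : Fin d → ℤ, p (fun j => ((N * z j : ℤ) : ℝ)) = 1) →
      ∃ (e : G ≃ₜ* (Fin d → Circle)) (B : (Fin d → ℝ) ≃L[ℝ] (Fin d → ℝ)),
        (∀ x, e (p x) = torusProj (B x)) ∧ ∀ x, ‖B x‖ ≤ C * ‖x‖ := by
  obtain ⟨C, hC, hbasis⟩ := exists_lattice_basis d
  refine ⟨C, hC, fun {G} _ _ p hpc hpo hps hpa hker ⟨N, hN, hpN⟩ => ?_⟩
  have hp0 : p 0 = 1 := by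
    have := hpa 0 0
    rw [add_zero] at this
    exact left_eq_mul.mp this
  let ι : (Fin d → ℤ) →+ (Fin d → ℝ) :=
    { toFun := fun z j => (z j : ℝ), map_zero' := by ext; simp, map_add' := fun _ _ => by
        ext; simp }
  let pm : (Fin d → ℤ) →+ Additive G :=
    { toFun := fun z => Additive.ofMul (p (ι z))
      map_zero' := by rw [map_zero, hp0]; rfl
      map_add' := fun x y => by rw [map_add, hpa]; rfl }
  obtain ⟨b, hb, hbd⟩ := hbasis pm.ker ⟨N, hN, fun v => hpN v⟩
  -- A carries ℤ^d onto the period lattice of p, so its inverse trivializes the torus; the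
  -- coordinate bound for the basis is exactly the bound on that inverse.
  let A : (Fin d → ℝ) →ₗ[ℝ] (Fin d → ℝ) :=
    ∑ j, (LinearMap.proj j : (Fin d → ℝ) →ₗ[ℝ] ℝ).smulRight (ι (b j))
  have hA : ∀ y, A y = ∑ j, y j • fun i => (b j i : ℝ) := by
    intro y
    simp only [A, LinearMap.sum_apply, LinearMap.smulRight_apply, LinearMap.proj_apply]
    rfl
  have hinj : Function.Injective A := by
    rw [injective_iff_map_eq_zero]
    intro y hy
    have := hbd y
    rw [← hA, hy, norm_zero, mul_zero] at this
    exact norm_le_zero_iff.mp this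
  let Ae : (Fin d → ℝ) ≃L[ℝ] (Fin d → ℝ) :=
    (LinearEquiv.ofInjectiveEndo A hinj).toContinuousLinearEquiv
  have hAe : ∀ y, Ae y = A y := fun y => rfl
  have hAint : ∀ c : Fin d → ℤ, A (ι c) = ι (∑ j, c j • b j) := by
    intro c
    rw [hA, map_sum]
    refine Finset.sum_congr rfl fun j _ => ?_
    ext i
    simp [ι]
  obtain ⟨e, he⟩ := exists_continuousMulEquiv_of_kernel_eq (p := p)
    (r := fun x => torusProj (Ae.symm x)) hpc
    (continuous_torusProj.comp Ae.symm.continuous) hpo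
    (isOpenMap_torusProj.comp Ae.symm.toHomeomorph.isOpenMap) hps
    (torusProj_surjective.comp Ae.symm.surjective) hpa
    (fun x y => by rw [map_add, torusProj_add]) (fun x => by
      rw [torusProj_eq_one_iff]
      constructor
      · intro hx
        obtain ⟨z, hz⟩ := hker x hx
        obtain ⟨c, hc⟩ := (hb z).mp (by
          change p (ι z) = 1
          rw [← hx, hz]
          rfl)
        refine ⟨c, ?_⟩
        rw [Ae.symm_apply_eq, hAe, show (fun j => (c j : ℝ)) = ι c from rfl, hAint, ← hc]
        exact hz
      · rintro ⟨c, hc⟩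
        rw [Ae.symm_apply_eq, hAe, show (fun j => (c j : ℝ)) = ι c from rfl, hAint] at hc
        have h1 : (∑ j, c j • b j) ∈ pm.ker := (hb _).mpr ⟨c, rfl⟩
        have h2 : p (ι (∑ j, c j • b j)) = 1 := h1
        rw [hc, h2])
  refine ⟨e, Ae.symm, he, fun x => ?_⟩
  have := hbd (Ae.symm x)
  rw [← hA, ← hAe, Ae.apply_symm_apply] at this
  exact this

/-! ### Extension of characters -/

instance : DivisibleBy (Additive Circle) ℤ where
  div z n := Additive.ofMul (Circle.exp (Complex.arg (Additive.toMul z : Circle) / n))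
  div_zero z := by simp
  div_cancel {n} z hn := by
    have hn' : (n : ℝ) ≠ 0 := by exact_mod_cast hn
    rw [← ofMul_zpow, ← Circle.exp_zsmul, zsmul_eq_mul, mul_div_cancel₀ _ hn', Circle.exp_arg]
    rfl

/-- A divisible abelian group is injective. -/
theorem exists_extend_character {A : Type*} [CommGroup A] (S : Subgroup A) (φ : S →* Circle) :
    ∃ ψ : A →* Circle, ∀ s : S, ψ s = φ s := by
  obtain ⟨h, hh⟩ := (Module.Baer.of_divisible (Additive Circle)).extension_property_addMonoidHom
    (MonoidHom.toAdditive S.subtype) Subtype.val_injective (MonoidHom.toAdditive φ)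
  exact ⟨MonoidHom.toAdditive.symm h, fun s => DFunLike.congr_fun hh s⟩

/-- Any algebraic extension is continuous: it suffices to check at 1, where S is a neighbourhood. -/
theorem exists_continuous_extend {A : Type*} [CommGroup A] [TopologicalSpace A]
    [IsTopologicalGroup A] {S : Subgroup A} (hS : IsOpen (S : Set A)) (φ : S →* Circle)
    (hφ : Continuous φ) : ∃ ψ : PontryaginDual A, ∀ s : S, ψ s = φ s := by
  obtain ⟨ψ, hψ⟩ := exists_extend_character S φ
  refine ⟨(⟨ψ, continuous_of_continuousAt_one ψ ?_⟩ : A →ₜ* Circle), hψ⟩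
  have h1 : ContinuousOn ψ S := by
    rw [continuousOn_iff_continuous_domRestrict]
    have : (S : Set A).domRestrict ψ = φ := funext hψ
    rw [this]
    exact hφ
  exact h1.continuousAt (hS.mem_nhds S.one_mem)

theorem exists_character_ne_one_of_finite {A : Type*} [CommGroup A] [Finite A] {a : A}
    (ha : a ≠ 1) : ∃ ψ : A →* Circle, ψ a ≠ 1 := by
  obtain ⟨φ, hφ⟩ := CommGroup.exists_apply_ne_one_of_hasEnoughRootsOfUnity A ℂ ha
  have hnorm : ∀ x, ‖((φ x : ℂˣ) : ℂ)‖ = 1 := by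
    intro x
    have h1 : (φ x) ^ Nat.card A = 1 := by rw [← map_pow, pow_card_eq_one', map_one]
    have h2 : ‖((φ x : ℂˣ) : ℂ)‖ ^ Nat.card A = 1 := by
      rw [← norm_pow, ← Units.val_pow_eq_pow_val, h1]
      simp
    exact (pow_eq_one_iff_of_nonneg (norm_nonneg _) Nat.card_pos.ne').mp h2
  refine ⟨{ toFun := fun x => ⟨(φ x : ℂ), mem_sphere_zero_iff_norm.mpr (hnorm x)⟩
            map_one' := by ext; simp
            map_mul' := fun x y => Circle.ext (congrArg Units.val (map_mul φ x y)) }, fun h => hφ ?_⟩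
  ext
  exact congrArg (fun z : Circle => (z : ℂ)) h

/-- If the neutral component is an open torus of finite index, then the characters separate
points. -/
theorem exists_dual_ne_one {A : Type*} [CommGroup A] [TopologicalSpace A]
    [IsTopologicalGroup A] {d : ℕ} {S : Subgroup A} (hS : IsOpen (S : Set A)) [S.FiniteIndex]
    (e : S ≃ₜ* (Fin d → Circle)) {t : A} (ht : t ≠ 1) : ∃ ψ : PontryaginDual A, ψ t ≠ 1 := by
  by_cases htS : t ∈ S
  · have h1 : e ⟨t, htS⟩ ≠ 1 := by
      intro h
      rw [EmbeddingLike.map_eq_one_iff] at h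
      exact ht (congrArg Subtype.val h)
    obtain ⟨j, hj⟩ : ∃ j, e ⟨t, htS⟩ j ≠ 1 := by
      by_contra! hcon
      exact h1 (funext hcon)
    obtain ⟨ψ, hψ⟩ := exists_continuous_extend hS
      ((Pi.evalMonoidHom (fun _ : Fin d => Circle) j).comp e.toMulEquiv.toMonoidHom)
      ((continuous_apply j).comp e.continuous)
    exact ⟨ψ, by rw [hψ ⟨t, htS⟩]; exact hj⟩
  · have h1 : (t : A ⧸ S) ≠ 1 := by rwa [Ne, QuotientGroup.eq_one_iff]
    have : Finite (A ⧸ S) := Subgroup.finite_quotient_of_finiteIndex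
    obtain ⟨φ, hφ⟩ := exists_character_ne_one_of_finite h1
    have hdisc : DiscreteTopology (A ⧸ S) := QuotientGroup.discreteTopology hS
    refine ⟨(⟨φ.comp (QuotientGroup.mk' S), ?_⟩ : A →ₜ* Circle), hφ⟩
    exact (continuous_of_discreteTopology (f := φ)).comp QuotientGroup.continuous_mk

end IdeleTorus

namespace IdeleTorus

/-! ### The volume of the collar of a convex set -/

section Collar

variable {d : ℕ}

/-- The open orthant of `ℝ^d` with the given signs. -/
def orthant (s : Fin d → Bool) : Set (Fin d → ℝ) :=
  {v | ∀ j, 0 < (if s j then 1 else -1) * v j}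

/-- The points of the collar of `C` from which no point of `C` is visible in the directions of
an orthant. -/
def collarPiece (C : Set (Fin d → ℝ)) (ε : ℝ) (s : Fin d → Bool) : Set (Fin d → ℝ) :=
  Metric.thickening ε C \ {x | ∃ v ∈ orthant s, x + v ∈ C}

theorem collar_subset_iUnion {C : Set (Fin d → ℝ)} (hC : IsOpen C) (hconv : Convex ℝ C) (ε : ℝ) :
    Metric.thickening ε C \ C ⊆ ⋃ s, collarPiece C ε s := by
  rintro x ⟨hx, hxC⟩
  obtain ⟨l, hl⟩ := geometric_hahn_banach_open_point hconv hC hxC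
  -- The orthant is the one on which the separating functional is nonnegative: moving from x in its
  -- directions does not decrease l, whereas l < l x on C.
  refine Set.mem_iUnion.mpr ⟨fun j => decide (0 ≤ l (Pi.single j 1)), hx, ?_⟩
  rintro ⟨v, hv, hxv⟩
  have h1 := hl _ hxv
  rw [map_add] at h1
  have h2 : l v = ∑ j, v j * l (Pi.single j 1) := by
    conv_lhs => rw [← Finset.univ_sum_single v, map_sum]
    refine Finset.sum_congr rfl fun j _ => ?_
    rw [← smul_eq_mul, ← map_smul, ← Pi.single_smul, smul_eq_mul, mul_one]
  have h3 : 0 ≤ l v := by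
    rw [h2]
    refine Finset.sum_nonneg fun j _ => ?_
    have hj := hv j
    by_cases h : 0 ≤ l (Pi.single j 1)
    · simp only [h, decide_true, if_true, one_mul] at hj
      exact mul_nonneg hj.le h
    · simp only [h, decide_false, Bool.false_eq_true, if_false, neg_one_mul] at hj
      push Not at h
      nlinarith
  linarith

theorem isOpen_visible {C : Set (Fin d → ℝ)} (hC : IsOpen C) (s : Fin d → Bool) :
    IsOpen {x | ∃ v ∈ orthant s, x + v ∈ C} := by
  have : {x | ∃ v ∈ orthant s, x + v ∈ C} = ⋃ v ∈ orthant s, (fun x => x + v) ⁻¹' C := by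
    ext x
    simp
  rw [this]
  exact isOpen_biUnion fun v _ => hC.preimage (by fun_prop)

/-- The diagonal vector of an orthant. -/
def orthantDiag (s : Fin d → Bool) : Fin d → ℝ := fun j => if s j then 1 else -1

theorem norm_orthantDiag_le (s : Fin d → Bool) : ‖orthantDiag s‖ ≤ 1 := by
  refine (pi_norm_le_iff_of_nonneg zero_le_one).mpr fun j => ?_
  unfold orthantDiag
  split_ifs <;> simp

/-- If x + r · diag were within ε of some c ∈ C, each coordinate of c - x would have the sign
prescribed by the orthant, of size more than r - ε > 0, and c would be visible from x. This makes
translates of the piece by steps of 2ε disjoint. -/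
theorem collarPiece_add_notMem {C : Set (Fin d → ℝ)} {ε : ℝ} (hε : 0 < ε) {s : Fin d → Bool}
    {x : Fin d → ℝ} (hx : x ∈ collarPiece C ε s) {r : ℝ} (hr : 2 * ε ≤ r) :
    x + r • orthantDiag s ∉ Metric.thickening ε C := by
  intro h
  obtain ⟨c, hc, hxc⟩ := Metric.mem_thickening_iff.mp h
  refine hx.2 ⟨c - x, fun j => ?_, by rwa [add_sub_cancel]⟩
  rw [dist_eq_norm] at hxc
  have h1 := (norm_le_pi_norm _ j).trans_lt hxc
  simp only [Pi.sub_apply, Pi.add_apply, Pi.smul_apply, smul_eq_mul, orthantDiag,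
    Real.norm_eq_abs, abs_lt] at h1
  simp only [Pi.sub_apply]
  split_ifs with hs
  · simp only [hs, if_true, mul_one] at h1
    linarith
  · simp only [hs, if_false, Bool.false_eq_true] at h1
    linarith

variable {T : Type*} [CommGroup T] [TopologicalSpace T] [IsTopologicalGroup T]
  [MeasurableSpace T] [BorelSpace T] (μ : Measure T) [μ.IsMulLeftInvariant]
  {π : (Fin d → ℝ) → T}

theorem injOn_ball_of_kernel (hadd : ∀ x y, π (x + y) = π x * π y)
    (hker : ∀ x, π x = 1 → ∃ z : Fin d → ℤ, x = fun j => (z j : ℝ)) :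
    Set.InjOn π (Metric.ball 0 (1 / 2)) := by
  intro x hx y hy hxy
  rw [mem_ball_zero_iff] at hx hy
  have h1 : π (x - y) = 1 := by rw [map_sub_of_add hadd, hxy, mul_inv_cancel]
  obtain ⟨z, hz⟩ := hker _ h1
  have h2 : ‖x - y‖ < 1 := by
    have := norm_sub_le x y
    linarith
  have h3 : ∀ j, z j = 0 := by
    intro j
    have h4 := (norm_le_pi_norm (x - y) j).trans_lt h2
    rw [hz, Real.norm_eq_abs] at h4
    have h5 : |(z j : ℝ)| < 1 := h4
    have h5 : |z j| < 1 := by exact_mod_cast h5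
    exact Int.abs_lt_one_iff.mp h5
  rw [← sub_eq_zero, hz]
  ext j
  simp [h3 j]

/-- A packing argument: about 1/(16ε) translates of the piece along the diagonal of the orthant are
pairwise disjoint and stay inside the cube on which π is injective. It takes place in T itself, so
of μ only the invariance enters. -/
theorem measure_collarPiece_le (hadd : ∀ x y, π (x + y) = π x * π y) (hopen : IsOpenMap π)
    (hker : ∀ x, π x = 1 → ∃ z : Fin d → ℤ, x = fun j => (z j : ℝ))
    {C : Set (Fin d → ℝ)} (hC : IsOpen C) {δ ε : ℝ} (hδ : δ ≤ 1 / 4)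
    (hCδ : C ⊆ Metric.closedBall 0 δ) (hε : 0 < ε) (hε' : ε ≤ 1 / 16) (s : Fin d → Bool) :
    μ (π '' collarPiece C ε s) ≤
      ENNReal.ofReal (32 * ε) * μ (π '' Metric.ball 0 (1 / 2)) := by
  set A := collarPiece C ε s with hA
  -- Fewer than N steps of 2ε move a point by at most 1/8, and δ + ε + 1/8 ≤ 7/16 stays below 1/2.
  -- Since ε ≤ 1/16 gives N ≥ 1, the floor costs at most a factor 2, whence 32ε.
  set N : ℕ := ⌊1 / (16 * ε)⌋₊ with hN
  have hNle : (N : ℝ) ≤ 1 / (16 * ε) := Nat.floor_le (by positivity)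
  have hNge : 1 ≤ N * (32 * ε) := by
    have h1 : 1 / (16 * ε) < N + 1 := Nat.lt_floor_add_one _
    rw [div_lt_iff₀ (by positivity)] at h1
    have h2 : (1 : ℝ) ≤ N := by
      have : 1 ≤ N := Nat.le_floor (by
        rw [Nat.cast_one, one_le_div (by positivity)]
        linarith)
      exact_mod_cast this
    nlinarith
  have hAnorm : ∀ x ∈ A, ‖x‖ < δ + ε := by
    intro x hx
    obtain ⟨c, hc, hxc⟩ := Metric.mem_thickening_iff.mp hx.1
    have h1 := mem_closedBall_zero_iff.mp (hCδ hc)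
    rw [dist_eq_norm] at hxc
    have h2 := norm_add_le c (x - c)
    rw [add_sub_cancel] at h2
    linarith
  let w : ℕ → Fin d → ℝ := fun k => (2 * ε * k) • orthantDiag s
  have hw : ∀ k < N, ‖w k‖ ≤ 1 / 8 := by
    intro k hk
    rw [norm_smul, Real.norm_eq_abs, abs_of_nonneg (by positivity)]
    have h1 : (k : ℝ) ≤ N := by exact_mod_cast hk.le
    have h2 : (k : ℝ) ≤ 1 / (16 * ε) := h1.trans hNle
    rw [le_div_iff₀ (by positivity)] at h2
    have h3 := norm_orthantDiag_le s
    have h4 : 0 ≤ 2 * ε * k := by positivity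
    nlinarith [mul_le_mul_of_nonneg_left h3 h4]
  have hball : ∀ k < N, ∀ x ∈ A, x + w k ∈ Metric.ball (0 : Fin d → ℝ) (1 / 2) := by
    intro k hk x hx
    rw [mem_ball_zero_iff]
    have h1 := norm_add_le x (w k)
    have h2 := hAnorm x hx
    have h3 := hw k hk
    linarith
  let S : ℕ → Set T := fun k => (fun t => (π (w k))⁻¹ * t) ⁻¹' (π '' A)
  have hS : ∀ k t, t ∈ S k ↔ ∃ x ∈ A, π (x + w k) = t := by
    intro k t
    constructor
    · rintro ⟨x, hx, hxt⟩
      refine ⟨x, hx, ?_⟩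
      rw [hadd, hxt, mul_comm, mul_inv_cancel_left]
    · rintro ⟨x, hx, rfl⟩
      refine ⟨x, hx, ?_⟩
      change _ = (π (w k))⁻¹ * π (x + w k)
      rw [hadd, mul_comm (π x), inv_mul_cancel_left]
  have hinj := injOn_ball_of_kernel hadd hker
  -- The piece is a difference of open sets inside the cube on which π is injective, so its image is
  -- a difference of open sets.
  have hmeasA : MeasurableSet (π '' A) := by
    have h1 : A = (Metric.thickening ε C) \
        ({x | ∃ v ∈ orthant s, x + v ∈ C} ∩ Metric.thickening ε C) := by
      rw [hA, collarPiece, Set.sdiff_inter_self_eq_sdiff]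
    have hsub : Metric.thickening ε C ⊆ Metric.ball 0 (1 / 2) := by
      intro x hx
      obtain ⟨c, hc, hxc⟩ := Metric.mem_thickening_iff.mp hx
      have h1 := mem_closedBall_zero_iff.mp (hCδ hc)
      rw [dist_eq_norm] at hxc
      have h2 := norm_add_le c (x - c)
      rw [add_sub_cancel] at h2
      rw [mem_ball_zero_iff]
      linarith
    rw [h1, (hinj.mono hsub).image_sdiff, Set.inter_eq_right.mpr Set.inter_subset_right]
    exact (hopen _ Metric.isOpen_thickening).measurableSet.diff
      (hopen _ ((isOpen_visible hC s).inter Metric.isOpen_thickening)).measurableSet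
  have hmeas : ∀ k, MeasurableSet (S k) := fun k =>
    hmeasA.preimage (measurable_const_mul _)
  have hμS : ∀ k, μ (S k) = μ (π '' A) := fun k => measure_preimage_mul μ _ _
  have hdisj : ∀ k < N, ∀ l < N, k < l → Disjoint (S k) (S l) := by
    intro k hk l hl hkl
    rw [Set.disjoint_left]
    intro t htk htl
    obtain ⟨x, hx, hxt⟩ := (hS k t).mp htk
    obtain ⟨y, hy, hyt⟩ := (hS l t).mp htl
    have h1 : x + w k = y + w l := hinj (hball k hk x hx) (hball l hl y hy) (hxt.trans hyt.symm)
    have h2 : x = y + (2 * ε * (l - k)) • orthantDiag s := by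
      rw [mul_sub, sub_smul, ← add_sub_assoc]
      exact eq_sub_of_add_eq h1
    refine collarPiece_add_notMem hε hy (r := 2 * ε * (l - k)) ?_ (h2 ▸ hx.1)
    have h3 : (k : ℝ) + 1 ≤ l := by exact_mod_cast hkl
    nlinarith
  have hsum : (N : ℝ≥0∞) * μ (π '' A) ≤ μ (π '' Metric.ball 0 (1 / 2)) := by
    have h1 : μ (⋃ k ∈ Finset.range N, S k) = ∑ k ∈ Finset.range N, μ (S k) := by
      refine measure_biUnion_finset ?_ fun k _ => hmeas k
      intro k hk l hl hkl
      have hk' : k < N := by simpa using hk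
      have hl' : l < N := by simpa using hl
      rcases lt_or_gt_of_ne hkl with h | h
      · exact hdisj k hk' l hl' h
      · exact (hdisj l hl' k hk' h).symm
    simp only [hμS, Finset.sum_const, Finset.card_range, nsmul_eq_mul] at h1
    rw [← h1]
    refine measure_mono ?_
    intro t ht
    simp only [Set.mem_iUnion, Finset.mem_range] at ht
    obtain ⟨k, hk, htk⟩ := ht
    obtain ⟨x, hx, hxt⟩ := (hS k t).mp htk
    exact ⟨_, hball k hk x hx, hxt⟩
  calc μ (π '' A) = 1 * μ (π '' A) := (one_mul _).symm
    _ ≤ (ENNReal.ofReal (32 * ε) * N) * μ (π '' A) := by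
        gcongr
        rw [← ENNReal.ofReal_natCast, ← ENNReal.ofReal_mul (by positivity), ← ENNReal.ofReal_one]
        exact ENNReal.ofReal_le_ofReal (by linarith)
    _ ≤ _ := by
        rw [mul_assoc]
        gcongr

theorem measure_collar_le (hadd : ∀ x y, π (x + y) = π x * π y) (hopen : IsOpenMap π)
    (hker : ∀ x, π x = 1 → ∃ z : Fin d → ℤ, x = fun j => (z j : ℝ))
    {C : Set (Fin d → ℝ)} (hC : IsOpen C) (hconv : Convex ℝ C) {δ ε : ℝ} (hδ : δ ≤ 1 / 4)
    (hCδ : C ⊆ Metric.closedBall 0 δ) (hε : 0 < ε) (hε' : ε ≤ 1 / 16) :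
    μ (π '' (Metric.thickening ε C \ C)) ≤
      ENNReal.ofReal (2 ^ d * (32 * ε)) * μ (π '' Metric.ball 0 (1 / 2)) := by
  calc μ (π '' (Metric.thickening ε C \ C)) ≤ μ (⋃ s : Fin d → Bool, π '' collarPiece C ε s) := by
        rw [← Set.image_iUnion]
        exact measure_mono (Set.image_mono (collar_subset_iUnion hC hconv ε))
    _ ≤ ∑ s : Fin d → Bool, μ (π '' collarPiece C ε s) := measure_iUnion_fintype_le _ _
    _ ≤ ∑ _s : Fin d → Bool, ENNReal.ofReal (32 * ε) * μ (π '' Metric.ball 0 (1 / 2)) :=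
        Finset.sum_le_sum fun s _ =>
          measure_collarPiece_le μ hadd hopen hker hC hδ hCδ hε hε' s
    _ = _ := by
        rw [Finset.sum_const, Finset.card_univ, Fintype.card_fun, Fintype.card_bool,
          Fintype.card_fin, nsmul_eq_mul, ENNReal.ofReal_mul (p := 2 ^ d) (by positivity), mul_assoc]
        congr 1
        rw [ENNReal.ofReal_pow (by norm_num)]
        simp

end Collar

end IdeleTorus

namespace IdeleTorus

/-! ### Approximation of small convex subsets of a compact group -/

theorem isOpenMap_codRestrict {X Y : Type*} [TopologicalSpace X] [TopologicalSpace Y] {f : X → Y}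
    (hf : IsOpenMap f) (s : Set Y) (hs : ∀ x, f x ∈ s) : IsOpenMap (Set.codRestrict f s hs) := by
  intro U hU
  refine ⟨f '' U, hf U hU, ?_⟩
  ext ⟨y, hy⟩
  constructor
  · rintro ⟨x, hx, hxy⟩
    exact ⟨x, hx, Subtype.ext hxy⟩
  · rintro ⟨x, hx, hxy⟩
    exact ⟨x, hx, congrArg Subtype.val hxy⟩

section Core

variable {T : Type*} [CommGroup T] [TopologicalSpace T] [IsTopologicalGroup T]
  {d : ℕ} {π : (Fin d → ℝ) → T}

theorem isOpen_connectedComponentOfOne (hopen : IsOpenMap π)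
    (hrange : ∀ t, t ∈ Subgroup.connectedComponentOfOne T ↔ ∃ x, π x = t) :
    IsOpen (Subgroup.connectedComponentOfOne T : Set T) := by
  have : (Subgroup.connectedComponentOfOne T : Set T) = Set.range π := by
    ext t
    exact hrange t
  rw [this]
  exact hopen.isOpen_range

/-- B translates the coordinates of π into those of e; being linear and invertible it preserves open
convex sets, and it enlarges their size by a factor at most `Cb`. -/
theorem isSmallConvex_image (hπ : Continuous π) (hadd : ∀ x y, π (x + y) = π x * π y)
    (hrange : ∀ t, t ∈ Subgroup.connectedComponentOfOne T ↔ ∃ x, π x = t)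
    (e : Subgroup.connectedComponentOfOne T ≃ₜ* (Fin d → Circle))
    (B : (Fin d → ℝ) ≃L[ℝ] (Fin d → ℝ)) {Cb : ℝ} (hCb : 0 ≤ Cb)
    (hB : ∀ x, ‖B x‖ ≤ Cb * ‖x‖)
    (he : ∀ x, e ⟨π x, (hrange _).mpr ⟨x, rfl⟩⟩ = torusProj (B x))
    {C : Set (Fin d → ℝ)} (hC : IsOpen C) (hconv : Convex ℝ C) (h0 : 0 ∈ C) {η δ : ℝ}
    (hCη : C ⊆ Metric.closedBall 0 η) (hη : Cb * η ≤ δ) (p : T) :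
    IsSmallConvex e δ {t | p⁻¹ * t ∈ π '' C} := by
  refine ⟨?_, p, ⟨0, h0, by rw [map_zero_of_add hadd, inv_mul_cancel]⟩, B '' C,
    B.toHomeomorph.isOpenMap _ hC, hconv.linear_image B.toLinearEquiv.toLinearMap, ?_, ?_⟩
  · have h1 : {t | p⁻¹ * t ∈ π '' C} = (fun x => p * π x) '' C := by
      ext t
      constructor
      · rintro ⟨x, hx, hxt⟩
        exact ⟨x, hx, by change p * π x = t; rw [hxt]; group⟩
      · rintro ⟨x, hx, rfl⟩
        exact ⟨x, hx, by group⟩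
    rw [h1]
    exact (hconv.isConnected ⟨0, h0⟩).image _ (by fun_prop)
  · rintro _ ⟨x, hx, rfl⟩
    have h1 := mem_closedBall_zero_iff.mp (hCη hx)
    have h2 : ‖B x‖ ≤ δ :=
      (hB x).trans ((mul_le_mul_of_nonneg_left h1 hCb).trans hη)
    refine ⟨fun j => ?_, fun j => ?_⟩
    · have := (norm_le_pi_norm (B x) j).trans h2
      rw [Real.norm_eq_abs, abs_le] at this
      exact this.1
    · have := (norm_le_pi_norm (B x) j).trans h2
      rw [Real.norm_eq_abs, abs_le] at this
      exact this.2
  · ext t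
    simp only [Set.mem_ofPred_eq, inv_mul_cancel_left, Set.image_image]
    refine exists_congr fun x => and_congr_right fun _ => ?_
    change π x = t ↔ ((e.symm (torusProj (B x)) : _) : T) = t
    rw [← he, e.symm_apply_apply]

variable [CompactSpace T] [MeasurableSpace T] [BorelSpace T]

/-- The function f agrees with 1_P on P and off P', and has modulus at most 1 on P' \ P. -/
theorem norm_integral_sub_le (μ : Measure T) [IsFiniteMeasure μ] (f : C(T, ℂ)) {P P' : Set T}
    (hP : IsOpen P) (hP' : IsOpen P') (hf1 : ∀ t ∈ P, f t = 1) (hf0 : ∀ t, t ∉ P' → f t = 0)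
    (hf : ∀ t, ‖f t‖ ≤ 1) (ψ : PontryaginDual T) {p : T} (hψ : ∀ t ∈ P, ψ t = ψ p) :
    ‖integralMul μ f (charFun ψ⁻¹) - (μ.real P : ℂ) * (starRingEnd ℂ) ((ψ p : Circle) : ℂ)‖ ≤
      μ.real (P' \ P) := by
  have h1 : (μ.real P : ℂ) * (starRingEnd ℂ) ((ψ p : Circle) : ℂ) =
      ∫ t, P.indicator (fun _ => (starRingEnd ℂ) ((ψ p : Circle) : ℂ)) t ∂μ := by
    rw [integral_indicator_const _ hP.measurableSet]
    simp
  have hind : Integrable (P.indicator (fun _ => (starRingEnd ℂ) ((ψ p : Circle) : ℂ))) μ :=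
    (integrable_const _).indicator hP.measurableSet
  have hnorm : ∀ t, ‖charFun ψ⁻¹ t‖ = 1 := fun t => Circle.norm_coe _
  have hint : Integrable (fun t => f t * charFun ψ⁻¹ t) μ :=
    integrable_continuousMap μ (f * charFun ψ⁻¹)
  rw [h1, integralMul_apply, ← integral_sub hint hind]
  have h2 : μ.real (P' \ P) = ∫ t, (P' \ P).indicator (fun _ => (1 : ℝ)) t ∂μ := by
    rw [integral_indicator_const _ (hP'.measurableSet.diff hP.measurableSet)]
    simp
  rw [h2]
  refine norm_integral_le_of_norm_le ((integrable_const _).indicator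
    (hP'.measurableSet.diff hP.measurableSet)) (Filter.Eventually.of_forall fun t => ?_)
  by_cases ht : t ∈ P
  · rw [Set.indicator_of_mem ht, hf1 t ht, Set.indicator_of_notMem (fun h => h.2 ht), one_mul,
      charFun_inv]
    have : star (charFun ψ) t = (starRingEnd ℂ) ((ψ p : Circle) : ℂ) := by
      rw [← hψ t ht]
      rfl
    rw [this, sub_self, norm_zero]
  · rw [Set.indicator_of_notMem ht, sub_zero, norm_mul, hnorm, mul_one]
    by_cases ht' : t ∈ P'
    · have hmem : t ∈ P' \ P := ⟨ht', ht⟩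
      rw [Set.indicator_of_mem hmem]
      exact hf t
    · rw [hf0 t ht', norm_zero]
      exact Set.indicator_nonneg (fun _ _ => zero_le_one) _

end Core

/-- The approximation of the characteristic function of a small convex subset of a compact abelian
group by characters. -/
theorem exists_approximation (d : ℕ) : ∃ c₀ Cd : ℝ, 0 < c₀ ∧ 0 < Cd ∧
    ∀ {T : Type*} [CommGroup T] [TopologicalSpace T] [IsTopologicalGroup T] [CompactSpace T]
      [MeasurableSpace T] [BorelSpace T] (μ : Measure T) [IsFiniteMeasure μ]
      [μ.IsMulLeftInvariant] (π : (Fin d → ℝ) → T),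
      μ Set.univ ≠ 0 → (Subgroup.connectedComponentOfOne T).FiniteIndex →
      Continuous π → IsOpenMap π → (∀ x y, π (x + y) = π x * π y) →
      (∀ t, t ∈ Subgroup.connectedComponentOfOne T ↔ ∃ x, π x = t) →
      (∀ x, π x = 1 → ∃ z : Fin d → ℤ, x = fun j => (z j : ℝ)) →
      (∃ N : ℤ, N ≠ 0 ∧ ∀ z : Fin d → ℤ, π (fun j => ((N * z j : ℤ) : ℝ)) = 1) →
      ∀ (V W : ℝ), 1 ≤ V → μ (π '' Metric.ball 0 (1 / 2)) ≤ ENNReal.ofReal V →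
      (∀ L : ℝ, 1 ≤ L → ∃ Ξ : Finset (PontryaginDual T), (Ξ.card : ℝ) ≤ W * L ^ d ∧
        ∀ (ψ : PontryaginDual T) (ξ : Fin d → ℝ),
          (∀ x, ψ (π x) = Circle.exp (2 * Real.pi * ∑ j, x j * ξ j)) →
          (∀ j, |ξ j| ≤ L) → ψ ∈ Ξ) →
      ∀ (M Y δ : ℝ), 1 < M → 2 ≤ Y → δ < 1 / 4 → δ ≤ c₀ →
      ∀ (C : Set (Fin d → ℝ)), IsOpen C → Convex ℝ C → 0 ∈ C → C ⊆ Metric.closedBall 0 δ →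
      ∀ p : T,
      ∃ (Ξ : Finset (PontryaginDual T)) (c : PontryaginDual T → ℂ) (G H : T → ℂ),
        (∀ x, {t | p⁻¹ * t ∈ π '' C}.indicator (fun _ => (1 : ℂ)) x =
          ∑ ψ ∈ Ξ, c ψ * ((ψ x : Circle) : ℂ) + G x + H x) ∧
        (∀ ψ, ψ ∉ Ξ → c ψ = 0) ∧
        (Ξ.card : ℝ) ≤ W * (Y * V) ^ d ∧
        (∀ ψ, ‖c ψ‖ ≤ 1) ∧
        (∀ x, ‖G x‖ ≤ 1) ∧
        (∃ P' : Set T,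
          (∃ e' : Subgroup.connectedComponentOfOne T ≃ₜ* (Fin d → Circle),
            IsSmallConvex e' (1 / 4) P') ∧
          {t | p⁻¹ * t ∈ π '' C} ⊆ P' ∧ tsupport G ⊆ P' \ {t | p⁻¹ * t ∈ π '' C} ∧
          μ (P' \ {t | p⁻¹ * t ∈ π '' C}) ≤ ENNReal.ofReal (Cd / M)) ∧
        (∀ x, ‖H x‖ ≤ Cd * (M * (Real.log Y / Y))) ∧
        (∀ ψ : PontryaginDual T,
          (∀ t ∈ Subgroup.connectedComponentOfOne T, ψ t = 1) →
          ∀ t ∈ {t | p⁻¹ * t ∈ π '' C},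
            ‖c ψ - ((μ.real {t | p⁻¹ * t ∈ π '' C} / μ.real Set.univ : ℝ) : ℂ) *
                (starRingEnd ℂ) ((ψ t : Circle) : ℂ)‖ ≤ Cd / M) := by
  obtain ⟨Cb, hCb, htorus⟩ := exists_torus_equiv d
  obtain ⟨g, b, hg, hg1, hb0, hb1, hb, hbs, hgb⟩ := exists_bandlimited_kernel d
  set A : ℝ := ∫ x, ‖x‖ * ‖g x‖ with hA
  have hA0 : 0 ≤ A := integral_nonneg fun x => by positivity
  -- The bound 1/16 is required by the packing of the collar; 1/(8 Cb), together with δ ≤ 1/(8 Cb),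
  -- makes Cb (δ + ε) ≤ 1/4, the admissible size of P'.
  set ε₀ : ℝ := min (1 / 16) (1 / (8 * Cb)) with hε₀
  have hε₀pos : 0 < ε₀ := by positivity
  have hlog2 : 0 < Real.log 2 := Real.log_pos one_lt_two
  -- The first term comes from the volume of the collar, the second from the smoothing error
  -- (2A/ε₀)(M/Y), where log Y ≥ log 2 pays for the factor log Y of the statement.
  set Cd : ℝ := 2 ^ d * (32 * ε₀) + 2 * A / (ε₀ * Real.log 2) with hCd
  have hCd1 : 2 ^ d * (32 * ε₀) ≤ Cd := by
    have : 0 ≤ 2 * A / (ε₀ * Real.log 2) := by positivity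
    linarith
  have hCd2 : 2 * A / (ε₀ * Real.log 2) ≤ Cd := by
    have : 0 ≤ 2 ^ d * (32 * ε₀) := by positivity
    linarith
  refine ⟨1 / (8 * Cb), Cd, by positivity, lt_of_lt_of_le (by positivity) hCd1, ?_⟩
  intro T _ _ _ _ _ _ μ _ _ π hμ hfin hπ hopen hadd hrange hker htors V W hV hμV hcount M Y δ
    hM hY hδ hδ' C hC hconv h0 hCδ p
  set S := Subgroup.connectedComponentOfOne T with hS
  have hSopen : IsOpen (S : Set T) := isOpen_connectedComponentOfOne hopen hrange
  have hmemS : ∀ x, π x ∈ (S : Set T) := fun x => (hrange _).mpr ⟨x, rfl⟩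
  obtain ⟨e', B, heB, hB⟩ := htorus (G := S) (Set.codRestrict π S hmemS)
    (hπ.codRestrict hmemS) (isOpenMap_codRestrict hopen _ hmemS)
    (fun ⟨t, ht⟩ => by
      obtain ⟨x, hx⟩ := (hrange t).mp ht
      exact ⟨x, Subtype.ext hx⟩)
    (fun x y => Subtype.ext (hadd x y))
    (fun x hx => hker x (congrArg Subtype.val hx))
    (by
      obtain ⟨N, hN, hz⟩ := htors
      exact ⟨N, hN, fun z => Subtype.ext (hz z)⟩)
  have hsep : ∀ t : T, t ≠ 1 → ∃ ψ : PontryaginDual T, ψ t ≠ 1 := fun t ht =>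
    exists_dual_ne_one hSopen e' ht
  have : μ.IsOpenPosMeasure :=
    isOpenPosMeasure_of_mulLeftInvariant_of_compact Set.univ isCompact_univ hμ
  have hMpos : 0 < M := by linarith
  have hVpos : 0 < V := by linarith
  have hYpos : 0 < Y := by linarith
  -- The collar has volume of order εV, which this width makes of order 1/M.
  set ε : ℝ := ε₀ / (M * V) with hε
  have hεpos : 0 < ε := by positivity
  have hMV : 1 ≤ M * V := by nlinarith
  have hεε₀ : ε ≤ ε₀ := div_le_self hε₀pos.le hMV
  have hε16 : ε ≤ 1 / 16 := hεε₀.trans (min_le_left _ _)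
  have hε8 : ε ≤ 1 / (8 * Cb) := hεε₀.trans (min_le_right _ _)
  set P : Set T := {t | p⁻¹ * t ∈ π '' C} with hP
  set P' : Set T := {t | p⁻¹ * t ∈ π '' Metric.thickening ε C} with hP'
  have hPopen : IsOpen P := (hopen _ hC).preimage (by fun_prop)
  have hP'open : IsOpen P' := (hopen _ Metric.isOpen_thickening).preimage (by fun_prop)
  have hPP' : P ⊆ P' := by
    rintro t ⟨x, hx, hxt⟩
    exact ⟨x, Metric.self_subset_thickening hεpos C hx, hxt⟩
  have hdiff : P' \ P ⊆ (fun t => p⁻¹ * t) ⁻¹' (π '' (Metric.thickening ε C \ C)) := by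
    rintro t ⟨⟨x, hx, hxt⟩, ht⟩
    exact ⟨x, ⟨hx, fun hxC => ht ⟨x, hxC, hxt⟩⟩, hxt⟩
  have hvol : μ (P' \ P) ≤
      ENNReal.ofReal (2 ^ d * (32 * ε)) * μ (π '' Metric.ball 0 (1 / 2)) := by
    refine (measure_mono hdiff).trans ?_
    rw [measure_preimage_mul]
    exact measure_collar_le μ hadd hopen hker hC hconv hδ.le hCδ hεpos hε16
  have hvolM : μ (P' \ P) ≤ ENNReal.ofReal (Cd / M) := by
    refine hvol.trans ((mul_le_mul_right hμV _).trans ?_)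
    rw [← ENNReal.ofReal_mul (by positivity)]
    refine ENNReal.ofReal_le_ofReal ?_
    have : 2 ^ d * (32 * ε) * V = 2 ^ d * (32 * ε₀) / M := by
      rw [hε]
      field_simp
    rw [this]
    gcongr
  -- Half the width, so that the closure of the support still lies in the open set P'.
  have hplat : Continuous (plateau π (ε / 2) P) := continuous_plateau (by positivity) hadd hopen
  let f : C(T, ℂ) := ⟨fun t => (plateau π (ε / 2) P t : ℂ), by fun_prop⟩
  have hfapp : ∀ t, f t = (plateau π (ε / 2) P t : ℂ) := fun t => rfl
  have hε2 : 0 < ε / 2 := by positivity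
  have hf1 : ∀ t ∈ P, f t = 1 := by
    intro t ht
    rw [hfapp, plateau_eq_one hε2 hadd ht]
    simp
  have hfnorm : ∀ t, ‖f t‖ ≤ 1 := by
    intro t
    rw [hfapp, Complex.norm_real, Real.norm_eq_abs, abs_of_nonneg (plateau_nonneg t)]
    exact plateau_le_one hε2 t
  have hclos : closure {t | f t ≠ 0} ⊆ P' := by
    intro t ht
    have hU : IsOpen {s | ∃ y : Fin d → ℝ, ‖y‖ < ε / 2 ∧ t * π y = s} := by
      have : {s | ∃ y : Fin d → ℝ, ‖y‖ < ε / 2 ∧ t * π y = s} =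
          (fun s => t⁻¹ * s) ⁻¹' (π '' Metric.ball 0 (ε / 2)) := by
        ext s
        constructor
        · rintro ⟨y, hy, rfl⟩
          exact ⟨y, mem_ball_zero_iff.mpr hy, by group⟩
        · rintro ⟨y, hy, hys⟩
          exact ⟨y, mem_ball_zero_iff.mp hy, by rw [hys]; group⟩
      rw [this]
      exact (hopen _ Metric.isOpen_ball).preimage (by fun_prop)
    obtain ⟨s, ⟨y, hy, rfl⟩, hs⟩ := mem_closure_iff.mp ht _ hU
      ⟨0, by simpa using hε2, by rw [map_zero_of_add hadd, mul_one]⟩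
    have hs' : plateau π (ε / 2) P (t * π y) ≠ 0 := by
      intro h
      apply hs
      rw [hfapp, h]
      simp
    obtain ⟨y', hy', x, hx, hxt⟩ := exists_of_plateau_ne_zero hε2 hs'
    refine ⟨x - (y + y'), Metric.mem_thickening_iff.mpr ⟨x, hx, ?_⟩, ?_⟩
    · rw [dist_eq_norm, sub_sub_cancel_left, norm_neg]
      have := norm_add_le y y'
      linarith
    · rw [map_sub_of_add hadd, hxt, hadd]
      group
  have hf0 : ∀ t, t ∉ P' → f t = 0 := by
    intro t ht
    by_contra hne
    exact ht (hclos (subset_closure hne))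
  have hLip : ∀ t x, ‖f (t * π x) - f t‖ ≤ 2 / ε * ‖x‖ := by
    intro t x
    rw [hfapp, hfapp, ← Complex.ofReal_sub, Complex.norm_real, Real.norm_eq_abs]
    refine (abs_plateau_sub_le hε2 hadd t x).trans_eq ?_
    rw [one_div_div]
  -- The smoothing error is (2/ε)A/L; the factor V in L cancels the one in 1/ε.
  set L : ℝ := Y * V with hL
  have hLpos : 0 < L := by positivity
  obtain ⟨Ξ, hΞcard, hΞ⟩ := hcount L (by nlinarith)
  choose ξ hξ using fun ψ : PontryaginDual T => exists_frequency hπ hadd ψ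
  obtain ⟨c, hc0, hc1, hcξ, happ⟩ := exists_trigPolynomial_approx hg hg1 hb0 hb1 hb hbs hgb μ hsep
    hπ f hLip hLpos ξ hξ Ξ (fun ψ hψ => hΞ ψ (ξ ψ) (hξ ψ) hψ)
  have hμpos : 0 < μ.real Set.univ := ENNReal.toReal_pos hμ (measure_ne_top μ _)
  refine ⟨Ξ, c, fun t => P.indicator (fun _ => (1 : ℂ)) t - f t,
    fun t => f t - ∑ ψ ∈ Ξ, c ψ * ((ψ t : Circle) : ℂ), fun x => by ring, hc0, hΞcard, ?_, ?_,
    ⟨P', ⟨e', ?_⟩, hPP', ?_, hvolM⟩, ?_, ?_⟩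
  · intro ψ
    refine (hc1 ψ).trans ?_
    rw [div_le_one hμpos, integralMul_apply]
    refine (norm_integral_le_of_norm_le_const (C := 1)
      (Filter.Eventually.of_forall fun t => ?_)).trans_eq (one_mul _)
    rw [norm_mul, charFun_apply, Circle.norm_coe, mul_one]
    exact hfnorm t
  · intro t
    change ‖P.indicator (fun _ => (1 : ℂ)) t - f t‖ ≤ 1
    by_cases ht : t ∈ P
    · rw [Set.indicator_of_mem ht, hf1 t ht]
      simp
    · rw [Set.indicator_of_notMem ht, zero_sub, norm_neg]
      exact hfnorm t
  · refine isSmallConvex_image hπ hadd hrange e' B hCb.le hB heB Metric.isOpen_thickening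
      (hconv.thickening ε) (Metric.self_subset_thickening hεpos C h0) (η := δ + ε) ?_ ?_ p
    · intro x hx
      obtain ⟨c, hc, hxc⟩ := Metric.mem_thickening_iff.mp hx
      have h1 := mem_closedBall_zero_iff.mp (hCδ hc)
      rw [dist_eq_norm] at hxc
      have h2 := norm_add_le c (x - c)
      rw [add_sub_cancel] at h2
      rw [mem_closedBall_zero_iff]
      linarith
    · have h1 : Cb * (1 / (8 * Cb)) = 1 / 8 := by field_simp
      nlinarith
  · have hsub : Function.support (fun t => P.indicator (fun _ => (1 : ℂ)) t - f t) ⊆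
        {t | f t ≠ 0} ∩ Pᶜ := by
      intro t ht
      by_cases htP : t ∈ P
      · exfalso
        apply ht
        simp [htP, hf1 t htP]
      · refine ⟨fun h => ht ?_, htP⟩
        simp [htP, h]
    -- G vanishes where f does and on the open set P, so its closed support lies in P' and still
    -- avoids P.
    intro t ht
    have h1 := closure_mono hsub ht
    exact ⟨hclos (closure_mono Set.inter_subset_left h1),
      hPopen.isClosed_compl.closure_subset (closure_mono Set.inter_subset_right h1)⟩
  · intro t
    refine (happ t).trans ?_
    have h1 : 2 / ε / L * A = 2 * A / ε₀ * (M / Y) := by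
      rw [hε, hL]
      field_simp
    rw [h1]
    have h2 : Real.log 2 ≤ Real.log Y := Real.log_le_log (by norm_num) hY
    calc 2 * A / ε₀ * (M / Y) = 2 * A / (ε₀ * Real.log 2) * (M * (Real.log 2 / Y)) := by
          field_simp
      _ ≤ Cd * (M * (Real.log Y / Y)) := by gcongr
  · intro ψ hψ t ht
    -- At frequency 0 the multiplier is 1, so the coefficient is the undamped Fourier coefficient of
    -- f.
    have hξ0 : ξ ψ = 0 := frequency_eq_zero fun x => by rw [← hξ, hψ _ (hmemS x)]
    rw [hcξ ψ hξ0]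
    have hconst : ∀ s ∈ P, ψ s = ψ t := by
      have h1 : ∀ s ∈ P, ψ s = ψ p := by
        rintro s ⟨x, hx, hxs⟩
        have h2 : s = p * π x := by rw [hxs]; group
        rw [h2, map_mul, hψ _ (hmemS x), mul_one]
      intro s hs
      rw [h1 s hs, h1 t ht]
    have h1 := norm_integral_sub_le μ f hPopen hP'open hf1 hf0 hfnorm ψ hconst
    have h2 : integralMul μ f (charFun ψ⁻¹) / (μ.real Set.univ : ℂ) -
        ((μ.real P / μ.real Set.univ : ℝ) : ℂ) * (starRingEnd ℂ) ((ψ t : Circle) : ℂ) =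
        (integralMul μ f (charFun ψ⁻¹) - (μ.real P : ℂ) * (starRingEnd ℂ) ((ψ t : Circle) : ℂ)) /
          (μ.real Set.univ : ℂ) := by
      push_cast
      ring
    rw [h2, norm_div, Complex.norm_real, Real.norm_eq_abs, abs_of_pos hμpos, div_le_iff₀ hμpos]
    refine h1.trans ?_
    -- The cube is now bounded by the whole group instead of by V, which gives the relative volume
    -- of the collar.
    have h3 : μ.real (P' \ P) ≤ 2 ^ d * (32 * ε) * μ.real Set.univ := by
      have h4 : μ (P' \ P) ≤ ENNReal.ofReal (2 ^ d * (32 * ε)) * μ Set.univ :=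
        hvol.trans (mul_le_mul_right (measure_mono (Set.subset_univ _)) _)
      have h5 := ENNReal.toReal_mono (ENNReal.mul_ne_top ENNReal.ofReal_ne_top
        (measure_ne_top μ _)) h4
      rwa [ENNReal.toReal_mul, ENNReal.toReal_ofReal (by positivity)] at h5
    refine h3.trans (mul_le_mul_of_nonneg_right ?_ hμpos.le)
    calc 2 ^ d * (32 * ε) ≤ 2 ^ d * (32 * (ε₀ / M)) := by
          gcongr
          rw [hε]
          gcongr
          nlinarith
      _ = 2 ^ d * (32 * ε₀) / M := by ring
      _ ≤ Cd / M := by gcongr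

end IdeleTorus

namespace IdeleTorus

universe u

/-! ### The exponential map of the archimedean part -/

/-- The image of p is connected, and it is an open subgroup, hence clopen. -/
theorem mem_connectedComponentOfOne_iff {V G : Type*} [AddCommGroup V] [TopologicalSpace V]
    [ConnectedSpace V] [CommGroup G] [TopologicalSpace G] [IsTopologicalGroup G] {p : V → G}
    (hp : Continuous p) (hopen : IsOpenMap p) (hadd : ∀ x y, p (x + y) = p x * p y) (t : G) :
    t ∈ Subgroup.connectedComponentOfOne G ↔ ∃ x, p x = t := by
  have h0 : p 0 = 1 := by
    have := hadd 0 0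
    rw [add_zero] at this
    exact left_eq_mul.mp this
  let S : Subgroup G :=
    { carrier := Set.range p
      mul_mem' := by
        rintro _ _ ⟨x, rfl⟩ ⟨y, rfl⟩
        exact ⟨x + y, hadd x y⟩
      one_mem' := ⟨0, h0⟩
      inv_mem' := by
        rintro _ ⟨x, rfl⟩
        refine ⟨-x, ?_⟩
        rw [eq_inv_iff_mul_eq_one, ← hadd, neg_add_cancel, h0] }
  have hSo : IsOpen (S : Set G) := hopen.isOpen_range
  have hclopen : IsClopen (S : Set G) := ⟨Subgroup.isClosed_of_isOpen _ hSo, hSo⟩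
  constructor
  · intro ht
    exact hclopen.connectedComponent_subset S.one_mem ht
  · rintro ⟨x, rfl⟩
    exact (isPreconnected_range hp).subset_connectedComponent ⟨0, h0⟩ ⟨x, rfl⟩

variable (K : Type u) [Field K] [NumberField K]

/-- The componentwise exponential map `K ⊗_ℚ ℝ → (K ⊗_ℚ ℝ)ˣ`. -/
def archExp (w : mixedEmbedding.mixedSpace K) : ArchUnits K :=
  MulEquiv.prodUnits.symm
    (MulEquiv.piUnits.symm fun v => Units.mk0 (Real.exp (w.1 v)) (Real.exp_ne_zero _),
      MulEquiv.piUnits.symm fun v => Units.mk0 (Complex.exp (w.2 v)) (Complex.exp_ne_zero _))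

variable {K}

theorem archExp_fst (w : mixedEmbedding.mixedSpace K) (v : {v : InfinitePlace K // v.IsReal}) :
    (archExp K w : mixedEmbedding.mixedSpace K).1 v = Real.exp (w.1 v) := rfl

theorem archExp_snd (w : mixedEmbedding.mixedSpace K) (v : {v : InfinitePlace K // v.IsComplex}) :
    (archExp K w : mixedEmbedding.mixedSpace K).2 v = Complex.exp (w.2 v) := rfl

theorem archExp_add (x y : mixedEmbedding.mixedSpace K) :
    archExp K (x + y) = archExp K x * archExp K y := by
  ext v
  · change Real.exp (x.1 v + y.1 v) = Real.exp (x.1 v) * Real.exp (y.1 v)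
    exact Real.exp_add _ _
  · change Complex.exp (x.2 v + y.2 v) = Complex.exp (x.2 v) * Complex.exp (y.2 v)
    exact Complex.exp_add _ _

theorem coe_archExp_eq : (fun w => (archExp K w : mixedEmbedding.mixedSpace K)) =
    Prod.map (fun x v => Real.exp (x v)) (fun z v => Complex.exp (z v)) := rfl

open scoped Classical in
theorem isOpenEmbedding_coe_archUnits :
    Topology.IsOpenEmbedding ((↑) : ArchUnits K → mixedEmbedding.mixedSpace K) :=
  Units.isOpenEmbedding_val (R := mixedEmbedding.mixedSpace K)

theorem continuous_archExp : Continuous (archExp K) := by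
  rw [isOpenEmbedding_coe_archUnits.isInducing.continuous_iff]
  change Continuous (fun w => (archExp K w : mixedEmbedding.mixedSpace K))
  rw [coe_archExp_eq]
  fun_prop

theorem isOpenMap_archExp : IsOpenMap (archExp K) := by
  refine isOpenEmbedding_coe_archUnits.isOpenMap_iff.mpr ?_
  change IsOpenMap (fun w => (archExp K w : mixedEmbedding.mixedSpace K))
  rw [coe_archExp_eq]
  refine IsOpenMap.prodMap
    (IsOpenMap.piMap (f := fun (_ : {v : InfinitePlace K // v.IsReal}) (x : ℝ) => Real.exp x)
      (fun _ => ?_) (by simp [Filter.cofinite_eq_bot]))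
    (IsOpenMap.piMap (f := fun (_ : {v : InfinitePlace K // v.IsComplex}) (z : ℂ) =>
      Complex.exp z) (fun _ => ?_) (by simp [Filter.cofinite_eq_bot]))
  · exact Real.isOpenEmbedding_exp.isOpenMap
  · exact Complex.isOpenMap_exp

/-- The exponential map to the base torus. -/
def baseExp (w : mixedEmbedding.mixedSpace K) : BaseTorus K := toBase K (archExp K w)

theorem continuous_baseExp : Continuous (baseExp (K := K)) :=
  (QuotientGroup.continuous_mk (N := unitsPos K)).comp continuous_archExp

theorem isOpenMap_baseExp : IsOpenMap (baseExp (K := K)) :=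
  (QuotientGroup.isOpenMap_coe (N := unitsPos K)).comp isOpenMap_archExp

theorem baseExp_add (x y : mixedEmbedding.mixedSpace K) :
    baseExp (x + y) = baseExp x * baseExp y := by
  rw [baseExp, archExp_add, map_mul]
  rfl

theorem mem_connectedComponent_base_iff (t : BaseTorus K) :
    t ∈ Subgroup.connectedComponentOfOne (BaseTorus K) ↔ ∃ w, baseExp w = t :=
  mem_connectedComponentOfOne_iff continuous_baseExp isOpenMap_baseExp baseExp_add t

theorem archExp_smul_one (r : ℝ) : ∃ p : Units.posSubgroup ℝ,
    archExp K (r • (1 : mixedEmbedding.mixedSpace K)) = posReal K p := by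
  refine ⟨⟨Units.mk0 (Real.exp r) (Real.exp_ne_zero r), Real.exp_pos r⟩, ?_⟩
  ext v
  · change Real.exp (r * 1) = Real.exp r
    rw [mul_one]
  · change Complex.exp (r • (1 : ℂ)) = ((Real.exp r : ℝ) : ℂ)
    simp

theorem toBase_posReal (p : Units.posSubgroup ℝ) : toBase K (posReal K p) = 1 :=
  (QuotientGroup.eq_one_iff (N := unitsPos K) _).mpr (Subgroup.mem_sup_right ⟨p, rfl⟩)

theorem eq_zero_of_torusProj_smul {d : ℕ} {v : Fin d → ℝ}
    (h : ∀ r : ℝ, torusProj (r • v) = 1) : v = 0 := by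
  by_contra hne
  obtain ⟨j, hj⟩ : ∃ j, v j ≠ 0 := by
    by_contra! hcon
    exact hne (funext hcon)
  obtain ⟨z, hz⟩ := torusProj_eq_one_iff.mp (h (1 / (2 * v j)))
  have h1 := congrFun hz j
  simp only [Pi.smul_apply, smul_eq_mul] at h1
  have h2 : (1 : ℝ) = 2 * z j := by
    rw [← h1]
    field_simp
  have h3 : (1 : ℤ) = 2 * z j := by exact_mod_cast h2
  omega

/-- Otherwise the quotient by the range would be a nonzero real vector space consisting of the
countably many classes of integral vectors. -/
theorem linearMap_surjective_of_add_int {V : Type*} [AddCommGroup V] [Module ℝ V] {d : ℕ}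
    (l : V →ₗ[ℝ] (Fin d → ℝ))
    (h : ∀ x, ∃ w, ∃ z : Fin d → ℤ, x = l w + fun j => (z j : ℝ)) : Function.Surjective l := by
  rw [← LinearMap.range_eq_top]
  by_contra hne
  obtain ⟨v, hv⟩ : ∃ v, v ∉ LinearMap.range l := by
    by_contra! hcon
    exact hne (eq_top_iff.mpr fun v _ => hcon v)
  have hc : Countable ((Fin d → ℝ) ⧸ LinearMap.range l) := by
    refine Function.Surjective.countable
      (f := fun z : Fin d → ℤ => (Submodule.Quotient.mk (fun j => (z j : ℝ)) :
        (Fin d → ℝ) ⧸ LinearMap.range l)) ?_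
    intro x
    obtain ⟨x, rfl⟩ := Submodule.Quotient.mk_surjective _ x
    obtain ⟨w, z, rfl⟩ := h x
    refine ⟨z, ?_⟩
    rw [Submodule.Quotient.eq]
    exact ⟨-w, by rw [map_neg]; abel⟩
  have hinj : Function.Injective (fun r : ℝ => (Submodule.Quotient.mk (r • v) :
      (Fin d → ℝ) ⧸ LinearMap.range l)) := by
    intro r r' hr
    simp only [Submodule.Quotient.eq, ← sub_smul] at hr
    by_contra hrr
    have hne0 : r - r' ≠ 0 := sub_ne_zero.mpr hrr
    refine hv ?_
    have := (LinearMap.range l).smul_mem (r - r')⁻¹ hr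
    rwa [smul_smul, inv_mul_cancel₀ hne0, one_smul] at this
  have := hinj.countable
  exact not_countable (α := ℝ) this

open scoped Classical in
/-- Linear coordinates on `K ⊗_ℚ ℝ` modulo `ℝ` that are compatible with a trivialization of the
neutral component of the base torus. -/
theorem exists_linear_coordinates {n : ℕ} (hn : Module.finrank ℚ K = n)
    (e : Subgroup.connectedComponentOfOne (BaseTorus K) ≃ₜ* (Fin (n - 1) → Circle)) :
    ∃ (l : mixedEmbedding.mixedSpace K →L[ℝ] (Fin (n - 1) → ℝ))
      (s : (Fin (n - 1) → ℝ) →L[ℝ] mixedEmbedding.mixedSpace K),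
      (∀ x, l (s x) = x) ∧
      (∀ w, l w = 0 ↔ ∃ r : ℝ, w = r • (1 : mixedEmbedding.mixedSpace K)) ∧
      ∀ w, torusProj (l w) =
        e ⟨baseExp w, (mem_connectedComponent_base_iff _).mpr ⟨w, rfl⟩⟩ := by
  have hmem : ∀ w : mixedEmbedding.mixedSpace K,
      baseExp w ∈ (Subgroup.connectedComponentOfOne (BaseTorus K) : Set (BaseTorus K)) :=
    fun w => (mem_connectedComponent_base_iff _).mpr ⟨w, rfl⟩
  obtain ⟨l, hl⟩ := exists_continuousLinearMap_lift_torus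
    (fun w => e (Set.codRestrict baseExp _ hmem w))
    (e.continuous.comp (continuous_baseExp.codRestrict hmem))
    (fun x y => by
      rw [← map_mul]
      congr 1
      exact Subtype.ext (baseExp_add x y))
  have hsurj : Function.Surjective l := by
    refine linearMap_surjective_of_add_int l.toLinearMap fun x => ?_
    obtain ⟨w, hw⟩ := (mem_connectedComponent_base_iff _).mp (e.symm (torusProj x)).2
    have h1 : torusProj (l w) = torusProj x := by
      have : Set.codRestrict baseExp _ hmem w = e.symm (torusProj x) := Subtype.ext hw
      rw [hl, this, e.apply_symm_apply]
    have h2 : torusProj (x - l w) = 1 := by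
      have h3 := torusProj_add (x - l w) (l w)
      rw [sub_add_cancel, h1] at h3
      exact right_eq_mul.mp h3
    obtain ⟨z, hz⟩ := torusProj_eq_one_iff.mp h2
    exact ⟨w, z, by rw [← hz]; exact (add_sub_cancel (l w) x).symm⟩
  have hl1 : ∀ r : ℝ, l (r • (1 : mixedEmbedding.mixedSpace K)) = 0 := by
    intro r
    have h1 : l 1 = 0 := by
      refine eq_zero_of_torusProj_smul fun r => ?_
      rw [← map_smul, hl]
      obtain ⟨p, hp⟩ := archExp_smul_one (K := K) r
      have : Set.codRestrict baseExp _ hmem (r • 1) = 1 := by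
        refine Subtype.ext ?_
        change toBase K (archExp K (r • 1)) = 1
        rw [hp, toBase_posReal]
      rw [this, map_one]
    rw [map_smul, h1, smul_zero]
  have hnpos : 0 < n := hn ▸ Module.finrank_pos
  -- Since l maps a space of dimension n onto ℝ^(n-1), its kernel is a line, namely the one spanned
  -- by 1. The rank statement of the unit theorem enters only through the existence of e.
  have hker : Module.finrank ℝ (LinearMap.ker l.toLinearMap) = 1 := by
    have h1 := LinearMap.finrank_range_add_finrank_ker l.toLinearMap
    rw [LinearMap.range_eq_top.mpr hsurj, finrank_top, mixedEmbedding.finrank, hn,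
      Module.finrank_fin_fun] at h1
    omega
  obtain ⟨s, hs⟩ := l.toLinearMap.exists_rightInverse_of_surjective
    (LinearMap.range_eq_top.mpr hsurj)
  refine ⟨l, LinearMap.toContinuousLinearMap s, fun x => LinearMap.congr_fun hs x, fun w => ?_, hl⟩
  constructor
  · intro hw
    have hne : (⟨1, by simpa using hl1 1⟩ : LinearMap.ker l.toLinearMap) ≠ 0 := by
      intro h
      exact one_ne_zero (congrArg Subtype.val h)
    obtain ⟨r, hr⟩ := (finrank_eq_one_iff_of_nonzero' _ hne).mp hker ⟨w, hw⟩
    exact ⟨r, (congrArg Subtype.val hr).symm⟩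
  · rintro ⟨r, rfl⟩
    exact hl1 r

/-! ### The exponential map to the class torus -/

variable (q : Ideal (𝓞 K))

/-- The exponential map to the neutral component of `C(q)/ℝ_{>0}`. -/
def torusExp (w : mixedEmbedding.mixedSpace K) : ClassTorus q := toTorus q (archExp K w, 1)

theorem continuous_torusExp : Continuous (torusExp q) :=
  (continuous_toTorus q).comp (continuous_archExp.prodMk continuous_const)

theorem isOpenMap_torusExp : IsOpenMap (torusExp q) := by
  intro U hU
  have h1 : torusExp q '' U = toTorus q '' ((archExp K '' U) ×ˢ {1}) := by
    ext t
    constructor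
    · rintro ⟨w, hw, rfl⟩
      exact ⟨_, ⟨⟨w, hw, rfl⟩, Set.mem_singleton _⟩, rfl⟩
    · rintro ⟨⟨_, _⟩, ⟨⟨w, hw, rfl⟩, rfl⟩, rfl⟩
      exact ⟨w, hw, rfl⟩
  rw [h1]
  exact isOpenMap_toTorus q _ ((isOpenMap_archExp _ hU).prod (isOpen_discrete _))

theorem torusExp_add (x y : mixedEmbedding.mixedSpace K) :
    torusExp q (x + y) = torusExp q x * torusExp q y := by
  rw [torusExp, archExp_add, torusExp, torusExp, ← map_mul, Prod.mk_mul_mk, mul_one]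

theorem mem_connectedComponent_torus_iff (t : ClassTorus q) :
    t ∈ Subgroup.connectedComponentOfOne (ClassTorus q) ↔ ∃ w, torusExp q w = t :=
  mem_connectedComponentOfOne_iff (continuous_torusExp q) (isOpenMap_torusExp q)
    (torusExp_add q) t

theorem toTorus_posReal (p : Units.posSubgroup ℝ) : toTorus q (posReal K p, 1) = 1 :=
  (QuotientGroup.eq_one_iff (N := posClasses q) _).mpr ⟨p, rfl⟩

theorem toTorus_surjective : Function.Surjective (toTorus q) := by
  intro t
  obtain ⟨c, rfl⟩ := QuotientGroup.mk_surjective (s := posClasses q) t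
  obtain ⟨s, rfl⟩ := QuotientGroup.mk_surjective (s := (principal q).range) c
  exact ⟨s, rfl⟩

theorem toTorus_principal (k : Kˣ) : toTorus q (principal q k) = 1 := by
  have : toClassGroupMod q (principal q k) = 1 :=
    (QuotientGroup.eq_one_iff (N := (principal q).range) _).mpr ⟨k, rfl⟩
  change QuotientGroup.mk' (posClasses q) (toClassGroupMod q (principal q k)) = 1
  rw [this]
  exact map_one _

theorem torusExp_smul_one (r : ℝ) : torusExp q (r • (1 : mixedEmbedding.mixedSpace K)) = 1 := by
  obtain ⟨p, hp⟩ := archExp_smul_one (K := K) r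
  rw [torusExp, hp, toTorus_posReal]

theorem rangeToBase_apply (u : unitSubgroup q) :
    rangeToBase q ⟨unitToTorus q u, ⟨u, rfl⟩⟩ = unitToBase q u :=
  MonoidHom.liftOfRightInverse_comp_apply (unitToTorus q).rangeRestrict _ _
    ⟨unitToBase q, ker_unitToTorus_le q⟩ u

theorem covering_torusExp (w : mixedEmbedding.mixedSpace K)
    (hw : torusExp q w ∈ Subgroup.connectedComponentOfOne (ClassTorus q)) :
    covering q ⟨torusExp q w, hw⟩ = baseExp w :=
  rangeToBase_apply q ⟨(archExp K w, 1), ⟨trivial, (finiteUnits q).one_mem⟩⟩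

end IdeleTorus

namespace IdeleTorus

universe u

/-! ### The group of units modulo `q` -/

variable {K : Type u} [Field K] [NumberField K] (q : Ideal (𝓞 K))

theorem valuation_eq_one_of_mem_localUnits {p : HeightOneSpectrum (𝓞 K)} {u : Kˣ}
    (hu : u ∈ localUnits p) : p.valuation K (u : K) = 1 := by
  simpa [localUnits, MonoidHom.mem_ker, Units.ext_iff] using hu

theorem mk_eq_mk_of_valuation_sub_le {p : HeightOneSpectrum (𝓞 K)} {m : ℕ} {u u' : Kˣ}
    (hu : p.valuation K (u : K) = 1) (hu' : p.valuation K (u' : K) = 1)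
    (h : p.valuation K ((u' : K) - u) ≤ WithZero.exp (-(m : ℤ))) :
    (QuotientGroup.mk u : Kˣ ⧸ higherUnits p m) = QuotientGroup.mk u' := by
  rw [QuotientGroup.eq]
  refine ⟨by simp [hu, hu'], ?_⟩
  have h1 : ((u⁻¹ * u' : Kˣ) : K) - 1 = ((u⁻¹ : Kˣ) : K) * ((u' : K) - u) := by
    rw [mul_sub, Units.inv_mul, Units.val_mul]
  rw [h1, map_mul, Units.val_inv_eq_inv_val, map_inv₀, hu, inv_one, one_mul]
  exact h

/-- The element `a` of `O_K` represents `α` in all local components at primes dividing `q`. -/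
def Represents (α : FinitePart q) (a : 𝓞 K) : Prop :=
  ∀ p : {p : HeightOneSpectrum (𝓞 K) // p.asIdeal ∣ q}, ∃ u : Kˣ,
    α.1 p = QuotientGroup.mk u ∧ p.1.valuation K (u : K) = 1 ∧
      p.1.valuation K (algebraMap (𝓞 K) K a - u) ≤
        WithZero.exp (-(multiplicity p.1.asIdeal q : ℤ))

variable {q}

theorem one_le_multiplicity {p : HeightOneSpectrum (𝓞 K)} (hp : p.asIdeal ∣ q) :
    1 ≤ multiplicity p.asIdeal q :=
  Nat.one_le_iff_ne_zero.mpr (multiplicity_ne_zero.mpr hp)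

/-- A maximal ideal p containing q and a would divide q, and there a is congruent to a local unit
modulo p, since the exponent of p in q is at least 1. -/
theorem Represents.isUnit [NeZero q] {α : FinitePart q} {a : 𝓞 K} (h : Represents q α a) :
    IsUnit (Ideal.Quotient.mk q a) := by
  by_contra hnot
  obtain ⟨m, hm, ham⟩ := exists_max_ideal_of_mem_nonunits hnot
  have hmax := Ideal.comap_isMaximal_of_surjective (Ideal.Quotient.mk q)
    Ideal.Quotient.mk_surjective (K := m)
  have hle : q ≤ m.comap (Ideal.Quotient.mk q) := by
    intro x hx
    rw [Ideal.mem_comap, Ideal.Quotient.eq_zero_iff_mem.mpr hx]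
    exact m.zero_mem
  let p : HeightOneSpectrum (𝓞 K) := ⟨m.comap (Ideal.Quotient.mk q), hmax.isPrime, by
    rintro h0
    rw [h0, le_bot_iff] at hle
    exact NeZero.ne q hle⟩
  have hp : p.asIdeal ∣ q := Ideal.dvd_iff_le.mpr hle
  obtain ⟨u, -, hu1, hua⟩ := h ⟨p, hp⟩
  have hlt : p.valuation K (algebraMap (𝓞 K) K a - u) < 1 := by
    refine hua.trans_lt ?_
    rw [← WithZero.exp_zero, WithZero.exp_lt_exp]
    have := one_le_multiplicity hp
    change -(multiplicity p.asIdeal q : ℤ) < 0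
    omega
  have ha : p.valuation K (algebraMap (𝓞 K) K a) < 1 :=
    (HeightOneSpectrum.valuation_lt_one_iff_mem p a).mpr ham
  have h2 : p.valuation K (u : K) < 1 := by
    have : (u : K) = algebraMap (𝓞 K) K a - (algebraMap (𝓞 K) K a - u) := by ring
    rw [this]
    exact ((p.valuation K).map_sub _ _).trans_lt (max_lt ha hlt)
  exact h2.ne hu1

/-- Each local unit is approximated by an integer of K, and the integers are glued by the Chinese
remainder theorem. -/
theorem exists_represents [NeZero q] {α : FinitePart q} (hα : α ∈ finiteUnits q) :
    ∃ a, Represents q α a := by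
  choose u hu huα using fun p => hα.1 p (Set.mem_univ p)
  have hu1 := fun p => valuation_eq_one_of_mem_localUnits (hu p)
  choose a ha using fun p : {p : HeightOneSpectrum (𝓞 K) // p.asIdeal ∣ q} =>
    HeightOneSpectrum.exists_valuation_sub_lt_of_integer p.1 (K := K) (hu1 p).le
      (Units.mk0 (WithZero.exp (-(multiplicity p.1.asIdeal q : ℤ))) (by simp))
  have : Finite {p : HeightOneSpectrum (𝓞 K) // p.asIdeal ∣ q} :=
    (Ideal.finite_factors (NeZero.ne q)).to_subtype
  have := Fintype.ofFinite {p : HeightOneSpectrum (𝓞 K) // p.asIdeal ∣ q}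
  obtain ⟨y, hy⟩ := IsDedekindDomain.exists_forall_sub_mem_ideal (s := Finset.univ)
    (fun p : {p : HeightOneSpectrum (𝓞 K) // p.asIdeal ∣ q} => p.1.asIdeal)
    (fun p => multiplicity p.1.asIdeal q) (fun p _ => p.1.prime)
    (fun p _ p' _ hne heq => hne (Subtype.ext (HeightOneSpectrum.ext heq)))
    (fun p => a p.1)
  refine ⟨y, fun p => ⟨u p, (huα p).symm, hu1 p, ?_⟩⟩
  have h1 := hy p (Finset.mem_univ p)
  rw [← HeightOneSpectrum.intValuation_le_pow_iff_mem,
    ← HeightOneSpectrum.valuation_of_algebraMap (K := K)] at h1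
  have h2 : algebraMap (𝓞 K) K y - (u p : K) =
    algebraMap (𝓞 K) K (y - a p) + (algebraMap (𝓞 K) K (a p) - u p) := by
    rw [map_sub]
    ring
  rw [h2]
  exact (p.1.valuation K).map_add_le h1 (ha p).le

theorem Represents.eq {α β : FinitePart q} (hα : α ∈ finiteUnits q) (hβ : β ∈ finiteUnits q)
    {a b : 𝓞 K} (ha : Represents q α a) (hb : Represents q β b) (hab : a - b ∈ q) : α = β := by
  refine Prod.ext (funext fun p => ?_) ?_
  · obtain ⟨u, hu, hu1, hua⟩ := ha p
    obtain ⟨v, hv, hv1, hvb⟩ := hb p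
    rw [hu, hv]
    refine mk_eq_mk_of_valuation_sub_le hu1 hv1 ?_
    have h1 : p.1.valuation K (algebraMap (𝓞 K) K (a - b)) ≤
        WithZero.exp (-(multiplicity p.1.asIdeal q : ℤ)) := by
      rw [HeightOneSpectrum.valuation_of_algebraMap,
        HeightOneSpectrum.intValuation_le_pow_iff_mem]
      exact Ideal.dvd_iff_le.mp (pow_multiplicity_dvd _ _) hab
    have h2 : (v : K) - u = (algebraMap (𝓞 K) K a - u) -
        (algebraMap (𝓞 K) K (a - b) + (algebraMap (𝓞 K) K b - v)) := by
      rw [map_sub]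
      ring
    rw [h2]
    exact (p.1.valuation K).map_sub_le hua ((p.1.valuation K).map_add_le h1 hvb)
  · exact (Subgroup.mem_bot.mp hα.2).trans (Subgroup.mem_bot.mp hβ.2).symm

variable (q)

/-- A choice of an injection of `finiteUnits q` into `(O_K/q)ˣ`. -/
theorem exists_injective_finiteUnits [NeZero q] :
    ∃ f : finiteUnits q → (𝓞 K ⧸ q)ˣ, Function.Injective f := by
  choose a ha using fun α : finiteUnits q => exists_represents α.2
  refine ⟨fun α => (ha α).isUnit.unit, fun α β h => ?_⟩
  have h1 := congrArg Units.val h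
  simp only [IsUnit.unit_spec] at h1
  exact Subtype.ext ((ha α).eq α.2 β.2 (ha β) (Ideal.Quotient.eq.mp h1))

theorem finite_quotient [NeZero q] : Finite (𝓞 K ⧸ q) :=
  Ideal.finiteQuotientOfFreeOfNeBot q (NeZero.ne q)

theorem finite_finiteUnits [NeZero q] : Finite (finiteUnits q) := by
  have := finite_quotient q
  obtain ⟨f, hf⟩ := exists_injective_finiteUnits q
  exact Finite.of_injective f hf

theorem card_finiteUnits_le [NeZero q] : Nat.card (finiteUnits q) ≤ totient q := by
  have := finite_quotient q
  obtain ⟨f, hf⟩ := exists_injective_finiteUnits q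
  exact Nat.card_le_card_of_injective f hf

end IdeleTorus

namespace IdeleTorus

universe u

/-! ### The group of components -/

variable {K : Type u} [Field K] [NumberField K] (q : Ideal (𝓞 K))

open scoped nonZeroDivisors in
theorem count_spanSingleton (p : HeightOneSpectrum (𝓞 K)) (x : Kˣ) :
    FractionalIdeal.count K p (FractionalIdeal.spanSingleton (𝓞 K)⁰ (x : K)) = ord p x := by
  obtain ⟨n, d, hd, hx⟩ := IsFractionRing.div_surjective (A := 𝓞 K) (x : K)
  have hd0 : d ≠ 0 := nonZeroDivisors.ne_zero hd
  have hn0 : n ≠ 0 := by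
    rintro rfl
    rw [map_zero, zero_div] at hx
    exact x.ne_zero hx.symm
  rw [FractionalIdeal.count_well_defined (a := d) (J := Ideal.span {n}) K p
    (FractionalIdeal.spanSingleton_ne_zero_iff.mpr x.ne_zero)]
  · rw [ord, ← hx, map_div₀, HeightOneSpectrum.valuation_of_algebraMap,
      HeightOneSpectrum.valuation_of_algebraMap, HeightOneSpectrum.intValuation_if_neg p hn0,
      HeightOneSpectrum.intValuation_if_neg p hd0,
      WithZero.log_div (by simp) (by simp), WithZero.log_exp, WithZero.log_exp]
    ring
  · rw [FractionalIdeal.coeIdeal_span_singleton,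
      FractionalIdeal.spanSingleton_mul_spanSingleton, ← hx, div_eq_inv_mul]

variable {q} in
open scoped Classical in
/-- The valuations of a representative of an element of the finite part. -/
def exponent [NeZero q] (α : FinitePart q) : HeightOneSpectrum (𝓞 K) →₀ ℤ :=
  Finsupp.ofSupportFinite
    (fun p => if h : p.asIdeal ∣ q then ord p (Quotient.out (α.1 ⟨p, h⟩)) else α.2.toAdd ⟨p, h⟩)
    (((Ideal.finite_factors (NeZero.ne q)).union
      ((α.2.toAdd.hasFiniteSupport).image Subtype.val)).subset fun p hp => by
        by_cases h : p.asIdeal ∣ q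
        · exact Or.inl h
        · refine Or.inr ⟨⟨p, h⟩, ?_, rfl⟩
          simpa [h] using hp)

variable {q} in
theorem exponent_of_dvd [NeZero q] (α : FinitePart q) {p : HeightOneSpectrum (𝓞 K)}
    (h : p.asIdeal ∣ q) : exponent α p = ord p (Quotient.out (α.1 ⟨p, h⟩)) := dif_pos h

variable {q} in
theorem exponent_of_not_dvd [NeZero q] (α : FinitePart q) {p : HeightOneSpectrum (𝓞 K)}
    (h : ¬ p.asIdeal ∣ q) : exponent α p = α.2.toAdd ⟨p, h⟩ := dif_neg h

open scoped nonZeroDivisors in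
variable {q} in
/-- The fractional ideal of an element of the finite part. -/
def fractional [NeZero q] (α : FinitePart q) : (FractionalIdeal (𝓞 K)⁰ K)ˣ :=
  Units.mk0 ((exponent α).prod fun p m => (p.asIdeal : FractionalIdeal (𝓞 K)⁰ K) ^ m)
    (Finset.prod_ne_zero_iff.mpr fun p _ =>
      zpow_ne_zero _ (FractionalIdeal.coeIdeal_ne_zero.mpr p.ne_bot))

variable {q} in
theorem count_fractional [NeZero q] (α : FinitePart q) (p : HeightOneSpectrum (𝓞 K)) :
    FractionalIdeal.count K p (fractional α) = exponent α p :=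
  FractionalIdeal.count_finsuppProd K p (exponent α)

/-- The ideal class of an element of the finite part. -/
def idealClass [NeZero q] (α : FinitePart q) : ClassGroup (𝓞 K) :=
  (ClassGroup.equiv K).symm (QuotientGroup.mk (fractional α))

variable {q}

theorem mem_localUnits_of_ord_eq_zero {p : HeightOneSpectrum (𝓞 K)} {x : Kˣ} (h : ord p x = 0) :
    x ∈ localUnits p := by
  have h0 : p.valuation K (x : K) ≠ 0 := by simp
  have h5 : WithZero.log (p.valuation K (x : K)) = 0 := by simpa [ord] using h
  have : p.valuation K (x : K) = 1 := by rw [← WithZero.exp_log h0, h5, WithZero.exp_zero]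
  rw [localUnits, MonoidHom.mem_ker]
  exact Units.ext this

/-- The fractional ideals of α and β differ by a principal ideal (k); multiplying the quotient by k
makes all valuations zero. -/
theorem exists_mul_mem_finiteUnits [NeZero q] {α β : FinitePart q}
    (h : idealClass q α = idealClass q β) :
    ∃ k : Kˣ, β⁻¹ * α * finiteDiag q k ∈ finiteUnits q := by
  have h1 := (ClassGroup.equiv K).symm.injective h
  obtain ⟨k, hk⟩ := QuotientGroup.eq.mp h1
  have hk' : fractional β = fractional α * toPrincipalIdeal (𝓞 K) K k := by
    rw [hk, mul_inv_cancel_left]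
  have hexp : ∀ p, exponent β p = exponent α p + ord p k := by
    intro p
    rw [← count_fractional, ← count_fractional, ← count_spanSingleton, hk', Units.val_mul,
      FractionalIdeal.count_mul K p (Units.ne_zero _) (Units.ne_zero _), coe_toPrincipalIdeal]
  refine ⟨k, fun p _ => ?_, ?_⟩
  · refine ⟨(Quotient.out (β.1 p))⁻¹ * Quotient.out (α.1 p) * k, ?_, ?_⟩
    · refine mem_localUnits_of_ord_eq_zero ?_
      have h2 := hexp p.1
      rw [exponent_of_dvd _ p.2, exponent_of_dvd _ p.2] at h2
      have h3 := ord_mul p.1 (Quotient.out (β.1 p))⁻¹ (Quotient.out (β.1 p))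
      rw [inv_mul_cancel, ord_one] at h3
      rw [ord_mul, ord_mul]
      change ord p.1 (Quotient.out (β.1 p)) = ord p.1 (Quotient.out (α.1 p)) + ord p.1 k at h2
      linarith
    · rw [map_mul, map_mul, map_inv]
      change (QuotientGroup.mk (Quotient.out (β.1 p)))⁻¹ * QuotientGroup.mk (Quotient.out (α.1 p)) *
        QuotientGroup.mk k = (β.1 p)⁻¹ * α.1 p * QuotientGroup.mk k
      rw [QuotientGroup.out_eq', QuotientGroup.out_eq']
  · refine Subgroup.mem_bot.mpr ?_
    apply Multiplicative.toAdd.injective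
    ext p
    have h2 := hexp p.1
    rw [exponent_of_not_dvd _ p.2, exponent_of_not_dvd _ p.2] at h2
    change -(β.2.toAdd p) + α.2.toAdd p + ord p.1 k = 0
    change β.2.toAdd p = α.2.toAdd p + ord p.1 k at h2
    linarith

variable (q)

/-- Representatives of the ideal classes in the finite part. -/
theorem exists_class_representatives [NeZero q] :
    ∃ r : ClassGroup (𝓞 K) → FinitePart q, ∀ α : FinitePart q,
      ∃ k : Kˣ, (r (idealClass q α))⁻¹ * α * finiteDiag q k ∈ finiteUnits q := by
  classical
  refine ⟨fun c => if h : ∃ β, idealClass q β = c then h.choose else 1, fun α => ?_⟩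
  have h : ∃ β, idealClass q β = idealClass q α := ⟨α, rfl⟩
  beta_reduce
  rw [dif_pos h]
  exact exists_mul_mem_finiteUnits h.choose_spec.symm

variable (K) in
/-- The archimedean unit with given signs at the real places. -/
def archSign (σ : {w : InfinitePlace K // w.IsReal} → ℤˣ) : ArchUnits K := archPoint K (0, 0, σ)

theorem archSign_fst (σ : {w : InfinitePlace K // w.IsReal} → ℤˣ)
    (v : {w : InfinitePlace K // w.IsReal}) :
    (archSign K σ : mixedEmbedding.mixedSpace K).1 v = ((σ v : ℤ) : ℝ) := by
  change ((σ v : ℤ) : ℝ) * Real.exp 0 = _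
  rw [Real.exp_zero, mul_one]

theorem archSign_snd (σ : {w : InfinitePlace K // w.IsReal} → ℤˣ)
    (v : {w : InfinitePlace K // w.IsComplex}) :
    (archSign K σ : mixedEmbedding.mixedSpace K).2 v = 1 := by
  change (((0 : AddCircle (2 * Real.pi)).toCircle : Circle) : ℂ) *
    ((Real.exp ((0 : ℝ) / 2) : ℝ) : ℂ) = 1
  simp

theorem archUnits_fst_ne_zero (y : ArchUnits K) (v : {w : InfinitePlace K // w.IsReal}) :
    (y : mixedEmbedding.mixedSpace K).1 v ≠ 0 := by
  intro h
  have h1 := congrFun (congrArg Prod.fst y.mul_inv) v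
  rw [Prod.fst_mul, Pi.mul_apply, h, zero_mul] at h1
  exact zero_ne_one h1

theorem archUnits_snd_ne_zero (y : ArchUnits K) (v : {w : InfinitePlace K // w.IsComplex}) :
    (y : mixedEmbedding.mixedSpace K).2 v ≠ 0 := by
  intro h
  have h1 := congrFun (congrArg Prod.snd y.mul_inv) v
  rw [Prod.snd_mul, Pi.mul_apply, h, zero_mul] at h1
  exact zero_ne_one h1

theorem exists_eq_archSign_mul_archExp (y : ArchUnits K) :
    ∃ σ w, y = archSign K σ * archExp K w := by
  refine ⟨fun v => if 0 < (y : mixedEmbedding.mixedSpace K).1 v then 1 else -1,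
    (fun v => Real.log ((y : mixedEmbedding.mixedSpace K).1 v),
      fun v => Complex.log ((y : mixedEmbedding.mixedSpace K).2 v)), ?_⟩
  ext v
  · rw [Units.val_mul, Prod.fst_mul, Pi.mul_apply, archSign_fst, archExp_fst,
      Real.exp_log_eq_abs (archUnits_fst_ne_zero y v)]
    split_ifs with h
    · simp [abs_of_pos h]
    · simp [abs_of_nonpos (not_lt.mp h)]
  · rw [Units.val_mul, Prod.snd_mul, Pi.mul_apply, archSign_snd, archExp_snd,
      Complex.exp_log (archUnits_snd_ne_zero y v), one_mul]

/-- The image of `(O_K/q)ˣ` in the torus. -/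
def finiteImage : Subgroup (ClassTorus q) :=
  (finiteUnits q).map ((toTorus q).comp (MonoidHom.inr (ArchUnits K) (FinitePart q)))

theorem finite_finiteImage [NeZero q] : Finite (finiteImage q) := by
  have : Finite (finiteUnits q) := finite_finiteUnits q
  exact (Set.toFinite (finiteUnits q : Set (FinitePart q))).image _ |>.to_subtype

theorem card_finiteImage_le [NeZero q] : Nat.card (finiteImage q) ≤ totient q := by
  have : Finite (finiteUnits q) := finite_finiteUnits q
  refine le_trans ?_ (card_finiteUnits_le q)
  exact Nat.card_le_card_of_surjective
    (fun α : finiteUnits q => (⟨toTorus q (1, α.1), α.1, α.2, rfl⟩ : finiteImage q))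
    (by rintro ⟨_, α, hα, rfl⟩; exact ⟨⟨α, hα⟩, rfl⟩)

/-- Modulo principal ideles a finite component is a class representative times an element of
(O_K/q)ˣ, and an archimedean component is a sign vector times an exponential. The index set depends
on K only; all dependence on q sits in `finiteImage`. -/
theorem exists_component_representatives [NeZero q] :
    ∃ r : ClassGroup (𝓞 K) × ({w : InfinitePlace K // w.IsReal} → ℤˣ) → ClassTorus q,
      ∀ t, ∃ c, ∃ f ∈ finiteImage q, ∃ w, t = r c * f * torusExp q w := by
  obtain ⟨r, hr⟩ := exists_class_representatives q
  refine ⟨fun c => toTorus q (archSign K c.2, r c.1), fun t => ?_⟩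
  obtain ⟨⟨y, α⟩, rfl⟩ := toTorus_surjective q t
  obtain ⟨k, hk⟩ := hr α
  obtain ⟨σ, w, hw⟩ := exists_eq_archSign_mul_archExp (y * archDiag K k)
  refine ⟨(idealClass q α, σ), toTorus q (1, (r (idealClass q α))⁻¹ * α * finiteDiag q k),
    ⟨_, hk, rfl⟩, w, ?_⟩
  rw [torusExp, ← map_mul, ← map_mul, ← mul_one (toTorus q (y, α)), ← toTorus_principal q k,
    ← map_mul]
  congr 1
  refine Prod.ext ?_ ?_
  · change y * archDiag K k = archSign K σ * 1 * archExp K w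
    rw [hw, mul_one]
  · change α * finiteDiag q k = r (idealClass q α) *
      ((r (idealClass q α))⁻¹ * α * finiteDiag q k) * 1
    group

theorem torusExp_mem (w : mixedEmbedding.mixedSpace K) :
    torusExp q w ∈ Subgroup.connectedComponentOfOne (ClassTorus q) :=
  (mem_connectedComponent_torus_iff q _).mpr ⟨w, rfl⟩

instance finiteIndex_connectedComponent [NeZero q] :
    (Subgroup.connectedComponentOfOne (ClassTorus q)).FiniteIndex := by
  obtain ⟨r, hr⟩ := exists_component_representatives q
  have := finite_finiteImage q
  have : Finite (ClassTorus q ⧸ Subgroup.connectedComponentOfOne (ClassTorus q)) := by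
    refine Finite.of_surjective (fun c : (ClassGroup (𝓞 K) ×
      ({w : InfinitePlace K // w.IsReal} → ℤˣ)) × finiteImage q =>
        (QuotientGroup.mk (r c.1 * c.2) :
          ClassTorus q ⧸ Subgroup.connectedComponentOfOne (ClassTorus q))) ?_
    intro t
    obtain ⟨t, rfl⟩ := QuotientGroup.mk_surjective t
    obtain ⟨c, f, hf, w, rfl⟩ := hr t
    refine ⟨(c, ⟨f, hf⟩), ?_⟩
    rw [QuotientGroup.eq, inv_mul_cancel_left]
    exact torusExp_mem q w
  exact Subgroup.finiteIndex_of_finite_quotient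

variable (K) in
/-- A bound for the number of components of the torus modulo the image of `(O_K/q)ˣ`. -/
def componentBound : ℕ :=
  Nat.card (ClassGroup (𝓞 K) × ({w : InfinitePlace K // w.IsReal} → ℤˣ))

theorem componentBound_pos : 0 < componentBound K := Nat.card_pos

theorem finite_quotient_sup [NeZero q] : Finite (ClassTorus q ⧸
      (finiteImage q ⊔ Subgroup.connectedComponentOfOne (ClassTorus q))) ∧
    Nat.card (ClassTorus q ⧸
      (finiteImage q ⊔ Subgroup.connectedComponentOfOne (ClassTorus q))) ≤ componentBound K := by
  obtain ⟨r, hr⟩ := exists_component_representatives q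
  have hsurj : Function.Surjective (fun c => (QuotientGroup.mk (r c) : ClassTorus q ⧸
      (finiteImage q ⊔ Subgroup.connectedComponentOfOne (ClassTorus q)))) := by
    intro t
    obtain ⟨t, rfl⟩ := QuotientGroup.mk_surjective t
    obtain ⟨c, f, hf, w, rfl⟩ := hr t
    refine ⟨c, ?_⟩
    rw [QuotientGroup.eq, mul_assoc, inv_mul_cancel_left]
    exact Subgroup.mul_mem_sup hf (torusExp_mem q w)
  exact ⟨Finite.of_surjective _ hsurj, Nat.card_le_card_of_surjective _ hsurj⟩

end IdeleTorus

namespace IdeleTorus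

universe u

/-! ### Counting characters of bounded frequency -/

theorem floor_mem_Icc {x L : ℝ} (h : |x| ≤ L) : ⌊x⌋ ∈ Finset.Icc ⌊-L⌋ ⌊L⌋ :=
  Finset.mem_Icc.mpr ⟨Int.floor_mono (abs_le.mp h).1, Int.floor_mono (abs_le.mp h).2⟩

theorem card_Icc_floor_le {L : ℝ} (hL : 1 ≤ L) : ((Finset.Icc ⌊-L⌋ ⌊L⌋).card : ℝ) ≤ 4 * L := by
  have h1 : ⌊-L⌋ ≤ ⌊L⌋ := Int.floor_mono (by linarith)
  have h2 : (((Finset.Icc ⌊-L⌋ ⌊L⌋).card : ℤ) : ℝ) = (⌊L⌋ : ℝ) + 1 - ⌊-L⌋ := by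
    rw [Int.card_Icc, Int.toNat_of_nonneg (by omega)]
    push_cast
    ring
  rw [← Int.cast_natCast, h2]
  have := Int.floor_le L
  have := Int.lt_floor_add_one (-L)
  linarith

/-- The values of ψ on F include those on π(ℤ^d), so they fix the frequency modulo ℤ^d, and the
floors fix the rest. Hence ψ is known on F ⊔ T₀, and what remains free is a character of the
quotient. In the application only the order of F grows with q. -/
theorem exists_finset_characters {T : Type*} [CommGroup T] [TopologicalSpace T]
    [IsTopologicalGroup T] {d : ℕ} {π : (Fin d → ℝ) → T} {T₀ F : Subgroup T} [Finite F]
    (hrange : ∀ t ∈ T₀, ∃ x, π x = t)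
    (hint : ∀ z : Fin d → ℤ, π (fun j => (z j : ℝ)) ∈ F) [Finite (T ⧸ (F ⊔ T₀))]
    {L : ℝ} (hL : 1 ≤ L) :
    ∃ Ξ : Finset (PontryaginDual T),
      (Ξ.card : ℝ) ≤ Nat.card F * (4 * L) ^ d * Nat.card (T ⧸ (F ⊔ T₀)) ∧
      ∀ (ψ : PontryaginDual T) (ξ : Fin d → ℝ),
        (∀ x, ψ (π x) = Circle.exp (2 * Real.pi * ∑ j, x j * ξ j)) →
        (∀ j, |ξ j| ≤ L) → ψ ∈ Ξ := by
  classical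
  let S : Set (PontryaginDual T) := {ψ | ∃ ξ : Fin d → ℝ,
    (∀ x, ψ (π x) = Circle.exp (2 * Real.pi * ∑ j, x j * ξ j)) ∧ ∀ j, |ξ j| ≤ L}
  choose ξ hξ hξL using fun ψ : S => ψ.2
  -- Homomorphisms into the unit group of `Circle` are used because duality of finite abelian groups
  -- is stated for unit groups.
  let A := (F →* Circleˣ) × (Fin d → Finset.Icc ⌊-L⌋ ⌊L⌋)
  let f : S → A := fun ψ =>
    (toUnits.toMonoidHom.comp (((ψ.1 : T →ₜ* Circle) : T →* Circle).comp F.subtype),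
      fun j => ⟨⌊ξ ψ j⌋, floor_mem_Icc (hξL ψ j)⟩)
  have hf : ∀ ψ ψ' : S, f ψ = f ψ' → ∀ t ∈ F ⊔ T₀, ψ.1 t = ψ'.1 t := by
    intro ψ ψ' h
    have hF : ∀ t ∈ F, ψ.1 t = ψ'.1 t := fun t ht =>
      toUnits.injective (DFunLike.congr_fun (congrArg Prod.fst h) ⟨t, ht⟩)
    have hfloor : ∀ j, ⌊ξ ψ j⌋ = ⌊ξ ψ' j⌋ := fun j =>
      congrArg Subtype.val (congrFun (congrArg Prod.snd h) j)
    have h1 : torusProj (ξ ψ) = torusProj (ξ ψ') := by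
      funext j
      have h2 := hF _ (hint (Pi.single j 1))
      rw [hξ ψ, hξ ψ'] at h2
      simpa [Pi.single_apply, torusProj] using h2
    have h2 : torusProj (ξ ψ - ξ ψ') = 1 := by
      have h3 := torusProj_add (ξ ψ - ξ ψ') (ξ ψ')
      rw [sub_add_cancel, h1] at h3
      exact right_eq_mul.mp h3
    obtain ⟨z, hz⟩ := torusProj_eq_one_iff.mp h2
    have h3 : ξ ψ = ξ ψ' := by
      funext j
      have h4 : ξ ψ j - ξ ψ' j = z j := congrFun hz j
      have h5 := Int.abs_sub_lt_one_of_floor_eq_floor (hfloor j)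
      rw [h4] at h5
      have h6 : z j = 0 := Int.abs_lt_one_iff.mp (by exact_mod_cast h5)
      rw [h6, Int.cast_zero] at h4
      exact sub_eq_zero.mp h4
    have hT : ∀ t ∈ T₀, ψ.1 t = ψ'.1 t := by
      intro t ht
      obtain ⟨x, rfl⟩ := hrange t ht
      rw [hξ ψ, hξ ψ', h3]
    have hle : F ⊔ T₀ ≤ MonoidHom.eqLocus ((ψ.1 : T →ₜ* Circle) : T →* Circle)
        ((ψ'.1 : T →ₜ* Circle) : T →* Circle) := sup_le hF hT
    exact fun t ht => hle ht
  -- One reference character for each value of the data; dividing ψ by it gives a character of the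
  -- quotient by F ⊔ T₀.
  let c : A → PontryaginDual T := fun a => if h : ∃ ψ, f ψ = a then h.choose.1 else 1
  have hc : ∀ ψ : S, ∀ t ∈ F ⊔ T₀, ψ.1 t = c (f ψ) t := by
    intro ψ t ht
    have h : ∃ ψ', f ψ' = f ψ := ⟨ψ, rfl⟩
    change ψ.1 t = (if h : ∃ ψ', f ψ' = f ψ then h.choose.1 else 1 : PontryaginDual T) t
    rw [dif_pos h]
    exact hf _ _ h.choose_spec.symm t ht
  have hlift : ∀ ψ : S, ∃ g : T ⧸ (F ⊔ T₀) →* Circleˣ,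
      ∀ t : T, g t = toUnits (ψ.1 t / c (f ψ) t) := by
    intro ψ
    refine ⟨QuotientGroup.lift (F ⊔ T₀) (toUnits.toMonoidHom.comp
      (((ψ.1 : T →ₜ* Circle) : T →* Circle) / ((c (f ψ) : T →ₜ* Circle) : T →* Circle)))
      (fun t ht => ?_), fun t => rfl⟩
    rw [MonoidHom.mem_ker]
    change toUnits (ψ.1 t / c (f ψ) t) = 1
    rw [hc ψ t ht, div_self', map_one]
  choose g hg using hlift
  have hinj : Function.Injective fun ψ : S => (f ψ, g ψ) := by
    intro ψ ψ' h
    have h1 : f ψ = f ψ' := congrArg Prod.fst h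
    have h2 : g ψ = g ψ' := congrArg Prod.snd h
    refine Subtype.ext (DFunLike.ext _ _ fun t => ?_)
    have h3 := DFunLike.congr_fun h2 (t : T ⧸ (F ⊔ T₀))
    rw [hg, hg, h1] at h3
    exact div_left_injective (toUnits.injective h3)
  have e1 := (CommGroup.monoidHom_mulEquiv_of_hasEnoughRootsOfUnity F Circle).some
  have e2 := (CommGroup.monoidHom_mulEquiv_of_hasEnoughRootsOfUnity (T ⧸ (F ⊔ T₀)) Circle).some
  have : Finite (F →* Circleˣ) := Finite.of_equiv _ e1.symm.toEquiv
  have : Finite (T ⧸ (F ⊔ T₀) →* Circleˣ) := Finite.of_equiv _ e2.symm.toEquiv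
  have hSfin : Finite S := Finite.of_injective _ hinj
  have hcard : S.ncard ≤ Nat.card F * (Finset.Icc ⌊-L⌋ ⌊L⌋).card ^ d *
      Nat.card (T ⧸ (F ⊔ T₀)) := by
    have h1 := Nat.card_le_card_of_injective _ hinj
    rw [Nat.card_prod, Nat.card_prod, Nat.card_congr e1.toEquiv, Nat.card_congr e2.toEquiv,
      Nat.card_pi, Finset.prod_const, Finset.card_univ, Fintype.card_fin,
      Nat.card_coe_set_eq, Nat.card_eq_fintype_card (α := Finset.Icc ⌊-L⌋ ⌊L⌋),
      Fintype.card_coe] at h1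
    exact h1
  have hS : S.Finite := Set.toFinite S
  refine ⟨hS.toFinset, ?_, fun ψ ξ h1 h2 => hS.mem_toFinset.mpr ⟨ξ, h1, h2⟩⟩
  rw [← Set.ncard_eq_toFinset_card S hS]
  refine (Nat.cast_le.mpr hcard).trans ?_
  push_cast
  gcongr
  exact card_Icc_floor_le hL

/-! ### The chart of the class torus given by a trivialization of the base torus -/

variable {K : Type u} [Field K] [NumberField K] (q : Ideal (𝓞 K))

theorem finiteDiag_unit_mem (ε : (𝓞 K)ˣ) :
    finiteDiag q (Units.map (algebraMap (𝓞 K) K : 𝓞 K →* K) ε) ∈ finiteUnits q := by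
  have hval : ∀ p : HeightOneSpectrum (𝓞 K),
      p.valuation K (algebraMap (𝓞 K) K (ε : 𝓞 K)) = 1 := by
    intro p
    refine le_antisymm (p.valuation_le_one _) ?_
    have h1 : p.valuation K (algebraMap (𝓞 K) K (ε : 𝓞 K)) *
        p.valuation K (algebraMap (𝓞 K) K ((ε⁻¹ : (𝓞 K)ˣ) : 𝓞 K)) = 1 := by
      rw [← map_mul, ← map_mul, Units.mul_inv, map_one, map_one]
    rw [← h1]
    exact mul_le_of_le_one_right' (p.valuation_le_one _)
  have hord : ∀ p : HeightOneSpectrum (𝓞 K),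
      ord p (Units.map (algebraMap (𝓞 K) K : 𝓞 K →* K) ε) = 0 := by
    intro p
    change -(WithZero.log (p.valuation K (algebraMap (𝓞 K) K (ε : 𝓞 K)))) = 0
    rw [hval, WithZero.log_one, neg_zero]
  refine ⟨fun p _ => ⟨_, mem_localUnits_of_ord_eq_zero (hord p.1), rfl⟩, ?_⟩
  refine Subgroup.mem_bot.mpr ?_
  apply Multiplicative.toAdd.injective
  ext p
  exact hord p.1

/-- Such an exponential is a unit ε times a positive real, and modulo principal ideles (ε, 1) equals
(1, ε⁻¹). -/
theorem torusExp_mem_finiteImage {w : mixedEmbedding.mixedSpace K} (hw : baseExp w = 1) :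
    torusExp q w ∈ finiteImage q := by
  have h1 : archExp K w ∈ unitsPos K := (QuotientGroup.eq_one_iff (N := unitsPos K) _).mp hw
  obtain ⟨_, ⟨ε, rfl⟩, _, ⟨r, rfl⟩, h2⟩ := Subgroup.mem_sup.mp h1
  refine ⟨(finiteDiag q (Units.map (algebraMap (𝓞 K) K : 𝓞 K →* K) ε))⁻¹,
    (finiteUnits q).inv_mem (finiteDiag_unit_mem q ε), ?_⟩
  have h3 : torusExp q w = toTorus q (1, (finiteDiag q
      (Units.map (algebraMap (𝓞 K) K : 𝓞 K →* K) ε))⁻¹) *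
      toTorus q (principal q (Units.map (algebraMap (𝓞 K) K : 𝓞 K →* K) ε)) *
      toTorus q (posReal K r, 1) := by
    rw [torusExp, ← map_mul, ← map_mul, ← h2]
    congr 1
    refine Prod.ext ?_ ?_
    · exact (congrArg (· * posReal K r) (one_mul _)).symm
    · change 1 = _⁻¹ * _ * 1
      rw [mul_one]
      exact (inv_mul_cancel _).symm
  rw [h3, toTorus_principal, toTorus_posReal, mul_one, mul_one]
  rfl

/-- Linear coordinates on `K ⊗_ℚ ℝ` modulo `ℝ` together with a linear section. -/
structure LinearChart (K : Type u) [Field K] [NumberField K] (d : ℕ)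
    (e : Subgroup.connectedComponentOfOne (BaseTorus K) ≃ₜ* (Fin d → Circle)) where
  /-- The coordinates. -/
  coord : mixedEmbedding.mixedSpace K → (Fin d → ℝ)
  /-- The section. -/
  sec : (Fin d → ℝ) → mixedEmbedding.mixedSpace K
  continuous_coord : Continuous coord
  continuous_sec : Continuous sec
  coord_sub : ∀ x y, coord (x - y) = coord x - coord y
  sec_add : ∀ x y, sec (x + y) = sec x + sec y
  coord_sec : ∀ x, coord (sec x) = x
  coord_eq_zero : ∀ w, coord w = 0 → ∃ r : ℝ, w = r • (1 : mixedEmbedding.mixedSpace K)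
  torusProj_coord : ∀ w, torusProj (coord w) =
    e ⟨baseExp w, (mem_connectedComponent_base_iff _).mpr ⟨w, rfl⟩⟩

open scoped Classical in
theorem nonempty_linearChart {n : ℕ} (hn : Module.finrank ℚ K = n)
    (e : Subgroup.connectedComponentOfOne (BaseTorus K) ≃ₜ* (Fin (n - 1) → Circle)) :
    Nonempty (LinearChart K (n - 1) e) := by
  obtain ⟨l, s, h1, h2, h3⟩ := exists_linear_coordinates hn e
  exact ⟨⟨l, s, l.continuous, s.continuous, l.map_sub, s.map_add, h1, fun w => (h2 w).mp, h3⟩⟩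

namespace LinearChart

variable {d : ℕ} {e : Subgroup.connectedComponentOfOne (BaseTorus K) ≃ₜ* (Fin d → Circle)}
  (χ : LinearChart K d e)

/-- The exponential map to the class torus in linear coordinates. -/
def proj (x : Fin d → ℝ) : ClassTorus q := torusExp q (χ.sec x)

/-- The vectors w and `sec (coord w)` differ by a real multiple of 1, which becomes trivial in the
torus. -/
theorem torusExp_eq_proj (w : mixedEmbedding.mixedSpace K) :
    torusExp q w = χ.proj q (χ.coord w) := by
  obtain ⟨r, hr⟩ := χ.coord_eq_zero (w - χ.sec (χ.coord w))
    (by rw [χ.coord_sub, χ.coord_sec, sub_self])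
  have h1 : w = r • 1 + χ.sec (χ.coord w) := by rw [← hr, sub_add_cancel]
  rw [proj]
  conv_lhs => rw [h1]
  rw [torusExp_add, torusExp_smul_one, one_mul]

theorem continuous_proj : Continuous (χ.proj q) := (continuous_torusExp q).comp χ.continuous_sec

theorem isOpenMap_proj : IsOpenMap (χ.proj q) := by
  intro U hU
  have h1 : χ.proj q '' U = torusExp q '' (χ.coord ⁻¹' U) := by
    ext t
    constructor
    · rintro ⟨x, hx, rfl⟩
      exact ⟨χ.sec x, by rwa [Set.mem_preimage, χ.coord_sec], rfl⟩
    · rintro ⟨w, hw, rfl⟩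
      exact ⟨χ.coord w, hw, (χ.torusExp_eq_proj q w).symm⟩
  rw [h1]
  exact isOpenMap_torusExp q _ (hU.preimage χ.continuous_coord)

theorem proj_add (x y : Fin d → ℝ) : χ.proj q (x + y) = χ.proj q x * χ.proj q y := by
  rw [proj, χ.sec_add, torusExp_add, proj, proj]

theorem mem_iff (t : ClassTorus q) :
    t ∈ Subgroup.connectedComponentOfOne (ClassTorus q) ↔ ∃ x, χ.proj q x = t := by
  rw [mem_connectedComponent_torus_iff]
  constructor
  · rintro ⟨w, rfl⟩
    exact ⟨χ.coord w, (χ.torusExp_eq_proj q w).symm⟩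
  · rintro ⟨x, rfl⟩
    exact ⟨χ.sec x, rfl⟩

theorem torusProj_eq (x : Fin d → ℝ) : torusProj x =
    e ⟨baseExp (χ.sec x), (mem_connectedComponent_base_iff _).mpr ⟨χ.sec x, rfl⟩⟩ := by
  rw [← χ.torusProj_coord, χ.coord_sec]

theorem baseExp_sec (x : Fin d → ℝ) : baseExp (χ.sec x) = (e.symm (torusProj x) : BaseTorus K) := by
  rw [χ.torusProj_eq, e.symm_apply_apply]

theorem covering_proj (x : Fin d → ℝ) (hx : χ.proj q x ∈ Subgroup.connectedComponentOfOne
    (ClassTorus q)) : covering q ⟨χ.proj q x, hx⟩ = (e.symm (torusProj x) : BaseTorus K) := by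
  rw [← χ.baseExp_sec]
  exact covering_torusExp q _ hx

theorem torusProj_eq_one_of_proj {x : Fin d → ℝ} (hx : χ.proj q x = 1) : torusProj x = 1 := by
  have hmem := (χ.mem_iff q _).mpr ⟨x, rfl⟩
  have h1 := χ.covering_proj q x hmem
  have h2 : (⟨χ.proj q x, hmem⟩ : Subgroup.connectedComponentOfOne (ClassTorus q)) = 1 :=
    Subtype.ext hx
  rw [h2, map_one] at h1
  have h3 : e.symm (torusProj x) = 1 := Subtype.ext h1.symm
  rw [← e.apply_symm_apply (torusProj x), h3, map_one]

theorem proj_int_mem (z : Fin d → ℤ) : χ.proj q (fun j => (z j : ℝ)) ∈ finiteImage q := by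
  refine torusExp_mem_finiteImage q ?_
  rw [χ.baseExp_sec, torusProj_eq_one_iff.mpr ⟨z, rfl⟩, map_one]
  rfl

theorem exists_torsion [NeZero q] : ∃ N : ℤ, N ≠ 0 ∧
    ∀ z : Fin d → ℤ, χ.proj q (fun j => ((N * z j : ℤ) : ℝ)) = 1 := by
  have := finite_finiteImage q
  refine ⟨(Nat.card (finiteImage q) : ℤ), by exact_mod_cast Nat.card_pos.ne', fun z => ?_⟩
  have hpow : ∀ m : ℕ, χ.proj q (fun j => (((m : ℤ) * z j : ℤ) : ℝ)) =
      χ.proj q (fun j => (z j : ℝ)) ^ m := by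
    intro m
    induction m with
    | zero =>
      rw [pow_zero, ← map_zero_of_add (χ.proj_add q)]
      congr 1
      funext j
      simp
    | succ m ih =>
      rw [pow_succ, ← ih, ← χ.proj_add]
      congr 1
      funext j
      simp only [Pi.add_apply]
      push_cast
      ring
  rw [hpow]
  exact congrArg Subtype.val (pow_card_eq_one' (x := (⟨_, χ.proj_int_mem q z⟩ : finiteImage q)))

/-- Splitting coordinates into floors and fractional parts exhibits T as a finite union of
translates of the image of [0, 1]^d. -/
theorem compactSpace_classTorus (χ : LinearChart K d e) [NeZero q] : CompactSpace (ClassTorus q) := by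
  obtain ⟨r, hr⟩ := exists_component_representatives q
  have := finite_finiteImage q
  have hcpt : IsCompact (χ.proj q '' Set.Icc 0 1) := isCompact_Icc.image (χ.continuous_proj q)
  have hcov : (⋃ c : (ClassGroup (𝓞 K) × ({w : InfinitePlace K // w.IsReal} → ℤˣ)) × finiteImage q,
      (fun t => (r c.1 * c.2) * t) '' (χ.proj q '' Set.Icc 0 1)) = Set.univ := by
    refine Set.eq_univ_of_forall fun t => ?_
    obtain ⟨c, f, hf, w, rfl⟩ := hr t
    refine Set.mem_iUnion.mpr ⟨(c, ⟨f, hf⟩ * ⟨_, χ.proj_int_mem q fun j => ⌊χ.coord w j⌋⟩),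
      _, ⟨fun j => Int.fract (χ.coord w j),
        ⟨fun j => Int.fract_nonneg _, fun j => (Int.fract_lt_one _).le⟩, rfl⟩, ?_⟩
    rw [torusExp_eq_proj q χ]
    change r c * (f * _) * _ = _
    rw [← mul_assoc, mul_assoc (r c * f), ← χ.proj_add]
    congr 2
    funext j
    exact Int.floor_add_fract _
  refine ⟨?_⟩
  rw [← hcov]
  exact isCompact_iUnion fun c => hcpt.image (continuous_const.mul continuous_id)

theorem exists_characters [NeZero q] {L : ℝ} (hL : 1 ≤ L) :
    ∃ Ξ : Finset (PontryaginDual (ClassTorus q)),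
      (Ξ.card : ℝ) ≤ (4 ^ d * componentBound K * totient q : ℝ) * L ^ d ∧
      ∀ (ψ : PontryaginDual (ClassTorus q)) (ξ : Fin d → ℝ),
        (∀ x, ψ (χ.proj q x) = Circle.exp (2 * Real.pi * ∑ j, x j * ξ j)) →
        (∀ j, |ξ j| ≤ L) → ψ ∈ Ξ := by
  have := finite_finiteImage q
  have := (finite_quotient_sup q).1
  obtain ⟨Ξ, h1, h2⟩ := exists_finset_characters (π := χ.proj q)
    (T₀ := Subgroup.connectedComponentOfOne (ClassTorus q)) (F := finiteImage q)
    (fun t ht => (χ.mem_iff q t).mp ht) (χ.proj_int_mem q) hL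
  refine ⟨Ξ, h1.trans ?_, h2⟩
  have h3 : (Nat.card (finiteImage q) : ℝ) ≤ totient q := by exact_mod_cast card_finiteImage_le q
  have h4 : (Nat.card (ClassTorus q ⧸ (finiteImage q ⊔
      Subgroup.connectedComponentOfOne (ClassTorus q))) : ℝ) ≤ componentBound K := by
    exact_mod_cast (finite_quotient_sup q).2
  calc _ ≤ (totient q : ℝ) * (4 * L) ^ d * componentBound K := by gcongr
    _ = _ := by rw [mul_pow]; ring

end LinearChart

end IdeleTorus

namespace IdeleTorus

universe u

/-! ### Quotient measures -/

section QuotientMeasure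

variable {X Y : Type*} [MeasurableSpace X] [MeasurableSpace Y] {π : X → Y} {hπ : Measurable π}
  {μ : Measure X}

theorem quotientMeasure_le {B : Set Y} {U : Set X} (hB : MeasurableSet B) (hU : MeasurableSet U)
    (h : B ⊆ π '' U) : quotientMeasure π hπ μ B ≤ μ U := by
  rw [quotientMeasure, toMeasure_apply _ _ hB]
  exact (OuterMeasure.ofFunction_le _).trans (iInf_le_of_le U (iInf_le_of_le hU (iInf_le _ h)))

/-- The infimum over U is already countably subadditive: the union of nearly optimal sets for the
members of a cover of B is admissible for B. So the passage to an outer measure loses nothing. -/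
theorem le_quotientMeasure {B : Set Y} (hB : MeasurableSet B) {c : ℝ≥0∞}
    (h : ∀ U, MeasurableSet U → B ⊆ π '' U → c ≤ μ U) : c ≤ quotientMeasure π hπ μ B := by
  rw [quotientMeasure, toMeasure_apply _ _ hB, OuterMeasure.ofFunction_apply]
  refine le_iInf fun t => le_iInf fun ht => ?_
  refine ENNReal.le_of_forall_pos_le_add fun ε hε hfin => ?_
  obtain ⟨ε', hε', hsum⟩ := ENNReal.exists_pos_sum_of_countable'
    (ENNReal.coe_ne_zero.mpr hε.ne') ℕ
  have h1 : ∀ n, ∃ U, MeasurableSet U ∧ t n ⊆ π '' U ∧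
      μ U < (⨅ (U : Set X) (_ : MeasurableSet U) (_ : t n ⊆ π '' U), μ U) + ε' n := by
    intro n
    have h2 := ENNReal.lt_add_right (ENNReal.ne_top_of_tsum_ne_top hfin.ne n) (hε' n).ne'
    obtain ⟨U, hU⟩ := iInf_lt_iff.mp h2
    obtain ⟨hUm, hU⟩ := iInf_lt_iff.mp hU
    obtain ⟨hUt, hU⟩ := iInf_lt_iff.mp hU
    exact ⟨U, hUm, hUt, hU⟩
  choose U hUm hUt hU using h1
  calc c ≤ μ (⋃ n, U n) := by
        refine h _ (MeasurableSet.iUnion hUm) ?_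
        rw [Set.image_iUnion]
        exact ht.trans (Set.iUnion_mono hUt)
    _ ≤ ∑' n, μ (U n) := measure_iUnion_le U
    _ ≤ ∑' n, (_ + ε' n) := ENNReal.tsum_le_tsum fun n => (hU n).le
    _ ≤ _ := by
        rw [ENNReal.tsum_add]
        gcongr

/-- The map τ lifts σ, so the τ-preimage of a set covering B has the same measure and covers the
σ-preimage of B. -/
theorem quotientMeasure_preimage_le {σ : Y → Y} (hσ : Measurable σ) (hσi : Function.Injective σ)
    {τ : X → X} (hτ : MeasurePreserving τ μ μ) (hτs : Function.Surjective τ)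
    (hcomm : ∀ x, π (τ x) = σ (π x)) {B : Set Y} (hB : MeasurableSet B) :
    quotientMeasure π hπ μ (σ ⁻¹' B) ≤ quotientMeasure π hπ μ B := by
  refine le_quotientMeasure hB fun U hU hBU => ?_
  rw [← hτ.measure_preimage hU.nullMeasurableSet]
  refine quotientMeasure_le (hσ hB) (hτ.measurable hU) fun y hy => ?_
  obtain ⟨u, hu, huy⟩ := hBU hy
  obtain ⟨x, rfl⟩ := hτs u
  exact ⟨x, hu, hσi (by rw [← hcomm, huy])⟩

/-- Unfolding: a set U mapping onto Y meets every orbit, so its translates cover O; moving the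
pieces back by `τ'` gives disjoint parts of U, because π is injective on O and the action is free.
-/
theorem measure_le_quotientMeasure_univ [SFinite μ] {Γ : Type*} {τ τ' : Γ → X → X}
    (hτ : ∀ γ, MeasurePreserving (τ γ) μ μ) (hτ' : ∀ γ, MeasurePreserving (τ' γ) μ μ)
    (hinv : ∀ γ x, τ γ (τ' γ x) = x) (hπτ : ∀ γ x, π (τ' γ x) = π x)
    (hfree : ∀ γ γ' x, τ' γ x = τ' γ' x → γ = γ')
    (htrans : ∀ x x', π x = π x' → ∃ γ, τ γ x = x')
    {O : Set X} (hO : MeasurableSet O) (hO0 : μ O ≠ 0) (hinj : Set.InjOn π O) :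
    μ O ≤ quotientMeasure π hπ μ Set.univ := by
  have hdisj : Pairwise (Function.onFun Disjoint fun γ => τ' γ ⁻¹' O) := by
    intro γ γ' hne
    refine Set.disjoint_left.mpr fun x hx hx' => hne (hfree γ γ' x ?_)
    exact hinj hx hx' (by rw [hπτ, hπτ])
  -- The translates of O are disjoint of equal positive measure, so s-finiteness of μ allows only
  -- countably many.
  have hcount : Countable Γ := by
    have h1 := Measure.countable_meas_pos_of_disjoint_iUnion (μ := μ)
      (fun γ => (hτ' γ).measurable hO) hdisj
    have h2 : {γ | 0 < μ (τ' γ ⁻¹' O)} = Set.univ := by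
      refine Set.eq_univ_of_forall fun γ => ?_
      rw [Set.mem_ofPred_eq, (hτ' γ).measure_preimage hO.nullMeasurableSet]
      exact pos_iff_ne_zero.mpr hO0
    rw [h2] at h1
    exact Set.countable_univ_iff.mp h1
  refine le_quotientMeasure MeasurableSet.univ fun U hU hUs => ?_
  have hcov : O ⊆ ⋃ γ, O ∩ τ γ ⁻¹' U := by
    intro x hx
    obtain ⟨u, hu, hux⟩ := hUs (Set.mem_univ (π x))
    obtain ⟨γ, rfl⟩ := htrans x u hux.symm
    exact Set.mem_iUnion.mpr ⟨γ, hx, hu⟩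
  calc μ O ≤ μ (⋃ γ, O ∩ τ γ ⁻¹' U) := measure_mono hcov
    _ ≤ ∑' γ, μ (O ∩ τ γ ⁻¹' U) := measure_iUnion_le _
    _ = ∑' γ, μ (τ' γ ⁻¹' O ∩ U) := by
        refine tsum_congr fun γ => ?_
        rw [← (hτ' γ).measure_preimage
          (hO.inter ((hτ γ).measurable hU)).nullMeasurableSet]
        congr 1
        ext x
        simp only [Set.mem_preimage, Set.mem_inter_iff, hinv]
    _ = μ (⋃ γ, τ' γ ⁻¹' O ∩ U) := by
        refine (measure_iUnion (fun γ γ' hne => ?_)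
          fun γ => ((hτ' γ).measurable hO).inter hU).symm
        exact (hdisj hne).mono Set.inter_subset_left Set.inter_subset_left
    _ ≤ μ U := measure_mono (Set.iUnion_subset fun γ => Set.inter_subset_right)

end QuotientMeasure

/-! ### Translations of the coordinate space -/

instance discreteMeasurableSpace_intUnits : DiscreteMeasurableSpace ℤˣ :=
  ⟨fun s => ⟨(fun u : ℤˣ => (u : ℤ)) '' s, trivial, Units.val_injective.preimage_image s⟩⟩

theorem measurePreserving_count {α : Type*} [MeasurableSpace α] [DiscreteMeasurableSpace α]
    (e : α ≃ α) : MeasurePreserving e Measure.count Measure.count := by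
  refine ⟨Measurable.of_discrete, Measure.ext fun s hs => ?_⟩
  rw [Measure.map_apply Measurable.of_discrete hs, Measure.count_apply MeasurableSet.of_discrete,
    Measure.count_apply hs, ← e.image_symm_eq_preimage, e.symm.injective.encard_image]

variable {K : Type u} [Field K] [NumberField K] (q : Ideal (𝓞 K))

instance discreteMeasurableSpace_finitePart : DiscreteMeasurableSpace (FinitePart q) :=
  ⟨fun _ => trivial⟩

instance instCountableFinitePart [NeZero q] : Countable (FinitePart q) := countable_finitePart q

instance sFinite_archMeasure : SFinite (archMeasure K) := by
  unfold archMeasure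
  infer_instance

instance isFiniteMeasureOnCompacts_archMeasure : IsFiniteMeasureOnCompacts (archMeasure K) := by
  unfold archMeasure
  infer_instance

variable {q}

/-- Translation on `(K ⊗_ℚ ℝ)ˣ/ℝ_{>0}` in coordinates. -/
def archShift (a b : ArchCoord K) : ArchCoord K := (a.1 + b.1, a.2.1 + b.2.1, a.2.2 * b.2.2)

/-- Inversion on `(K ⊗_ℚ ℝ)ˣ/ℝ_{>0}` in coordinates. -/
def archInv (a : ArchCoord K) : ArchCoord K := (-a.1, -a.2.1, a.2.2⁻¹)

theorem archPoint_fst (a : ArchCoord K) (w : {w : InfinitePlace K // w.IsReal}) :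
    (archPoint K a : mixedEmbedding.mixedSpace K).1 w =
      ((a.2.2 w : ℤ) : ℝ) * Real.exp ((a.1 : EuclideanSpace ℝ _) w.1) := rfl

theorem archPoint_snd (a : ArchCoord K) (w : {w : InfinitePlace K // w.IsComplex}) :
    (archPoint K a : mixedEmbedding.mixedSpace K).2 w =
      ((a.2.1 w).toCircle : ℂ) * (Real.exp ((a.1 : EuclideanSpace ℝ _) w.1 / 2) : ℂ) := rfl

theorem archPoint_shift (a b : ArchCoord K) :
    archPoint K (archShift a b) = archPoint K a * archPoint K b := by
  ext w
  · rw [Units.val_mul, Prod.fst_mul, Pi.mul_apply]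
    simp only [archPoint_fst]
    change (((a.2.2 w * b.2.2 w : ℤˣ) : ℤ) : ℝ) *
      Real.exp ((a.1 : EuclideanSpace ℝ _) w.1 + (b.1 : EuclideanSpace ℝ _) w.1) = _
    rw [Real.exp_add]
    push_cast
    ring
  · rw [Units.val_mul, Prod.snd_mul, Pi.mul_apply]
    simp only [archPoint_snd]
    change ((a.2.1 w + b.2.1 w).toCircle : ℂ) *
      (Real.exp (((a.1 : EuclideanSpace ℝ _) w.1 + (b.1 : EuclideanSpace ℝ _) w.1) / 2) : ℂ) = _
    rw [AddCircle.toCircle_add, add_div, Real.exp_add]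
    push_cast
    ring

theorem measurePreserving_archShift (a : ArchCoord K) :
    MeasurePreserving (archShift a) (archMeasure K) (archMeasure K) := by
  classical
  unfold archMeasure
  exact (measurePreserving_add_left _ a.1).prod
    ((measurePreserving_add_left _ a.2.1).prod (measurePreserving_count (Equiv.mulLeft a.2.2)))

/-- Translation on the coordinate space. -/
def shift (a b : ArchCoord K × FinitePart q) : ArchCoord K × FinitePart q :=
  (archShift a.1 b.1, a.2 * b.2)

/-- Inversion on the coordinate space. -/
def shiftInv (a : ArchCoord K × FinitePart q) : ArchCoord K × FinitePart q :=
  (archInv a.1, a.2⁻¹)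

theorem measurePreserving_shift [NeZero q] (a : ArchCoord K × FinitePart q) :
    MeasurePreserving (shift a) ((archMeasure K).prod Measure.count)
      ((archMeasure K).prod Measure.count) :=
  (measurePreserving_archShift a.1).prod (measurePreserving_count (Equiv.mulLeft a.2))

theorem shift_shiftInv (a b : ArchCoord K × FinitePart q) : shift a (shift (shiftInv a) b) = b := by
  refine Prod.ext (Prod.ext ?_ (Prod.ext ?_ ?_)) ?_
  · exact add_neg_cancel_left _ _
  · exact add_neg_cancel_left _ _
  · exact mul_inv_cancel_left _ _
  · exact mul_inv_cancel_left _ _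

theorem shift_shiftInv_self (a b : ArchCoord K × FinitePart q) :
    shift (shift b (shiftInv a)) a = b := by
  refine Prod.ext (Prod.ext ?_ (Prod.ext ?_ ?_)) ?_
  · exact neg_add_cancel_right _ _
  · exact neg_add_cancel_right _ _
  · exact inv_mul_cancel_right _ _
  · exact inv_mul_cancel_right _ _

theorem shift_right_cancel {a b c : ArchCoord K × FinitePart q} (h : shift a c = shift b c) :
    a = b := by
  refine Prod.ext (Prod.ext ?_ (Prod.ext ?_ ?_)) ?_
  · exact add_right_cancel (congrArg (fun x => x.1.1) h)
  · exact add_right_cancel (congrArg (fun x => x.1.2.1) h)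
  · exact mul_right_cancel (congrArg (fun x => x.1.2.2) h)
  · exact mul_right_cancel (congrArg (fun x => x.2) h)

theorem shiftInv_injective : Function.Injective (shiftInv (q := q)) := by
  intro a b h
  refine Prod.ext (Prod.ext ?_ (Prod.ext ?_ ?_)) ?_
  · exact neg_injective (congrArg (fun x => x.1.1) h)
  · exact neg_injective (congrArg (fun x => x.1.2.1) h)
  · exact inv_injective (congrArg (fun x => x.1.2.2) h)
  · exact inv_injective (congrArg (fun x => x.2) h)

theorem coordToTorus_shift (a b : ArchCoord K × FinitePart q) :
    coordToTorus q (shift a b) = coordToTorus q a * coordToTorus q b := by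
  rw [coordToTorus, coordToTorus, coordToTorus, ← map_mul]
  congr 1
  exact Prod.ext (archPoint_shift a.1 b.1) rfl

theorem coordToTorus_shiftInv (a : ArchCoord K × FinitePart q) :
    coordToTorus q (shiftInv a) = (coordToTorus q a)⁻¹ := by
  have h1 := coordToTorus_shift a (shift (shiftInv a) a)
  rw [shift_shiftInv, coordToTorus_shift] at h1
  exact eq_inv_of_mul_eq_one_left (mul_eq_left.mp h1.symm)

end IdeleTorus

namespace IdeleTorus

universe u

/-! ### Polar coordinates -/

variable {K : Type u} [Field K] [NumberField K]

/-- The trace of the real part at an infinite place. -/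
def placeTrace (w : mixedEmbedding.mixedSpace K) (v : InfinitePlace K) : ℝ :=
  open scoped Classical in
  if hv : v.IsReal then w.1 ⟨v, hv⟩ else 2 * (w.2 ⟨v, InfinitePlace.not_isReal_iff_isComplex.mp hv⟩).re

theorem placeTrace_real (w : mixedEmbedding.mixedSpace K) (v : {v : InfinitePlace K // v.IsReal}) :
    placeTrace w v.1 = w.1 v := dif_pos v.2

theorem placeTrace_complex (w : mixedEmbedding.mixedSpace K)
    (v : {v : InfinitePlace K // v.IsComplex}) : placeTrace w v.1 = 2 * (w.2 v).re :=
  dif_neg (InfinitePlace.not_isReal_iff_isComplex.mpr v.2)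

theorem continuous_placeTrace (v : InfinitePlace K) :
    Continuous fun w : mixedEmbedding.mixedSpace K => placeTrace w v := by
  by_cases hv : v.IsReal
  · simp only [placeTrace, dif_pos hv]
    fun_prop
  · simp only [placeTrace, dif_neg hv]
    fun_prop

/-- The normalized trace. -/
def meanTrace (w : mixedEmbedding.mixedSpace K) : ℝ :=
  (∑ v, placeTrace w v) / Module.finrank ℚ K

theorem mem_traceZero_iff (x : EuclideanSpace ℝ (InfinitePlace K)) :
    x ∈ traceZero K ↔ ∑ v, x v = 0 := by
  rw [traceZero, LinearMap.mem_ker, LinearMap.sum_apply]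
  rfl

theorem sum_mult_mul (r : ℝ) :
    ∑ v : InfinitePlace K, (v.mult : ℝ) * r = Module.finrank ℚ K * r := by
  rw [← Finset.sum_mul, ← Nat.cast_sum, InfinitePlace.sum_mult_eq]

/-- The projection to the hyperplane of trace zero. -/
def traceFree (w : mixedEmbedding.mixedSpace K) : traceZero K :=
  -- Removing the scalar `meanTrace w` changes the coordinate at v by `v.mult` times that scalar,
  -- and the multiplicities add up to n.
  ⟨WithLp.toLp 2 fun v => placeTrace w v - v.mult * meanTrace w, by
    rw [mem_traceZero_iff]
    change ∑ v : InfinitePlace K, (placeTrace w v - v.mult * meanTrace w) = 0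
    have h0 : (Module.finrank ℚ K : ℝ) ≠ 0 := by exact_mod_cast Module.finrank_pos.ne'
    rw [Finset.sum_sub_distrib, sum_mult_mul, meanTrace, mul_div_cancel₀ _ h0, sub_self]⟩

theorem continuous_traceFree : Continuous (traceFree (K := K)) := by
  refine Continuous.subtype_mk ?_ _
  refine (PiLp.continuous_toLp 2 _).comp (continuous_pi fun v => ?_)
  refine (continuous_placeTrace v).sub (continuous_const.mul ?_)
  exact (continuous_finsetSum _ fun v _ => continuous_placeTrace v).div_const _

/-- The element of `K ⊗_ℚ ℝ` with given logarithmic coordinates. -/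
def logArch (h : traceZero K) (θ : {v : InfinitePlace K // v.IsComplex} → ℝ) :
    mixedEmbedding.mixedSpace K :=
  (fun v => (h : EuclideanSpace ℝ (InfinitePlace K)) v.1,
    fun v => ⟨(h : EuclideanSpace ℝ (InfinitePlace K)) v.1 / 2, θ v⟩)

theorem archExp_logArch (h : traceZero K) (θ : {v : InfinitePlace K // v.IsComplex} → ℝ) :
    archExp K (logArch h θ) = archPoint K (h, fun v => (θ v : AddCircle (2 * Real.pi)), 1) := by
  ext v
  · rw [archExp_fst, archPoint_fst]
    simp [logArch]
  · rw [archExp_snd, archPoint_snd]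
    change Complex.exp ⟨_, _⟩ = _
    rw [AddCircle.toCircle_apply_mk, Circle.coe_exp, Complex.ofReal_exp, ← Complex.exp_add]
    congr 1
    apply Complex.ext
    · simp
    · simp

theorem logArch_traceFree (w : mixedEmbedding.mixedSpace K) :
    logArch (traceFree w) (fun v => (w.2 v).im) + meanTrace w • (1 : mixedEmbedding.mixedSpace K) =
      w := by
  refine Prod.ext (funext fun v => ?_) (funext fun v => ?_)
  · change placeTrace w v.1 - v.1.mult * meanTrace w + meanTrace w * 1 = w.1 v
    rw [placeTrace_real, InfinitePlace.mult_isReal]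
    push_cast
    ring
  · change (⟨(placeTrace w v.1 - v.1.mult * meanTrace w) / 2, (w.2 v).im⟩ : ℂ) +
      meanTrace w • (1 : ℂ) = w.2 v
    rw [placeTrace_complex, InfinitePlace.mult_isComplex]
    apply Complex.ext
    · simp
      ring
    · simp

/-- The coordinates of the exponential of an element of `K ⊗_ℚ ℝ`. -/
def logCoord (w : mixedEmbedding.mixedSpace K) : ArchCoord K :=
  (traceFree w, fun v => ((w.2 v).im : AddCircle (2 * Real.pi)), 1)

theorem continuous_logCoord : Continuous (logCoord (K := K)) := by
  refine continuous_traceFree.prodMk (Continuous.prodMk (continuous_pi fun v => ?_)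
    continuous_const)
  exact (AddCircle.continuous_mk' _).comp
    (Complex.continuous_im.comp ((continuous_apply v).comp continuous_snd))

theorem exists_archExp_eq (w : mixedEmbedding.mixedSpace K) :
    ∃ p, archExp K w = archPoint K (logCoord w) * posReal K p := by
  obtain ⟨p, hp⟩ := archExp_smul_one (K := K) (meanTrace w)
  refine ⟨p, ?_⟩
  conv_lhs => rw [← logArch_traceFree w]
  rw [archExp_add, hp, archExp_logArch]
  rfl

variable (q : Ideal (𝓞 K))

theorem coordToTorus_logCoord (w : mixedEmbedding.mixedSpace K) :
    coordToTorus q (logCoord w, 1) = torusExp q w := by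
  obtain ⟨p, hp⟩ := exists_archExp_eq w
  have h1 : ((archExp K w, 1) : PreClassGroup q) =
      (archPoint K (logCoord w), 1) * (posReal K p, 1) := by
    rw [hp, Prod.mk_mul_mk, mul_one]
  rw [torusExp, h1, map_mul, toTorus_posReal, mul_one, coordToTorus]

theorem coordToTorus_surjective : Function.Surjective (coordToTorus q) := by
  intro t
  obtain ⟨⟨y, α⟩, rfl⟩ := toTorus_surjective q t
  obtain ⟨σ, w, rfl⟩ := exists_eq_archSign_mul_archExp y
  refine ⟨shift ((0, 0, σ), α) (logCoord w, 1), ?_⟩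
  rw [coordToTorus_shift, coordToTorus_logCoord, torusExp]
  change toTorus q (archSign K σ, α) * _ = _
  rw [← map_mul, Prod.mk_mul_mk, mul_one]

/-! ### The measure on the torus -/

theorem measurable_mul_left (g : ClassTorus q) : Measurable (g * ·) :=
  (continuous_const.mul continuous_id).measurable

theorem ideleMeasure_preimage_le [NeZero q] (g : ClassTorus q) {B : Set (ClassTorus q)}
    (hB : MeasurableSet B) :
    ideleMeasure q ((g * ·) ⁻¹' B) ≤ ideleMeasure q B := by
  obtain ⟨a, rfl⟩ := coordToTorus_surjective q g
  exact quotientMeasure_preimage_le (measurable_mul_left q _) (mul_right_injective _)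
    (measurePreserving_shift a) (fun b => ⟨_, shift_shiftInv a b⟩) (coordToTorus_shift a) hB

instance isMulLeftInvariant_ideleMeasure [NeZero q] : (ideleMeasure q).IsMulLeftInvariant := by
  refine ⟨fun g => Measure.ext fun B hB => ?_⟩
  rw [Measure.map_apply (measurable_mul_left q g) hB]
  refine le_antisymm (ideleMeasure_preimage_le q g hB) ?_
  -- The inequality for the inverse element gives the reverse inequality.
  have h1 := ideleMeasure_preimage_le q g⁻¹ (measurable_mul_left q g hB)
  rwa [← Set.preimage_comp, show ((g * ·) ∘ (g⁻¹ * ·)) = (id : ClassTorus q → ClassTorus q) from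
    funext fun x => mul_inv_cancel_left g x, Set.preimage_id] at h1

theorem continuous_logArch : Continuous fun a : traceZero K ×
    ({v : InfinitePlace K // v.IsComplex} → ℝ) => logArch a.1 a.2 := by
  have hH : ∀ v : InfinitePlace K, Continuous fun a : traceZero K ×
      ({v : InfinitePlace K // v.IsComplex} → ℝ) =>
        (a.1 : EuclideanSpace ℝ (InfinitePlace K)) v := fun v =>
    (EuclideanSpace.proj (𝕜 := ℝ) v).continuous.comp
      (continuous_subtype_val.comp continuous_fst)
  refine Continuous.prodMk (continuous_pi fun v => hH v.1) (continuous_pi fun v => ?_)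
  exact Complex.equivRealProdCLM.symm.continuous.comp
    (((hH v.1).div_const 2).prodMk ((continuous_apply v).comp continuous_snd))

/-- Summing the coordinates of the difference gives nr = 0, since both elements have trace zero. -/
theorem logArch_eq_of_sub {h h' : traceZero K} {θ θ' : {v : InfinitePlace K // v.IsComplex} → ℝ}
    {r : ℝ} (hr : logArch h θ - logArch h' θ' = r • (1 : mixedEmbedding.mixedSpace K)) :
    h = h' ∧ θ = θ' := by
  have h1 : ∀ v : InfinitePlace K, (h : EuclideanSpace ℝ (InfinitePlace K)) v -
      (h' : EuclideanSpace ℝ (InfinitePlace K)) v = v.mult * r := by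
    intro v
    by_cases hv : v.IsReal
    · have h2 : (h : EuclideanSpace ℝ (InfinitePlace K)) v -
        (h' : EuclideanSpace ℝ (InfinitePlace K)) v = r * 1 :=
        congrFun (congrArg Prod.fst hr) ⟨v, hv⟩
      rw [h2, InfinitePlace.mult, if_pos hv]
      push_cast
      ring
    · have hv' := InfinitePlace.not_isReal_iff_isComplex.mp hv
      have h2 : (⟨(h : EuclideanSpace ℝ (InfinitePlace K)) v / 2, θ ⟨v, hv'⟩⟩ : ℂ) -
        ⟨(h' : EuclideanSpace ℝ (InfinitePlace K)) v / 2, θ' ⟨v, hv'⟩⟩ = r • (1 : ℂ) :=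
        congrFun (congrArg Prod.snd hr) ⟨v, hv'⟩
      have h3 := congrArg Complex.re h2
      simp only [Complex.sub_re, Complex.real_smul, mul_one, Complex.ofReal_re] at h3
      rw [InfinitePlace.mult, if_neg hv]
      push_cast
      linarith
  have h0 : (Module.finrank ℚ K : ℝ) ≠ 0 := by exact_mod_cast Module.finrank_pos.ne'
  have hr0 : r = 0 := by
    have h2 := Finset.sum_congr (s₁ := Finset.univ) rfl fun v _ => h1 v
    rw [sum_mult_mul, Finset.sum_sub_distrib, (mem_traceZero_iff _).mp h.2,
      (mem_traceZero_iff _).mp h'.2, sub_zero] at h2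
    exact (mul_eq_zero.mp h2.symm).resolve_left h0
  constructor
  · refine Subtype.ext (PiLp.ext fun v => ?_)
    have h2 := h1 v
    rw [hr0, mul_zero] at h2
    exact sub_eq_zero.mp h2
  · funext v
    have h2 : (⟨(h : EuclideanSpace ℝ (InfinitePlace K)) v.1 / 2, θ v⟩ : ℂ) -
      ⟨(h' : EuclideanSpace ℝ (InfinitePlace K)) v.1 / 2, θ' v⟩ = r • (1 : ℂ) :=
      congrFun (congrArg Prod.snd hr) v
    have h3 := congrArg Complex.im h2
    simp only [Complex.sub_im, hr0, zero_smul, Complex.zero_im] at h3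
    exact sub_eq_zero.mp h3

theorem archMeasure_box_ne_zero {η : ℝ} (hη : 0 < η) :
    archMeasure K (Metric.ball 0 η ×ˢ ((Set.univ.pi fun _ => Metric.ball 0 η) ×ˢ {1})) ≠ 0 := by
  classical
  rw [archMeasure, Measure.prod_prod, Measure.prod_prod, Measure.pi_pi]
  refine mul_ne_zero (Metric.measure_ball_pos _ _ hη).ne'
    (mul_ne_zero (Finset.prod_ne_zero_iff.mpr fun v _ => ?_) ?_)
  · exact (Metric.measure_ball_pos _ _ hη).ne'
  · rw [Measure.count_singleton]
    exact one_ne_zero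

instance opensMeasurableSpace_archCoord : OpensMeasurableSpace (ArchCoord K) := by
  have : OpensMeasurableSpace ({w : InfinitePlace K // w.IsReal} → ℤˣ) :=
    ⟨MeasurableSpace.generateFrom_le fun s _ => MeasurableSet.of_discrete⟩
  have : OpensMeasurableSpace (({w : InfinitePlace K // w.IsComplex} → AddCircle (2 * Real.pi)) ×
      ({w : InfinitePlace K // w.IsReal} → ℤˣ)) := Prod.opensMeasurableSpace
  exact Prod.opensMeasurableSpace

/-! ### Finiteness, positivity and uniform volume bounds for the measure -/

namespace LinearChart

variable {d : ℕ} {e : Subgroup.connectedComponentOfOne (BaseTorus K) ≃ₜ* (Fin d → Circle)}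
  (χ : LinearChart K d e)

theorem exists_int_of_proj {x : Fin d → ℝ} (hx : χ.proj q x = 1) :
    ∃ z : Fin d → ℤ, x = fun j => (z j : ℝ) :=
  torusProj_eq_one_iff.mp (χ.torusProj_eq_one_of_proj q hx)

/-- A small box in logarithmic coordinates goes into the cube on which π is injective, so two of its
points with equal image differ by a scalar, which the trace condition forces to be 0. -/
theorem exists_box_injOn (χ : LinearChart K d e) : ∃ η > 0, Set.InjOn (coordToTorus q)
    ((Metric.ball 0 η ×ˢ ((Set.univ.pi fun _ => Metric.ball 0 η) ×ˢ {1})) ×ˢ {1}) := by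
  classical
  have hc : Continuous fun a : traceZero K × ({v : InfinitePlace K // v.IsComplex} → ℝ) =>
      χ.coord (logArch a.1 a.2) := χ.continuous_coord.comp continuous_logArch
  have h0 : χ.coord (logArch 0 0) = 0 := by
    have h1 : logArch (0 : traceZero K) 0 = 0 - 0 := by
      rw [sub_zero]
      refine Prod.ext (funext fun v => rfl) (funext fun v => ?_)
      change (⟨(0 : ℝ) / 2, 0⟩ : ℂ) = 0
      rw [zero_div]
      rfl
    rw [h1, χ.coord_sub, sub_self]
  have hnhds : (fun a : traceZero K × ({v : InfinitePlace K // v.IsComplex} → ℝ) =>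
      χ.coord (logArch a.1 a.2)) ⁻¹' Metric.ball 0 (1 / 2) ∈ nhds 0 := by
    refine (Metric.isOpen_ball.preimage hc).mem_nhds ?_
    change χ.coord (logArch 0 0) ∈ Metric.ball 0 (1 / 2)
    rw [h0]
    exact Metric.mem_ball_self (by norm_num)
  obtain ⟨η, hη, hηb⟩ := Metric.mem_nhds_iff
    (α := traceZero K × ({v : InfinitePlace K // v.IsComplex} → ℝ)).mp hnhds
  have hlift : ∀ t ∈ (Set.univ.pi fun _ => Metric.ball 0 η :
      Set ({v : InfinitePlace K // v.IsComplex} → AddCircle (2 * Real.pi))),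
      ∃ θ : {v : InfinitePlace K // v.IsComplex} → ℝ,
        (fun v => (θ v : AddCircle (2 * Real.pi))) = t ∧ ‖θ‖ < η := by
    intro t ht
    choose θ hθ hθη using fun v => QuotientAddGroup.norm_lt_iff.mp
      (mem_ball_zero_iff.mp (ht v (Set.mem_univ v)))
    exact ⟨θ, funext hθ, (pi_norm_lt_iff hη).mpr hθη⟩
  refine ⟨η, hη, ?_⟩
  rintro ⟨⟨h, t, σ⟩, α⟩ ⟨⟨hh, ht, hσ⟩, hα⟩ ⟨⟨h', t', σ'⟩, α'⟩ ⟨⟨hh', ht', hσ'⟩, hα'⟩ heq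
  obtain ⟨θ, rfl, hθ⟩ := hlift t ht
  obtain ⟨θ', rfl, hθ'⟩ := hlift t' ht'
  obtain rfl : σ = 1 := hσ
  obtain rfl : σ' = 1 := hσ'
  obtain rfl : α = 1 := hα
  obtain rfl : α' = 1 := hα'
  rw [coordToTorus, coordToTorus, ← archExp_logArch, ← archExp_logArch] at heq
  change torusExp q _ = torusExp q _ at heq
  rw [torusExp_eq_proj q χ, torusExp_eq_proj q χ] at heq
  have hmem : ∀ (h : traceZero K) (θ : {v : InfinitePlace K // v.IsComplex} → ℝ),
      h ∈ Metric.ball 0 η → ‖θ‖ < η → χ.coord (logArch h θ) ∈ Metric.ball 0 (1 / 2) := by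
    intro h θ hh hθ
    refine hηb (a := (h, θ)) (mem_ball_zero_iff.mpr ?_)
    exact max_lt (mem_ball_zero_iff.mp hh) hθ
  have h1 := injOn_ball_of_kernel (χ.proj_add q) (fun x hx => χ.exists_int_of_proj q hx)
    (hmem h θ hh hθ) (hmem h' θ' hh' hθ') heq
  obtain ⟨r, hr⟩ := χ.coord_eq_zero (logArch h θ - logArch h' θ')
    (by rw [χ.coord_sub, h1, sub_self])
  obtain ⟨rfl, rfl⟩ := logArch_eq_of_sub hr
  rfl

theorem ideleMeasure_univ_ne_zero (χ : LinearChart K d e) [NeZero q] :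
    ideleMeasure q Set.univ ≠ 0 := by
  obtain ⟨η, hη, hinj⟩ := χ.exists_box_injOn q
  have hbox : ((archMeasure K).prod Measure.count) ((Metric.ball 0 η ×ˢ
      ((Set.univ.pi fun _ => Metric.ball 0 η) ×ˢ {1})) ×ˢ {(1 : FinitePart q)}) ≠ 0 := by
    rw [Measure.prod_prod, Measure.count_singleton, mul_one]
    exact archMeasure_box_ne_zero hη
  have hmeas : MeasurableSet ((Metric.ball (0 : traceZero K) η ×ˢ
      ((Set.univ.pi fun _ : {v : InfinitePlace K // v.IsComplex} =>
        Metric.ball (0 : AddCircle (2 * Real.pi)) η) ×ˢ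
      {(1 : {w : InfinitePlace K // w.IsReal} → ℤˣ)})) ×ˢ {(1 : FinitePart q)}) :=
    (measurableSet_ball.prod ((MeasurableSet.univ_pi fun _ => measurableSet_ball).prod
      (measurableSet_singleton _))).prod (measurableSet_singleton _)
  refine ne_of_gt (lt_of_lt_of_le (pos_iff_ne_zero.mpr hbox) ?_)
  have hone : ∀ γ : {a : ArchCoord K × FinitePart q // coordToTorus q a = 1},
      coordToTorus q (shiftInv γ.1) = 1 := fun γ => by
    rw [coordToTorus_shiftInv, γ.2, inv_one]
  -- The acting group is the kernel of `coordToTorus`, by translation; its orbits are the fibres.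
  refine measure_le_quotientMeasure_univ
    (Γ := {a : ArchCoord K × FinitePart q // coordToTorus q a = 1})
    (τ := fun γ => shift γ.1) (τ' := fun γ => shift (shiftInv γ.1))
    (fun γ => measurePreserving_shift γ.1) (fun γ => measurePreserving_shift _)
    (fun γ x => shift_shiftInv γ.1 x) (fun γ x => ?_) (fun γ γ' x hx => ?_)
    (fun x x' hx => ?_) hmeas hbox hinj
  · rw [coordToTorus_shift, hone, one_mul]
  · exact Subtype.ext (shiftInv_injective (shift_right_cancel hx))
  · refine ⟨⟨shift x' (shiftInv x), ?_⟩, shift_shiftInv_self x x'⟩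
    rw [coordToTorus_shift, coordToTorus_shiftInv, hx, mul_inv_cancel]

/-- A bound for the volume of the image of the ball of radius two. -/
def boxBound : ℝ≥0∞ := archMeasure K ((fun x => logCoord (χ.sec x)) '' Metric.closedBall 0 2)

theorem isCompact_image_closedBall :
    IsCompact ((fun x => logCoord (χ.sec x)) '' Metric.closedBall 0 2) :=
  (isCompact_closedBall 0 2).image (continuous_logCoord.comp χ.continuous_sec)

theorem boxBound_lt_top : χ.boxBound < ⊤ := χ.isCompact_image_closedBall.measure_lt_top

theorem ideleMeasure_image_ball_le [NeZero q] :
    ideleMeasure q (χ.proj q '' Metric.ball 0 2) ≤ χ.boxBound := by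
  have h1 : ideleMeasure q (χ.proj q '' Metric.ball 0 2) ≤
      ((archMeasure K).prod Measure.count)
        (((fun x => logCoord (χ.sec x)) '' Metric.closedBall 0 2) ×ˢ {(1 : FinitePart q)}) := by
    refine quotientMeasure_le ((χ.isOpenMap_proj q) _ Metric.isOpen_ball).measurableSet
      (χ.isCompact_image_closedBall.measurableSet.prod (measurableSet_singleton _)) ?_
    rintro _ ⟨x, hx, rfl⟩
    exact ⟨(_, 1), ⟨⟨x, Metric.ball_subset_closedBall hx, rfl⟩, Set.mem_singleton _⟩,
      coordToTorus_logCoord q (χ.sec x)⟩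
  rwa [Measure.prod_prod, Measure.count_singleton, mul_one] at h1

theorem fract_mem_ball (x : Fin d → ℝ) : (fun j => Int.fract (x j)) ∈ Metric.ball 0 2 := by
  rw [mem_ball_zero_iff, pi_norm_lt_iff (by norm_num)]
  intro j
  rw [Real.norm_of_nonneg (Int.fract_nonneg _)]
  exact (Int.fract_lt_one _).trans (by norm_num)

theorem isFiniteMeasure_ideleMeasure (χ : LinearChart K d e) [NeZero q] :
    IsFiniteMeasure (ideleMeasure q) := by
  obtain ⟨r, hr⟩ := exists_component_representatives q
  have := finite_finiteImage q
  have := Fintype.ofFinite ((ClassGroup (𝓞 K) × ({w : InfinitePlace K // w.IsReal} → ℤˣ)) ×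
    finiteImage q)
  have hcov : (Set.univ : Set (ClassTorus q)) ⊆
      ⋃ c : (ClassGroup (𝓞 K) × ({w : InfinitePlace K // w.IsReal} → ℤˣ)) × finiteImage q,
      ((r c.1 * c.2)⁻¹ * ·) ⁻¹' (χ.proj q '' Metric.ball 0 2) := by
    intro t _
    obtain ⟨c, f, hf, w, rfl⟩ := hr t
    refine Set.mem_iUnion.mpr ⟨(c, ⟨f, hf⟩ * ⟨_, χ.proj_int_mem q fun j => ⌊χ.coord w j⌋⟩),
      fun j => Int.fract (χ.coord w j), fract_mem_ball _, ?_⟩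
    rw [torusExp_eq_proj q χ]
    change _ = (r c * (f * _))⁻¹ * _
    rw [eq_inv_mul_iff_mul_eq, ← mul_assoc, mul_assoc (r c * f), ← χ.proj_add]
    congr 2
    funext j
    exact Int.floor_add_fract _
  refine ⟨(measure_mono hcov).trans_lt ((measure_iUnion_fintype_le _ _).trans_lt ?_)⟩
  refine ENNReal.sum_lt_top.mpr fun c _ => ?_
  rw [measure_preimage_mul]
  exact (χ.ideleMeasure_image_ball_le q).trans_lt χ.boxBound_lt_top

/-- The kernel of the covering map. -/
def coveringKernel : Subgroup (ClassTorus q) :=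
  (covering q).ker.map (Subgroup.connectedComponentOfOne (ClassTorus q)).subtype

theorem mem_coveringKernel_iff (t : ClassTorus q) :
    t ∈ coveringKernel q ↔ ∃ z : Fin d → ℤ, χ.proj q (fun j => (z j : ℝ)) = t := by
  constructor
  · rintro ⟨⟨t, ht⟩, hker, rfl⟩
    obtain ⟨x, rfl⟩ := (χ.mem_iff q _).mp ht
    have h1 : covering q ⟨χ.proj q x, ht⟩ = 1 := hker
    rw [χ.covering_proj] at h1
    have h3 : e.symm (torusProj x) = 1 := Subtype.ext h1
    obtain ⟨z, rfl⟩ := torusProj_eq_one_iff.mp (show torusProj x = 1 by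
      rw [← e.apply_symm_apply (torusProj x), h3, map_one])
    exact ⟨z, rfl⟩
  · rintro ⟨z, rfl⟩
    refine ⟨⟨_, (χ.mem_iff q _).mpr ⟨_, rfl⟩⟩, ?_, rfl⟩
    change covering q _ = 1
    rw [χ.covering_proj, torusProj_eq_one_iff.mpr ⟨z, rfl⟩, map_one]
    rfl

theorem finite_coveringKernel (χ : LinearChart K d e) [NeZero q] : Finite (coveringKernel q) := by
  have := finite_finiteImage q
  have h1 : coveringKernel q ≤ finiteImage q := by
    intro t ht
    obtain ⟨z, rfl⟩ := (χ.mem_coveringKernel_iff q t).mp ht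
    exact χ.proj_int_mem q z
  exact Finite.of_injective _ (Subgroup.inclusion_injective h1)

/-- The open unit cube injects even into the base torus, so its translates under distinct elements
of the covering kernel are disjoint. -/
theorem card_mul_le (χ : LinearChart K d e) [NeZero q] :
    Nat.card (coveringKernel q) * ideleMeasure q (χ.proj q '' Metric.ball 0 (1 / 2)) ≤
      ideleMeasure q (Subgroup.connectedComponentOfOne (ClassTorus q) : Set (ClassTorus q)) := by
  have := χ.finite_coveringKernel q
  have := Fintype.ofFinite (coveringKernel q)
  have hmeas : MeasurableSet (χ.proj q '' Metric.ball 0 (1 / 2)) :=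
    ((χ.isOpenMap_proj q) _ Metric.isOpen_ball).measurableSet
  have hdisj : Pairwise (Function.onFun Disjoint fun f : coveringKernel q =>
      ((f : ClassTorus q) * ·) ⁻¹' (χ.proj q '' Metric.ball 0 (1 / 2))) := by
    intro f f' hne
    refine Set.disjoint_left.mpr fun t ht ht' => hne ?_
    obtain ⟨x, hx, hxt⟩ := ht
    obtain ⟨x', hx', hxt'⟩ := ht'
    obtain ⟨z, hz⟩ := (χ.mem_coveringKernel_iff q _).mp f.2
    obtain ⟨z', hz'⟩ := (χ.mem_coveringKernel_iff q _).mp f'.2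
    have h1 : torusProj (x - x' - fun j => ((z j - z' j : ℤ) : ℝ)) = 1 := by
      refine χ.torusProj_eq_one_of_proj q ?_
      have h2 : (fun j => ((z j - z' j : ℤ) : ℝ)) =
          (fun j => (z j : ℝ)) - fun j => (z' j : ℝ) := by
        funext j
        simp
      rw [h2, map_sub_of_add (χ.proj_add q), map_sub_of_add (χ.proj_add q),
        map_sub_of_add (χ.proj_add q), hz, hz', hxt, hxt']
      group
    obtain ⟨m, hm⟩ := torusProj_eq_one_iff.mp h1
    have h2 : torusProj x = torusProj x' := by
      have h3 : x - x' = fun j => ((m j + (z j - z' j) : ℤ) : ℝ) := by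
        rw [sub_eq_iff_eq_add] at hm
        rw [hm]
        funext j
        simp
      have h4 := torusProj_add (x - x') x'
      rwa [sub_add_cancel, h3, torusProj_eq_one_iff.mpr ⟨_, rfl⟩, one_mul] at h4
    let _ : MeasurableSpace (Fin d → Circle) := borel _
    have : BorelSpace (Fin d → Circle) := ⟨rfl⟩
    have h3 : x = x' := injOn_ball_of_kernel (π := torusProj) torusProj_add
      (fun x hx => torusProj_eq_one_iff.mp hx) hx hx' h2
    rw [h3, hxt'] at hxt
    exact Subtype.ext (mul_right_cancel hxt).symm
  calc Nat.card (coveringKernel q) * ideleMeasure q (χ.proj q '' Metric.ball 0 (1 / 2)) =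
        ∑ f : coveringKernel q, ideleMeasure q
          (((f : ClassTorus q) * ·) ⁻¹' (χ.proj q '' Metric.ball 0 (1 / 2))) := by
        simp only [measure_preimage_mul, Finset.sum_const, Finset.card_univ, nsmul_eq_mul,
          Nat.card_eq_fintype_card]
    _ = ideleMeasure q (⋃ f : coveringKernel q,
          (((f : ClassTorus q) * ·) ⁻¹' (χ.proj q '' Metric.ball 0 (1 / 2)))) := by
        rw [measure_iUnion hdisj fun f => measurable_mul_left q _ hmeas, tsum_fintype]
    _ ≤ _ := by
        refine measure_mono (Set.iUnion_subset fun f t ht => ?_)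
        obtain ⟨x, hx, hxt⟩ := ht
        obtain ⟨z, hz⟩ := (χ.mem_coveringKernel_iff q _).mp f.2
        refine (χ.mem_iff q t).mpr ⟨x - fun j => (z j : ℝ), ?_⟩
        rw [map_sub_of_add (χ.proj_add q), hz, hxt]
        simp

/-- The floors of the coordinates give an element of the covering kernel, and the fractional parts
lie in a fixed ball whose volume bound does not involve q. -/
theorem le_card_mul (χ : LinearChart K d e) [NeZero q] :
    ideleMeasure q (Subgroup.connectedComponentOfOne (ClassTorus q) : Set (ClassTorus q)) ≤
      Nat.card (coveringKernel q) * χ.boxBound := by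
  have := χ.finite_coveringKernel q
  have := Fintype.ofFinite (coveringKernel q)
  have hcov : (Subgroup.connectedComponentOfOne (ClassTorus q) : Set (ClassTorus q)) ⊆
      ⋃ f : coveringKernel q,
        ((f : ClassTorus q)⁻¹ * ·) ⁻¹' (χ.proj q '' Metric.ball 0 2) := by
    intro t ht
    obtain ⟨x, rfl⟩ := (χ.mem_iff q t).mp ht
    refine Set.mem_iUnion.mpr ⟨⟨_, (χ.mem_coveringKernel_iff q _).mpr ⟨fun j => ⌊x j⌋, rfl⟩⟩,
      fun j => Int.fract (x j), fract_mem_ball _, ?_⟩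
    change _ = (χ.proj q _)⁻¹ * _
    rw [eq_inv_mul_iff_mul_eq, ← χ.proj_add]
    congr 1
    funext j
    exact Int.floor_add_fract _
  refine (measure_mono hcov).trans ((measure_iUnion_fintype_le _ _).trans ?_)
  simp only [measure_preimage_mul, Finset.sum_const, Finset.card_univ, nsmul_eq_mul,
    Nat.card_eq_fintype_card]
  gcongr
  exact χ.ideleMeasure_image_ball_le q

/-- The covering kernel depends on neither chart. Bounding the volume of T⁰ below with χ and above
with χ₀ and cancelling the order of the kernel leaves a bound independent of q and of e. -/
theorem ideleMeasure_image_half_ball_le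
    {e₀ : Subgroup.connectedComponentOfOne (BaseTorus K) ≃ₜ* (Fin d → Circle)}
    (χ₀ : LinearChart K d e₀) [NeZero q] :
    ideleMeasure q (χ.proj q '' Metric.ball 0 (1 / 2)) ≤ χ₀.boxBound := by
  have := χ.finite_coveringKernel q
  have h1 := (χ.card_mul_le q).trans (χ₀.le_card_mul q)
  exact (ENNReal.mul_le_mul_iff_right (by exact_mod_cast Nat.card_pos.ne')
    (ENNReal.natCast_ne_top _)).mp h1

end LinearChart

end IdeleTorus

namespace IdeleTorus

universe u

/-! ### Thin patches in linear coordinates -/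

variable {K : Type u} [Field K] [NumberField K] (q : Ideal (𝓞 K))

theorem zero_mem_of_torusProj_eq_one {d : ℕ} {C : Set (Fin d → ℝ)} {δ : ℝ} (hδ : δ < 1 / 4)
    (hC : C ⊆ Set.Icc (fun _ => -δ) (fun _ => δ)) {v : Fin d → ℝ} (hv : v ∈ C)
    (h1 : torusProj v = 1) : (0 : Fin d → ℝ) ∈ C := by
  obtain ⟨z, rfl⟩ := torusProj_eq_one_iff.mp h1
  have h2 : (fun j => (z j : ℝ)) = (0 : Fin d → ℝ) := by
    funext j
    have h3 : -δ ≤ (z j : ℝ) := (hC hv).1 j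
    have h4 : (z j : ℝ) ≤ δ := (hC hv).2 j
    have h5 : |(z j : ℝ)| < 1 := abs_lt.mpr ⟨by linarith, by linarith⟩
    have h6 : z j = 0 := Int.abs_lt_one_iff.mp (by exact_mod_cast h5)
    rw [h6, Int.cast_zero, Pi.zero_apply]
  rwa [h2] at hv

/-- A thin patch is a translate of the image of a convex set in linear coordinates. -/
theorem LinearChart.exists_convex_of_isThinPatch {d : ℕ}
    {e : Subgroup.connectedComponentOfOne (BaseTorus K) ≃ₜ* (Fin d → Circle)}
    (χ : LinearChart K d e) {δ : ℝ} (hδ : δ < 1 / 4) {P : Set (ClassTorus q)}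
    (hP : IsThinPatch q e δ P) :
    ∃ (p : ClassTorus q) (C : Set (Fin d → ℝ)), IsOpen C ∧ Convex ℝ C ∧ 0 ∈ C ∧
      C ⊆ Set.Icc (fun _ => -δ) (fun _ => δ) ∧ P = {t | p⁻¹ * t ∈ χ.proj q '' C} := by
  obtain ⟨hPo, -, t, htP, hinj, -, b, hb, C, hCo, hCc, hCδ, hbC⟩ := hP
  obtain ⟨p, hp, rfl⟩ := hb
  have hcov : ∀ x, covering q ⟨χ.proj q x, (χ.mem_iff q _).mpr ⟨x, rfl⟩⟩ =
      (e.symm (torusProj x) : BaseTorus K) := fun x => χ.covering_proj q x _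
  let ρ : (Fin d → ℝ) → Subgroup.connectedComponentOfOne (ClassTorus q) :=
    fun x => ⟨χ.proj q x, (χ.mem_iff q _).mpr ⟨x, rfl⟩⟩
  have hC0 : (0 : Fin d → ℝ) ∈ C := by
    have h1 : (1 : BaseTorus K) ∈ (fun v => ((e.symm (torusProj v) : _) : BaseTorus K)) '' C := by
      rw [← hbC, Set.mem_ofPred_eq, mul_one]
      exact ⟨p, hp, rfl⟩
    obtain ⟨v, hv, hv1⟩ := h1
    have h3 : e.symm (torusProj v) = 1 := Subtype.ext hv1
    exact zero_mem_of_torusProj_eq_one hδ hCδ hv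
      (by rw [← e.apply_symm_apply (torusProj v), h3, map_one])
  have hρ0 : ρ 0 = 1 := Subtype.ext (map_zero_of_add (χ.proj_add q))
  have hopen : ∀ u : Subgroup.connectedComponentOfOne (ClassTorus q),
      IsOpen {x | t * ((p * ρ x * u : Subgroup.connectedComponentOfOne (ClassTorus q)) :
        ClassTorus q) ∈ P} := by
    intro u
    refine hPo.preimage (f := fun x => t * (p * χ.proj q x * u)) ?_
    have := χ.continuous_proj q
    fun_prop
  -- Over C the patch splits into open sheets indexed by the elements u of the covering kernel, and
  -- injectivity separates the sheet u = 1 from the others. As C is connected and 0 lies in the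
  -- sheet u = 1, all of C lifts to that sheet.
  have hsub : C ⊆ {x | t * ((p * ρ x * 1 : Subgroup.connectedComponentOfOne (ClassTorus q)) :
      ClassTorus q) ∈ P} := by
    refine hCc.isPreconnected.subset_left_of_subset_union (hopen 1)
      (v := ⋃ u ∈ {u | covering q u = 1 ∧ u ≠ 1},
        {x | t * ((p * ρ x * u : Subgroup.connectedComponentOfOne (ClassTorus q)) :
          ClassTorus q) ∈ P})
      (isOpen_biUnion fun u _ => hopen u) ?_ ?_ ⟨0, hC0, ?_⟩
    · refine Set.disjoint_left.mpr fun x hx hx' => ?_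
      obtain ⟨u, ⟨hu1, hu2⟩, hxu⟩ := Set.mem_iUnion₂.mp hx'
      have h1 := hinj hx hxu (by rw [map_mul _ _ u, map_mul _ _ 1, hu1, map_one])
      exact hu2 (mul_left_cancel h1).symm
    · intro x hx
      have h1 : (e.symm (torusProj x) : BaseTorus K) ∈ {x : BaseTorus K | covering q p * x ∈
          covering q '' {y | t * (y : ClassTorus q) ∈ P}} := by
        rw [hbC]
        exact ⟨x, hx, rfl⟩
      obtain ⟨y, hy, hyx⟩ := h1
      have h2 : covering q ((p * ρ x)⁻¹ * y) = 1 := by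
        rw [map_mul, map_inv, hyx, map_mul, hcov, inv_mul_cancel]
      have h3 : p * ρ x * ((p * ρ x)⁻¹ * y) = y := mul_inv_cancel_left _ _
      by_cases h4 : (p * ρ x)⁻¹ * y = 1
      · refine Or.inl ?_
        rw [h4] at h3
        rw [Set.mem_ofPred_eq, h3]
        exact hy
      · refine Or.inr (Set.mem_iUnion₂.mpr ⟨_, ⟨h2, h4⟩, ?_⟩)
        rw [Set.mem_ofPred_eq, h3]
        exact hy
    · rw [Set.mem_ofPred_eq, hρ0, mul_one, mul_one]
      exact hp
  refine ⟨t * p, C, hCo, hCc, hC0, hCδ, Set.ext fun s => ⟨fun hs => ?_, ?_⟩⟩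
  · let y : Subgroup.connectedComponentOfOne (ClassTorus q) := ⟨t⁻¹ * s, htP s hs⟩
    have hy : t * (y : ClassTorus q) ∈ P := by
      rw [mul_inv_cancel_left]
      exact hs
    have h1 : (covering q p)⁻¹ * covering q y ∈
        (fun v => ((e.symm (torusProj v) : _) : BaseTorus K)) '' C := by
      rw [← hbC, Set.mem_ofPred_eq, mul_inv_cancel_left]
      exact ⟨y, hy, rfl⟩
    obtain ⟨x, hx, hxy⟩ := h1
    have h2 := hsub hx
    rw [Set.mem_ofPred_eq, mul_one] at h2
    -- Two points of the patch over the same point of the base coincide, so the lifted copy of C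
    -- exhausts the patch.
    have h3 : p * ρ x = y := hinj h2 hy (by
      rw [map_mul, hcov]
      exact (congrArg (covering q p * ·) hxy).trans (mul_inv_cancel_left _ _))
    refine ⟨x, hx, ?_⟩
    have h4 : (p : ClassTorus q) * χ.proj q x = t⁻¹ * s := congrArg Subtype.val h3
    rw [mul_inv_rev, mul_assoc, ← h4, inv_mul_cancel_left]
  · rintro ⟨x, hx, hxs⟩
    have h2 := hsub hx
    rw [Set.mem_ofPred_eq, mul_one] at h2
    have h3 : s = t * (p * χ.proj q x) := by
      rw [hxs]
      group
    rw [h3]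
    exact h2

theorem one_le_totient [NeZero q] : 1 ≤ totient q := by
  have := finite_quotient q
  exact Nat.card_pos

/-- If n ≥ 2 the exponent -(n - 2) is nonpositive and φ ≥ 1, so δ ≤ c₀. If n = 1 the exponent is
positive, but then there are no coordinates to bound. -/
theorem subset_closedBall_min {n d : ℕ} (hd : d = n - 1) (hn : n ≠ 0) {c₀ δ φ : ℝ} (hc₀ : 0 < c₀)
    (hδ0 : 0 < δ) (hφ : 1 ≤ φ) (hδ : δ ≤ c₀ * φ ^ (-((n : ℤ) - 2))) {C : Set (Fin d → ℝ)}
    (hC : C ⊆ Set.Icc (fun _ => -δ) (fun _ => δ)) : C ⊆ Metric.closedBall 0 (min δ c₀) := by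
  intro x hx
  rw [mem_closedBall_zero_iff, pi_norm_le_iff_of_nonneg (le_min hδ0.le hc₀.le)]
  intro j
  have hn2 : 2 ≤ n := by
    have := j.pos
    omega
  have h1 : φ ^ (-((n : ℤ) - 2)) ≤ 1 := zpow_le_one_of_nonpos₀ hφ (by omega)
  have h2 : δ ≤ c₀ := hδ.trans (mul_le_of_le_one_right hc₀.le h1)
  rw [min_eq_left h2]
  exact abs_le.mpr ⟨(hC hx).1 j, (hC hx).2 j⟩

end IdeleTorus
end

/-! ### The proposition: charts and constants put together -/

theorem propositionC1 (n : ℕ) :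
    ∃ c₀ C : ℝ, 0 < c₀ ∧ 0 < C ∧
      ∀ (K : Type*) [Field K] [NumberField K], Module.finrank ℚ K = n →
        ∃ C_K : ℝ, 0 < C_K ∧
          ∀ (e : Subgroup.connectedComponentOfOne (IdeleTorus.BaseTorus K) ≃ₜ*
              (Fin (n - 1) → Circle))
            (q : Ideal (𝓞 K)) [NeZero q] (M Y δ : ℝ) (P : Set (IdeleTorus.ClassTorus q)),
            1 < M → 2 ≤ Y → 0 < δ → δ < 1 / 4 →
            δ ≤ c₀ * (IdeleTorus.totient q : ℝ) ^ (-((n : ℤ) - 2)) →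
            IdeleTorus.IsThinPatch q e δ P →
            ∃ (Ξ : Finset (PontryaginDual (IdeleTorus.ClassTorus q)))
              (c : PontryaginDual (IdeleTorus.ClassTorus q) → ℂ)
              (G H : IdeleTorus.ClassTorus q → ℂ),
              (∀ x, P.indicator (fun _ => (1 : ℂ)) x =
                ∑ ψ ∈ Ξ, c ψ * ((ψ x : Circle) : ℂ) + G x + H x) ∧
              (∀ ψ, ψ ∉ Ξ → c ψ = 0) ∧
              (Ξ.card : ℝ) ≤ C_K * ((IdeleTorus.totient q : ℝ) * Y ^ (n - 1)) ∧
              (∀ ψ, ‖c ψ‖ ≤ 1) ∧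
              (∀ x, ‖G x‖ ≤ 1) ∧
              (∃ P' : Set (IdeleTorus.ClassTorus q),
                (∃ e' : Subgroup.connectedComponentOfOne (IdeleTorus.ClassTorus q) ≃ₜ*
                  (Fin (n - 1) → Circle), IdeleTorus.IsSmallConvex e' (1 / 4) P') ∧
                P ⊆ P' ∧ tsupport G ⊆ P' \ P ∧
                IdeleTorus.ideleMeasure q (P' \ P) ≤ ENNReal.ofReal (C / M)) ∧
              (∀ x, ‖H x‖ ≤ C * (M * (Real.log Y / Y))) ∧
              (∀ ψ : PontryaginDual (IdeleTorus.ClassTorus q),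
                (∀ t ∈ Subgroup.connectedComponentOfOne (IdeleTorus.ClassTorus q), ψ t = 1) →
                ∀ p ∈ P,
                  ‖c ψ - (((IdeleTorus.ideleMeasure q).real P /
                        (IdeleTorus.ideleMeasure q).real Set.univ : ℝ) : ℂ) *
                      (starRingEnd ℂ) ((ψ p : Circle) : ℂ)‖ ≤ C / M) := by
  obtain ⟨c₀, C, hc₀, hC, happrox⟩ := IdeleTorus.exists_approximation (n - 1)
  refine ⟨c₀, C, hc₀, hC, fun K _ _ hn => ?_⟩
  -- Without any trivialization of B⁰ the claim is vacuous. Otherwise a reference chart χ₀ is fixed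
  -- before e and q, so that V and `C_K` depend on K only.
  by_cases hne : Nonempty (Subgroup.connectedComponentOfOne (IdeleTorus.BaseTorus K) ≃ₜ*
    (Fin (n - 1) → Circle))
  swap
  · exact ⟨1, one_pos, fun e => (hne ⟨e⟩).elim⟩
  obtain ⟨e₀⟩ := hne
  obtain ⟨χ₀⟩ := IdeleTorus.nonempty_linearChart hn e₀
  have hn0 : n ≠ 0 := hn ▸ Module.finrank_pos.ne'
  have hV1 : 1 ≤ max 1 χ₀.boxBound.toReal := le_max_left _ _
  have hcb : (0 : ℝ) < IdeleTorus.componentBound K := by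
    exact_mod_cast IdeleTorus.componentBound_pos
  -- The character count with cutoff L = YV is 4^(n-1) · `componentBound K` · φ(q) · (YV)^(n-1),
  -- with V = max 1 (`χ₀.boxBound`); everything but φ(q) Y^(n-1) goes into the constant.
  refine ⟨4 ^ (n - 1) * IdeleTorus.componentBound K * max 1 χ₀.boxBound.toReal ^ (n - 1),
    by positivity, fun e q _ M Y δ P hM hY hδ0 hδ4 hδ hP => ?_⟩
  obtain ⟨χ⟩ := IdeleTorus.nonempty_linearChart hn e
  obtain ⟨p, D, hDo, hDc, hD0, hDδ, rfl⟩ := χ.exists_convex_of_isThinPatch q hδ4 hP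
  have := χ.compactSpace_classTorus q
  have := χ.isFiniteMeasure_ideleMeasure q
  have hφ : (1 : ℝ) ≤ IdeleTorus.totient q := by exact_mod_cast IdeleTorus.one_le_totient q
  have hvol : IdeleTorus.ideleMeasure q (χ.proj q '' Metric.ball 0 (1 / 2)) ≤
      ENNReal.ofReal (max 1 χ₀.boxBound.toReal) := by
    refine (χ.ideleMeasure_image_half_ball_le q χ₀).trans
      ((ENNReal.ofReal_toReal χ₀.boxBound_lt_top.ne).symm.le.trans ?_)
    exact ENNReal.ofReal_le_ofReal (le_max_right _ _)
  obtain ⟨Ξ, c, G, H, h1, h2, h3, h4⟩ := happrox (IdeleTorus.ideleMeasure q) (χ.proj q)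
    (χ.ideleMeasure_univ_ne_zero q) inferInstance (χ.continuous_proj q) (χ.isOpenMap_proj q)
    (χ.proj_add q) (χ.mem_iff q) (fun x hx => χ.exists_int_of_proj q hx) (χ.exists_torsion q)
    (max 1 χ₀.boxBound.toReal) _ hV1 hvol (fun L hL => χ.exists_characters q hL)
    M Y (min δ c₀) hM hY ((min_le_left _ _).trans_lt hδ4) (min_le_right _ _) D hDo hDc hD0
    (IdeleTorus.subset_closedBall_min rfl hn0 hc₀ hδ0 hφ hδ hDδ) p
  refine ⟨Ξ, c, G, H, h1, h2, h3.trans_eq ?_, h4⟩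
  rw [mul_pow]
  ring
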